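/- Let $\rho>0$ and $\delta>0$. Let $\chi\in\mathcal S(\mathbb R)$ be real valued and even, positive near $0$, with $\operatorname{supp}\widehat\chi\subset\{\delta<|t|<2\delta\}$, where $\widehat f(t)=\int_{\mathbb R} e^{-it\tau}f(\tau)\,d\tau$. Let $\psi\in C_c^\infty(\mathbb R)$ be real valued and even, with $\operatorname{supp}\psi\subset(-\frac12,\frac12)$ and $\operatorname{supp}(1-\psi)\subset(-\frac14,\frac14)^c$. Let $b$ be smooth and complex valued on $(0,\infty)$, with $$J_0(\zeta)=\operatorname{Re}\big(e^{i\zeta}b(\zeta)\big),\qquad |b^{(k)}(\zeta)|\le C_k(1+\zeta)^{-k-\frac12}\quad(\zeta>0,\ k\ge 0),$$ where $J_0$ is the Bessel function of order $0$. Put $\tilde\psi(\tau,w)=b(w(1-\tau))\psi(\tau)$ and let $\widehat{\tilde\psi}(\cdot,w)$ be its Fourier transform in $\tau$. For $\lambda\ge 1$, $\zeta>0$, $r_1,r_2>0$ define $$a_\lambda(\zeta)=\lambda^{\frac12}\int_{\mathbb R}\widehat\chi(s)\,\widehat{\tilde\psi}\big(\lambda(\zeta-s),\lambda\zeta\big)\,\lambda\,ds,\qquad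 D(r_1,r_2,s)=\big(r_1^2+r_2^2+2r_1r_2\cosh s\big)^{\frac12},$$ $$K(r_1,r_2,\theta)=\int_0^\infty e^{i\lambda D(r_1,r_2,s)}\,\frac{\sin(\theta/\rho)}{\cosh(s/\rho)-\cos(\theta/\rho)}\,a_\lambda\big(D(r_1,r_2,s)\big)\,ds,\qquad \theta\in\mathbb R/2\pi\rho\mathbb Z .$$ This integral converges absolutely for all $\lambda\ge1$, $r_1,r_2>0$ and $\theta$. Moreover, for $p=6$ and for $p=\infty$ there is a constant $C$, depending only on $p,\rho,\delta,\chi,\psi,b$, such that for every $\lambda\ge 1$ and every $g\in L^2\big((0,\infty)\times\mathbb R/2\pi\rho\mathbb Z,\ r\,dr\,d\theta\big)$ the integral below converges absolutely for almost every $(r_2,\theta_2)$ and $$\left\|\iint K(r_1,r_2,\theta_2-\theta_1)\,g(r_1,\theta_1)\,r_1\,dr_1\,d\theta_1\right\|_{L^p(r_2\,dr_2\,d\theta_2)}\le C\,\lambda^{-\frac2p}\,\|g\|_{L^2(r_1\,dr_1\,d\theta_1)},$$ with $2/p=0$ for $p=\infty$. -/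

import Mathlib

open Real Set Filter Topology MeasureTheory
open scoped SchwartzMap ContDiff ENNReal

noncomputable section

/-- A positive radius gives a positive circumference. -/
instance conePeriodPos (ρ : ℝ) [h : Fact (0 < ρ)] : Fact (0 < 2 * π * ρ) :=
  ⟨by have := h.out; positivity⟩

/-- The Euclidean cone of radius `ρ` in polar coordinates `(r, θ)`, with `θ ∈ ℝ / 2πρℤ`;
the radial variable is confined to `(0, ∞)` by the measure `coneMeasure`. -/
abbrev Cone (ρ : ℝ) : Type := ℝ × AddCircle (2 * π * ρ)

/-- The Riemannian measure `r dr dθ` on `(0, ∞) × ℝ / 2πρℤ`; here `dθ` has total mass `2πρ`. -/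
def coneMeasure (ρ : ℝ) [Fact (0 < ρ)] : Measure (Cone ρ) :=
  ((volume.restrict (Ioi (0 : ℝ))).withDensity fun r => ENNReal.ofReal r).prod volume

/-- The Fourier transform `f̂(t) = ∫ e^{-itτ} f(τ) dτ`. -/
def fourierHat (f : ℝ → ℂ) (t : ℝ) : ℂ :=
  ∫ τ : ℝ, Complex.exp (-(Complex.I * t * τ)) * f τ

/-- The Bessel function of order zero, `J₀(z) = (1/π) ∫₀^π cos(z cos t) dt`. -/
def besselJZero (z : ℝ) : ℝ := π⁻¹ * ∫ t in (0 : ℝ)..π, Real.cos (z * Real.cos t)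

/-- `b` is an oscillatory amplitude of `J₀`: on `(0, ∞)` it is smooth, `J₀(ζ) = Re (e^{iζ} b(ζ))`,
and `|b^{(k)}(ζ)| ≲_k (1 + ζ)^{-k-1/2}` for every `k ≥ 0`. -/
structure IsBesselAmplitude (b : ℝ → ℂ) : Prop where
  smooth : ContDiffOn ℝ ∞ b (Ioi 0)
  bessel_eq : ∀ ζ : ℝ, 0 < ζ → besselJZero ζ = (Complex.exp (Complex.I * ζ) * b ζ).re
  symbol_bound : ∀ k : ℕ, ∃ C : ℝ, ∀ ζ : ℝ, 0 < ζ →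
    ‖iteratedDeriv k b ζ‖ ≤ C * (1 + ζ) ^ (-(k : ℝ) - 1 / 2)

namespace BesselAmplitude

/-- `e^{-iζ(1 - cos t)}`. -/
def osc (ζ t : ℝ) : ℂ := Complex.exp (-(Complex.I * ζ * ((1 - Real.cos t : ℝ) : ℂ)))

/-- `∫₀^π w(t) (1 - cos t)^k e^{-iζ(1 - cos t)} dt`. -/
def oscInt (k : ℕ) (w : ℝ → ℝ) (ζ : ℝ) : ℂ :=
  ∫ t in (0 : ℝ)..π, ((w t * (1 - Real.cos t) ^ k : ℝ) : ℂ) * osc ζ t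

/-- Smooth weights vanishing near `t = π`. -/
def Weight (w : ℝ → ℝ) : Prop := ContDiff ℝ ∞ w ∧ ∀ t, Real.cos t < -(1 / 2) → w t = 0

/-- `w(t) tan(t/2)`. -/
def tanMul (w : ℝ → ℝ) (t : ℝ) : ℝ := w t * (Real.sin t / (1 + Real.cos t))

lemma norm_osc (ζ t : ℝ) : ‖osc ζ t‖ = 1 := by
  have : osc ζ t = Complex.exp (((-(ζ * (1 - Real.cos t)) : ℝ) : ℂ) * Complex.I) := by
    unfold osc; congr 1; push_cast; ring
  rw [this, Complex.norm_exp_ofReal_mul_I]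

lemma continuous_osc (ζ : ℝ) : Continuous (osc ζ) := by unfold osc; fun_prop

lemma hasDerivAt_osc_left (ζ t : ℝ) :
    HasDerivAt (fun z => osc z t) (-Complex.I * ((1 - Real.cos t : ℝ) : ℂ) * osc ζ t) ζ := by
  unfold osc
  have h1 : HasDerivAt (fun z : ℝ => (z : ℂ)) 1 ζ := Complex.ofRealCLM.hasDerivAt
  have := ((h1.const_mul Complex.I).mul_const ((1 - Real.cos t : ℝ) : ℂ)).neg.cexp
  exact this.congr_deriv (by simp only [Pi.neg_apply]; ring)

lemma hasDerivAt_osc_right (ζ t : ℝ) :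
    HasDerivAt (osc ζ) (-Complex.I * ζ * (Real.sin t : ℂ) * osc ζ t) t := by
  unfold osc
  have h1 : HasDerivAt (fun t => ((1 - Real.cos t : ℝ) : ℂ)) ((Real.sin t : ℝ) : ℂ) t := by
    have := ((Real.hasDerivAt_cos t).const_sub 1).ofReal_comp
    simpa using this
  have := (h1.const_mul (Complex.I * ζ)).neg.cexp
  exact this.congr_deriv (by simp only [Pi.neg_apply]; ring)

lemma hasDerivAt_oscInt (k : ℕ) {w : ℝ → ℝ} (hw : Continuous w) (ζ : ℝ) :
    HasDerivAt (oscInt k w) (-Complex.I * oscInt (k + 1) w ζ) ζ := by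
  obtain ⟨M, hM⟩ := (isCompact_Icc (a := (0:ℝ)) (b := π)).exists_bound_of_continuousOn
    (f := fun t => w t * (1 - Real.cos t) ^ (k + 1)) (by fun_prop)
  have hc : ∀ (j : ℕ) (z : ℝ),
      Continuous fun t => ((w t * (1 - Real.cos t) ^ j : ℝ) : ℂ) * osc z t := fun j z =>
    (Complex.continuous_ofReal.comp (by fun_prop)).mul (continuous_osc z)
  have key := (intervalIntegral.hasDerivAt_integral_of_dominated_loc_of_deriv_le (μ := volume)
    (F := fun z t => ((w t * (1 - Real.cos t) ^ k : ℝ) : ℂ) * osc z t)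
    (F' := fun z t => -Complex.I * (((w t * (1 - Real.cos t) ^ (k + 1) : ℝ) : ℂ) * osc z t))
    (x₀ := ζ) (a := 0) (b := π) (s := univ) (bound := fun _ => M) univ_mem
    (Eventually.of_forall fun z => (hc k z).aestronglyMeasurable)
    ((hc k ζ).intervalIntegrable _ _)
    (((hc (k + 1) ζ).const_mul _).aestronglyMeasurable)
    (ae_of_all _ fun t ht z _ => ?_) (by simp) (ae_of_all _ fun t ht z _ => ?_)).2
  · unfold oscInt
    rw [← intervalIntegral.integral_const_mul]
    exact key
  · rw [uIoc_of_le Real.pi_pos.le] at ht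
    rw [norm_mul, norm_mul, norm_osc, mul_one, norm_neg, Complex.norm_I, one_mul,
      Complex.norm_real]
    exact hM t ⟨ht.1.le, ht.2⟩
  · have := (hasDerivAt_osc_left z t).const_mul ((w t * (1 - Real.cos t) ^ k : ℝ) : ℂ)
    exact this.congr_deriv (by push_cast; ring)

lemma iteratedDeriv_oscInt {w : ℝ → ℝ} (hw : Continuous w) (c : ℂ) (k : ℕ) :
    iteratedDeriv k (fun ζ => c * oscInt 0 w ζ) =
      fun ζ => c * (-Complex.I) ^ k * oscInt k w ζ := by
  induction k with
  | zero => simp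
  | succ k ih =>
    rw [iteratedDeriv_succ, ih]
    funext ζ
    rw [((hasDerivAt_oscInt k hw ζ).const_mul _).deriv]
    ring

lemma contDiff_oscInt {w : ℝ → ℝ} (hw : Continuous w) (c : ℂ) :
    ContDiff ℝ ∞ (fun ζ => c * oscInt 0 w ζ) := by
  apply contDiff_of_differentiable_iteratedDeriv
  intro m _
  rw [iteratedDeriv_oscInt hw]
  exact fun ζ => ((hasDerivAt_oscInt m hw ζ).const_mul _).differentiableAt

lemma contDiff_tanMul {w : ℝ → ℝ} (hw : Weight w) : ContDiff ℝ ∞ (tanMul w) := by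
  rw [contDiff_iff_contDiffAt]
  intro t
  by_cases h : Real.cos t < -(1 / 2)
  · have : tanMul w =ᶠ[𝓝 t] fun _ => 0 := by
      filter_upwards [(isOpen_lt Real.continuous_cos continuous_const).mem_nhds h] with x hx
      simp [tanMul, hw.2 x hx]
    exact contDiffAt_const.congr_of_eventuallyEq this
  · have h0 : 1 + Real.cos t ≠ 0 := by push Not at h; linarith
    exact hw.1.contDiffAt.mul (Real.contDiff_sin.contDiffAt.div
      (contDiffAt_const.add Real.contDiff_cos.contDiffAt) h0)

lemma tanMul_zero_of {w : ℝ → ℝ} (hw : Weight w) {t : ℝ} (h : Real.cos t < -(1 / 2)) :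
    tanMul w t = 0 ∧ deriv (tanMul w) t = 0 := by
  have : tanMul w =ᶠ[𝓝 t] fun _ => 0 := by
    filter_upwards [(isOpen_lt Real.continuous_cos continuous_const).mem_nhds h] with x hx
    simp [tanMul, hw.2 x hx]
  exact ⟨this.eq_of_nhds, by rw [this.deriv_eq]; simp⟩

lemma tanMul_mul_sin {w : ℝ → ℝ} (hw : Weight w) (t : ℝ) :
    tanMul w t * Real.sin t = w t * (1 - Real.cos t) := by
  by_cases h : Real.cos t < -(1 / 2)
  · simp [tanMul, hw.2 t h]
  · have h0 : 1 + Real.cos t ≠ 0 := by push Not at h; linarith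
    unfold tanMul
    field_simp
    rw [Real.sin_sq]; ring

lemma weight_next {w : ℝ → ℝ} (hw : Weight w) (m : ℕ) :
    Weight (fun t => deriv (tanMul w) t + m * w t) := by
  refine ⟨?_, fun t ht => by simp [(tanMul_zero_of hw ht).2, hw.2 t ht]⟩
  have h : ContDiff ℝ ∞ (deriv (tanMul w)) :=
    (contDiff_infty_iff_deriv.1 (contDiff_tanMul hw)).2
  exact h.add (contDiff_const.mul hw.1)

lemma hasDerivAt_tanMul {w : ℝ → ℝ} (hw : Weight w) (t : ℝ) :
    HasDerivAt (tanMul w) (deriv (tanMul w) t) t :=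
  ((contDiff_tanMul hw).differentiable (by simp) t).hasDerivAt

lemma oscInt_succ {w : ℝ → ℝ} (hw : Weight w) (m : ℕ) (ζ : ℝ) :
    Complex.I * ζ * oscInt (m + 1) w ζ =
      oscInt m (fun t => deriv (tanMul w) t + m * w t) ζ := by
  have hW := weight_next hw m
  have hc : ∀ (j : ℕ) (v : ℝ → ℝ), Continuous v →
      Continuous fun t => ((v t * (1 - Real.cos t) ^ j : ℝ) : ℂ) * osc ζ t := fun j v hv =>
    (Complex.continuous_ofReal.comp (by fun_prop)).mul (continuous_osc ζ)
  have hd : ∀ t, HasDerivAt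
      (fun t => ((tanMul w t * (1 - Real.cos t) ^ m : ℝ) : ℂ) * osc ζ t)
      ((((deriv (tanMul w) t + m * w t) * (1 - Real.cos t) ^ m : ℝ) : ℂ) * osc ζ t -
        Complex.I * ζ * (((w t * (1 - Real.cos t) ^ (m + 1) : ℝ) : ℂ) * osc ζ t)) t := by
    intro t
    have h2 := (((hasDerivAt_tanMul hw t).mul
      (((Real.hasDerivAt_cos t).const_sub 1).pow m)).ofReal_comp).mul (hasDerivAt_osc_right ζ t)
    refine h2.congr_deriv ?_
    have e := tanMul_mul_sin hw t
    have e1 : tanMul w t * (m * (1 - Real.cos t) ^ (m - 1) * Real.sin t) =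
        m * w t * (1 - Real.cos t) ^ m := by
      rcases m with _ | m
      · simp
      · simp only [Nat.add_sub_cancel]
        linear_combination ((m + 1 : ℕ) : ℝ) * (1 - Real.cos t) ^ m * e
    have e2 : ((tanMul w t : ℝ) : ℂ) * (Real.sin t : ℂ) = (w t : ℂ) * ((1 - Real.cos t : ℝ) : ℂ) := by
      exact_mod_cast e
    have e3 := congrArg (fun x : ℝ => (x : ℂ)) e1
    push_cast at e2 e3 ⊢
    simp only [Pi.mul_apply, Pi.pow_apply]
    push_cast
    linear_combination (osc ζ t) * e3 -
      Complex.I * ζ * (1 - Complex.cos t) ^ m * osc ζ t * e2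
  have hint := intervalIntegral.integral_eq_sub_of_hasDerivAt (a := 0) (b := π)
    (fun t _ => hd t) (((hc m _ hW.1.continuous).sub
      ((hc (m + 1) w hw.1.continuous).const_mul _)).intervalIntegrable _ _)
  have h0 : tanMul w 0 = 0 := by simp [tanMul]
  have hπ : tanMul w π = 0 := (tanMul_zero_of hw (by rw [Real.cos_pi]; norm_num)).1
  rw [h0, hπ, intervalIntegral.integral_sub ((hc m _ hW.1.continuous).intervalIntegrable _ _)
    (((hc (m + 1) w hw.1.continuous).const_mul _).intervalIntegrable _ _),
    intervalIntegral.integral_const_mul] at hint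
  unfold oscInt
  simp only [zero_mul, Complex.ofReal_zero, sub_zero] at hint
  exact (sub_eq_zero.1 hint).symm

lemma norm_oscInt_le {w : ℝ → ℝ} (hw : Continuous w) (k : ℕ) :
    ∃ C : ℝ, 0 ≤ C ∧ ∀ ζ, ‖oscInt k w ζ‖ ≤ C := by
  obtain ⟨M, hM⟩ := (isCompact_Icc (a := (0:ℝ)) (b := π)).exists_bound_of_continuousOn
    (f := fun t => w t * (1 - Real.cos t) ^ k) (by fun_prop)
  have h : ∀ ζ, ‖oscInt k w ζ‖ ≤ M * |π - 0| := fun ζ => by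
    apply intervalIntegral.norm_integral_le_of_norm_le_const
    intro t ht
    rw [uIoc_of_le Real.pi_pos.le] at ht
    rw [norm_mul, norm_osc, mul_one, Complex.norm_real]
    exact hM t ⟨ht.1.le, ht.2⟩
  exact ⟨_, (norm_nonneg _).trans (h 0), h⟩


lemma norm_oscInt_zero_le {w : ℝ → ℝ} (hw : Weight w) :
    ∃ C : ℝ, ∀ ζ, 1 ≤ ζ → ‖oscInt 0 w ζ‖ ≤ C * ζ ^ (-(1 / 2) : ℝ) := by
  have hTd : Continuous (deriv (tanMul w)) :=
    ((contDiff_infty_iff_deriv.1 (contDiff_tanMul hw)).2).continuous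
  have hwc := hw.1.continuous
  obtain ⟨M, hM⟩ := (isCompact_Icc (a := (0:ℝ)) (b := π)).exists_bound_of_continuousOn
    (f := w) (by fun_prop)
  obtain ⟨N, hN⟩ := (isCompact_Icc (a := (0:ℝ)) (b := π)).exists_bound_of_continuousOn
    (f := fun t => deriv (tanMul w) t - w t) (by fun_prop)
  obtain ⟨L, hL⟩ := (isCompact_Icc (a := (0:ℝ)) (b := π)).exists_bound_of_continuousOn
    (f := deriv (tanMul w)) (by fun_prop)
  have hN0 : 0 ≤ N := (norm_nonneg _).trans (hN 0 ⟨le_rfl, Real.pi_pos.le⟩)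
  have hL0 : 0 ≤ L := (norm_nonneg _).trans (hL 0 ⟨le_rfl, Real.pi_pos.le⟩)
  have hcos : ∀ t ∈ Icc (0 : ℝ) π, 2 / π ^ 2 * t ^ 2 ≤ 1 - Real.cos t := fun t ht => by
    have := Real.cos_le_one_sub_mul_cos_sq (x := t) (by rw [abs_of_nonneg ht.1]; exact ht.2)
    linarith
  refine ⟨M + (L * (π ^ 2 / 2) + N * (π ^ 2 / 2)), fun ζ hζ => ?_⟩
  have hζ0 : 0 < ζ := by linarith
  set ε : ℝ := ζ ^ (-(1 / 2) : ℝ) with hε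
  have hε0 : 0 < ε := Real.rpow_pos_of_pos hζ0 _
  have hε1 : ε ≤ 1 := Real.rpow_le_one_of_one_le_of_nonpos hζ (by norm_num)
  have hεπ : ε ≤ π := by linarith [Real.pi_gt_three]
  have hε2 : ε ^ 2 * ζ = 1 := by
    rw [hε, ← Real.rpow_natCast, ← Real.rpow_mul hζ0.le]
    norm_num
    rw [Real.rpow_neg_one]; field_simp
  have hc : Continuous fun t => ((w t : ℝ) : ℂ) * osc ζ t :=
    (Complex.continuous_ofReal.comp hwc).mul (continuous_osc ζ)
  have hsplit : oscInt 0 w ζ = (∫ t in (0 : ℝ)..ε, (w t : ℂ) * osc ζ t) +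
      ∫ t in ε..π, (w t : ℂ) * osc ζ t := by
    rw [intervalIntegral.integral_add_adjacent_intervals (hc.intervalIntegrable _ _)
      (hc.intervalIntegrable _ _)]
    simp [oscInt]
  have h1 : ‖∫ t in (0 : ℝ)..ε, (w t : ℂ) * osc ζ t‖ ≤ M * ε := by
    have := intervalIntegral.norm_integral_le_of_norm_le_const (a := 0) (b := ε) (C := M)
      (f := fun t => (w t : ℂ) * osc ζ t) (fun t ht => by
        rw [uIoc_of_le hε0.le] at ht
        rw [norm_mul, norm_osc, mul_one, Complex.norm_real]
        exact hM t ⟨ht.1.le, ht.2.trans hεπ⟩)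
    rwa [sub_zero, abs_of_pos hε0] at this
  have hpos : ∀ t ∈ Icc ε π, 0 < 1 - Real.cos t := fun t ht =>
    lt_of_lt_of_le (by have := hε0.trans_le ht.1; positivity) (hcos t ⟨hε0.le.trans ht.1, ht.2⟩)
  have hinv : ∀ t ∈ Icc ε π, (1 - Real.cos t)⁻¹ ≤ π ^ 2 / 2 * (t ^ 2)⁻¹ := fun t ht => by
    have ht0 := hε0.trans_le ht.1
    have := inv_anti₀ (by positivity) (hcos t ⟨ht0.le, ht.2⟩)
    refine this.trans (le_of_eq ?_)
    field_simp
  -- the boundary function and its derivative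
  have hd : ∀ t ∈ uIcc ε π, HasDerivAt
      (fun t => ((tanMul w t * (1 - Real.cos t)⁻¹ : ℝ) : ℂ) * osc ζ t)
      ((((deriv (tanMul w) t - w t) * (1 - Real.cos t)⁻¹ : ℝ) : ℂ) * osc ζ t -
        Complex.I * ζ * ((w t : ℂ) * osc ζ t)) t := by
    intro t ht
    rw [uIcc_of_le hεπ] at ht
    have hne := (hpos t ht).ne'
    have h2 := (((hasDerivAt_tanMul hw t).mul
      (((Real.hasDerivAt_cos t).const_sub 1).inv hne)).ofReal_comp).mul (hasDerivAt_osc_right ζ t)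
    refine h2.congr_deriv ?_
    have e := tanMul_mul_sin hw t
    have e1 : deriv (tanMul w) t * (1 - Real.cos t)⁻¹ +
        tanMul w t * (-(- -Real.sin t) / (1 - Real.cos t) ^ 2) =
        (deriv (tanMul w) t - w t) * (1 - Real.cos t)⁻¹ := by
      field_simp
      linear_combination -e
    have e2 : tanMul w t * (1 - Real.cos t)⁻¹ * Real.sin t = w t := by
      field_simp
      linear_combination e
    have e3 := congrArg (fun x : ℝ => (x : ℂ)) e1
    have e4 := congrArg (fun x : ℝ => (x : ℂ)) e2
    simp only [Pi.mul_apply, Pi.inv_apply]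
    push_cast at e3 e4 ⊢
    linear_combination (osc ζ t) * e3 - Complex.I * ζ * osc ζ t * e4
  have hcA : ContinuousOn (fun t => (((deriv (tanMul w) t - w t) * (1 - Real.cos t)⁻¹ : ℝ) : ℂ) *
      osc ζ t) (uIcc ε π) := by
    rw [uIcc_of_le hεπ]
    refine ContinuousOn.mul (Complex.continuous_ofReal.comp_continuousOn ?_)
      (continuous_osc ζ).continuousOn
    refine ContinuousOn.mul (by fun_prop) (ContinuousOn.inv₀ (by fun_prop) fun t ht => (hpos t ht).ne')
  have hint := intervalIntegral.integral_eq_sub_of_hasDerivAt hd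
    (hcA.intervalIntegrable.sub ((hc.const_mul _).intervalIntegrable _ _))
  rw [intervalIntegral.integral_sub hcA.intervalIntegrable ((hc.const_mul _).intervalIntegrable _ _),
    intervalIntegral.integral_const_mul,
    (tanMul_zero_of hw (t := π) (by rw [Real.cos_pi]; norm_num)).1] at hint
  have hA : ‖∫ t in ε..π, (((deriv (tanMul w) t - w t) * (1 - Real.cos t)⁻¹ : ℝ) : ℂ) * osc ζ t‖ ≤
      N * (π ^ 2 / 2) * ε⁻¹ := by
    have hgi : IntervalIntegrable (fun t : ℝ => N * (π ^ 2 / 2) * (t ^ 2)⁻¹) volume ε π := by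
      apply ContinuousOn.intervalIntegrable
      rw [uIcc_of_le hεπ]
      exact continuousOn_const.mul (ContinuousOn.inv₀ (by fun_prop) fun t ht => by
        have := hε0.trans_le ht.1; positivity)
    refine (intervalIntegral.norm_integral_le_of_norm_le hεπ (ae_of_all _ fun t ht => ?_) hgi).trans ?_
    · have ht' : t ∈ Icc ε π := ⟨ht.1.le, ht.2⟩
      rw [norm_mul, norm_osc, mul_one, Complex.norm_real, norm_mul, mul_assoc,
        Real.norm_of_nonneg (inv_nonneg.2 (hpos t ht').le)]
      exact mul_le_mul (hN t ⟨hε0.le.trans ht'.1, ht.2⟩) (hinv t ht')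
        (inv_nonneg.2 (hpos t ht').le) hN0
    · rw [intervalIntegral.integral_const_mul]
      have hi : ∫ t in ε..π, ((t : ℝ) ^ 2)⁻¹ = ε⁻¹ - π⁻¹ := by
        have := intervalIntegral.integral_eq_sub_of_hasDerivAt (a := ε) (b := π)
          (f := fun t : ℝ => -t⁻¹) (f' := fun t => (t ^ 2)⁻¹) (fun t ht => by
            rw [uIcc_of_le hεπ] at ht
            have := (hasDerivAt_inv (hε0.trans_le ht.1).ne').neg
            exact this.congr_deriv (by simp)) (by
            apply ContinuousOn.intervalIntegrable
            rw [uIcc_of_le hεπ]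
            exact (ContinuousOn.inv₀ (by fun_prop) fun t ht => by
              have := hε0.trans_le ht.1; positivity))
        rw [this]; ring
      rw [hi]
      have : ε⁻¹ - π⁻¹ ≤ ε⁻¹ := by have := Real.pi_pos; linarith [inv_pos.2 this]
      gcongr
  have hT : ‖tanMul w ε‖ ≤ L * ε := by
    have := (convex_Icc (0 : ℝ) π).norm_image_sub_le_of_norm_deriv_le (f := tanMul w) (C := L)
      (fun x _ => (hasDerivAt_tanMul hw x).differentiableAt) (fun x hx => hL x hx)
      (x := 0) (y := ε) ⟨le_rfl, Real.pi_pos.le⟩ ⟨hε0.le, hεπ⟩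
    have h0 : tanMul w 0 = 0 := by simp [tanMul]
    rwa [h0, sub_zero, sub_zero, Real.norm_of_nonneg hε0.le] at this
  have hB : ‖((tanMul w ε * (1 - Real.cos ε)⁻¹ : ℝ) : ℂ) * osc ζ ε‖ ≤ L * (π ^ 2 / 2) * ε⁻¹ := by
    have hm : ε ∈ Icc ε π := ⟨le_rfl, hεπ⟩
    rw [norm_mul, norm_osc, mul_one, Complex.norm_real, norm_mul,
        Real.norm_of_nonneg (inv_nonneg.2 (hpos ε hm).le)]
    refine (mul_le_mul hT (hinv ε hm) (inv_nonneg.2 (hpos ε hm).le) (by positivity)).trans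
      (le_of_eq ?_)
    field_simp
  have hI : ζ * ‖∫ t in ε..π, (w t : ℂ) * osc ζ t‖ ≤
      (L * (π ^ 2 / 2) + N * (π ^ 2 / 2)) * ε⁻¹ := by
    have e : Complex.I * ζ * (∫ t in ε..π, (w t : ℂ) * osc ζ t) =
        (∫ t in ε..π, (((deriv (tanMul w) t - w t) * (1 - Real.cos t)⁻¹ : ℝ) : ℂ) * osc ζ t) +
        ((tanMul w ε * (1 - Real.cos ε)⁻¹ : ℝ) : ℂ) * osc ζ ε := by
      simp only [zero_mul, Complex.ofReal_zero, zero_sub] at hint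
      linear_combination -hint
    have e' : ζ * ‖∫ t in ε..π, (w t : ℂ) * osc ζ t‖ =
        ‖Complex.I * ζ * (∫ t in ε..π, (w t : ℂ) * osc ζ t)‖ := by
      rw [norm_mul, norm_mul, Complex.norm_I, one_mul, Complex.norm_real,
        Real.norm_of_nonneg hζ0.le]
    rw [e', e]
    refine (norm_add_le _ _).trans ?_
    linarith
  have h2 : ‖∫ t in ε..π, (w t : ℂ) * osc ζ t‖ ≤ (L * (π ^ 2 / 2) + N * (π ^ 2 / 2)) * ε := by
    have hz : ζ = (ε ^ 2)⁻¹ := by field_simp; linarith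
    have := mul_le_mul_of_nonneg_left hI (sq_nonneg ε)
    calc ‖∫ t in ε..π, (w t : ℂ) * osc ζ t‖
        = ε ^ 2 * (ζ * ‖∫ t in ε..π, (w t : ℂ) * osc ζ t‖) := by
          rw [← mul_assoc, hε2, one_mul]
      _ ≤ ε ^ 2 * ((L * (π ^ 2 / 2) + N * (π ^ 2 / 2)) * ε⁻¹) := this
      _ = _ := by field_simp
  rw [hsplit]
  refine (norm_add_le _ _).trans ?_
  linarith

lemma norm_oscInt_decay (k : ℕ) : ∀ {w : ℝ → ℝ}, Weight w →
    ∃ C : ℝ, ∀ ζ, 1 ≤ ζ → ‖oscInt k w ζ‖ ≤ C * ζ ^ (-(k : ℝ) - 1 / 2) := by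
  induction k with
  | zero =>
    intro w hw
    simpa using norm_oscInt_zero_le hw
  | succ k ih =>
    intro w hw
    obtain ⟨C, hC⟩ := ih (weight_next hw k)
    refine ⟨C, fun ζ hζ => ?_⟩
    have hζ0 : 0 < ζ := by linarith
    have e := congrArg norm (oscInt_succ hw k ζ)
    rw [norm_mul, norm_mul, Complex.norm_I, one_mul, Complex.norm_real,
        Real.norm_of_nonneg hζ0.le] at e
    have h : ‖oscInt (k + 1) w ζ‖ = ζ⁻¹ * ‖oscInt k (fun t => deriv (tanMul w) t + k * w t) ζ‖ := by
      rw [← e]; field_simp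
    rw [h]
    calc _ ≤ ζ⁻¹ * (C * ζ ^ (-(k : ℝ) - 1 / 2)) := by gcongr; exact hC ζ hζ
      _ = C * (ζ ^ (-1 : ℝ) * ζ ^ (-(k : ℝ) - 1 / 2)) := by rw [Real.rpow_neg_one]; ring
      _ = _ := by
        rw [← Real.rpow_add hζ0]; congr 2; push_cast; ring

lemma norm_oscInt_symbol (k : ℕ) {w : ℝ → ℝ} (hw : Weight w) :
    ∃ C : ℝ, ∀ ζ, 0 < ζ → ‖oscInt k w ζ‖ ≤ C * (1 + ζ) ^ (-(k : ℝ) - 1 / 2) := by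
  obtain ⟨A, hA0, hA⟩ := norm_oscInt_le hw.1.continuous k
  obtain ⟨B, hB⟩ := norm_oscInt_decay k hw
  set a : ℝ := (k : ℝ) + 1 / 2 with ha
  have ha0 : 0 < a := by positivity
  have hneg : -(k : ℝ) - 1 / 2 = -a := by rw [ha]; ring
  rw [hneg] at hB ⊢
  have hB0 : 0 ≤ B := by simpa using (norm_nonneg _).trans (hB 1 le_rfl)
  refine ⟨(A + B) * 2 ^ a, fun ζ hζ => ?_⟩
  have key : ∀ x : ℝ, 0 < x → 1 + ζ ≤ 2 * x → x ^ (-a) ≤ 2 ^ a * (1 + ζ) ^ (-a) := by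
    intro x hx hle
    have := Real.rpow_le_rpow_of_nonpos (by linarith) hle (neg_nonpos.2 ha0.le)
    rw [Real.mul_rpow (by norm_num) hx.le] at this
    calc x ^ (-a) = 2 ^ a * (2 ^ (-a) * x ^ (-a)) := by
          rw [← mul_assoc, ← Real.rpow_add (by norm_num)]; simp
      _ ≤ _ := by gcongr
  have hp : 0 ≤ (2 : ℝ) ^ a * (1 + ζ) ^ (-a) := by positivity
  rcases le_total ζ 1 with h | h
  · have h1 := key 1 one_pos (by linarith)
    rw [Real.one_rpow] at h1
    calc _ ≤ A * 1 := by rw [mul_one]; exact hA ζ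
      _ ≤ (A + B) * (2 ^ a * (1 + ζ) ^ (-a)) := by gcongr; linarith
      _ = _ := by ring
  · calc _ ≤ B * ζ ^ (-a) := hB ζ h
      _ ≤ (A + B) * (2 ^ a * (1 + ζ) ^ (-a)) := by gcongr; · linarith
                                                   · exact key ζ hζ (by linarith)
      _ = _ := by ring

/-- The cutoff in `t` separating the two critical points `t = 0` and `t = π`. -/
def cut (t : ℝ) : ℝ := Real.smoothTransition (Real.cos t + 1 / 2)

lemma weight_cut : Weight cut :=
  ⟨Real.smoothTransition.contDiff.comp (Real.contDiff_cos.add contDiff_const),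
    fun t ht => Real.smoothTransition.zero_of_nonpos (by linarith)⟩

lemma cut_add (t : ℝ) : cut t + cut (π - t) = 1 := by
  unfold cut
  rw [Real.cos_pi_sub]
  have e : -Real.cos t + 1 / 2 = 1 - (Real.cos t + 1 / 2) := by ring
  rw [e]
  have h := Real.smoothTransition.pos_denom (Real.cos t + 1 / 2)
  unfold Real.smoothTransition
  rw [sub_sub_cancel, add_comm (expNegInvGlue (1 - _)), ← add_div, div_self h.ne']

end BesselAmplitude

open BesselAmplitude in
/-- `J₀` has an oscillatory amplitude, so `IsBesselAmplitude` is not an empty condition. -/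
theorem exists_isBesselAmplitude : ∃ b : ℝ → ℂ, IsBesselAmplitude b := by
  refine ⟨fun ζ => ((2 / π : ℝ) : ℂ) * oscInt 0 cut ζ, ?_, ?_, ?_⟩
  · exact (contDiff_oscInt weight_cut.1.continuous _).contDiffOn
  · intro ζ _
    have hc := weight_cut.1.continuous
    have hcR : Continuous fun t => cut t * Real.cos (ζ * Real.cos t) := by fun_prop
    have h1 : (Complex.exp (Complex.I * ζ) * (((2 / π : ℝ) : ℂ) * oscInt 0 cut ζ)).re =
        2 / π * ∫ t in (0 : ℝ)..π, cut t * Real.cos (ζ * Real.cos t) := by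
      have e : Complex.exp (Complex.I * ζ) * (((2 / π : ℝ) : ℂ) * oscInt 0 cut ζ) =
          ((2 / π : ℝ) : ℂ) * ∫ t in (0 : ℝ)..π,
            (cut t : ℂ) * Complex.exp (((ζ * Real.cos t : ℝ) : ℂ) * Complex.I) := by
        rw [mul_left_comm]
        congr 1
        unfold oscInt
        rw [← intervalIntegral.integral_const_mul]
        congr 1
        funext t
        rw [pow_zero, mul_one, mul_left_comm]
        unfold osc
        rw [← Complex.exp_add]
        congr 2
        push_cast; ring
      rw [e, Complex.re_ofReal_mul]
      congr 1
      have hci : IntervalIntegrable (fun t => (cut t : ℂ) *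
          Complex.exp (((ζ * Real.cos t : ℝ) : ℂ) * Complex.I)) volume 0 π := by
        apply Continuous.intervalIntegrable
        have := Complex.continuous_ofReal.comp hc
        fun_prop
      have := Complex.reCLM.intervalIntegral_comp_comm hci
      simp only [Complex.reCLM_apply] at this
      rw [← this]
      congr 1
      funext t
      rw [Complex.re_ofReal_mul, Complex.exp_ofReal_mul_I_re]
    have h2 : ∫ t in (0 : ℝ)..π, cut (π - t) * Real.cos (ζ * Real.cos t) =
        ∫ t in (0 : ℝ)..π, cut t * Real.cos (ζ * Real.cos t) := by
      have := intervalIntegral.integral_comp_sub_left (a := 0) (b := π)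
        (fun t => cut t * Real.cos (ζ * Real.cos t)) π
      simp only [Real.cos_pi_sub, mul_neg, Real.cos_neg, sub_self, sub_zero] at this
      exact this
    have h3 : ∫ t in (0 : ℝ)..π, Real.cos (ζ * Real.cos t) =
        2 * ∫ t in (0 : ℝ)..π, cut t * Real.cos (ζ * Real.cos t) := by
      have hcR' : Continuous fun t => cut (π - t) * Real.cos (ζ * Real.cos t) := by fun_prop
      rw [two_mul]
      nth_rewrite 2 [← h2]
      rw [← intervalIntegral.integral_add (hcR.intervalIntegrable _ _)
        (hcR'.intervalIntegrable _ _)]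
      congr 1
      funext t
      rw [← add_mul, cut_add, one_mul]
    rw [h1, besselJZero, h3]
    ring
  · intro k
    obtain ⟨C, hC⟩ := norm_oscInt_symbol k weight_cut
    refine ⟨2 / π * C, fun ζ hζ => ?_⟩
    rw [iteratedDeriv_oscInt weight_cut.1.continuous, norm_mul, norm_mul, norm_pow, norm_neg,
      Complex.norm_I, one_pow, mul_one, Complex.norm_real,
      Real.norm_of_nonneg (by positivity), mul_assoc]
    gcongr
    exact hC ζ hζ

/-- The frequency cutoff `χ`: an even, real valued Schwartz function, positive near `0`, whose
Fourier transform is supported in `{δ < |t| < 2δ}`. -/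
structure IsSpectralCutoff (δ : ℝ) (χ : 𝓢(ℝ, ℝ)) : Prop where
  even : ∀ τ : ℝ, χ (-τ) = χ τ
  pos_near_zero : ∀ᶠ τ in 𝓝 (0 : ℝ), 0 < χ τ
  tsupport_hat : tsupport (fourierHat fun τ => (χ τ : ℂ)) ⊆ {t : ℝ | δ < |t| ∧ |t| < 2 * δ}

/-- The smooth even bump function `ψ`, supported in `(-1/2, 1/2)`, such that the support
of `1 - ψ` lies in the complement of `(-1/4, 1/4)`. -/
structure IsUnitBump (ψ : ℝ → ℝ) : Prop where
  smooth : ContDiff ℝ ∞ ψ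
  even : ∀ τ : ℝ, ψ (-τ) = ψ τ
  tsupport_subset : tsupport ψ ⊆ Ioo (-(1 / 2)) (1 / 2)
  tsupport_one_sub : tsupport (fun τ => 1 - ψ τ) ⊆ (Ioo (-(1 / 4)) (1 / 4))ᶜ

/-- `ψ̃(τ, w) = b(w(1 - τ)) ψ(τ)`. -/
def psiTilde (ψ : ℝ → ℝ) (b : ℝ → ℂ) (τ w : ℝ) : ℂ := b (w * (1 - τ)) * ψ τ

/-- The amplitude
`a_λ(ζ) = λ^{1/2} ∫ χ̂(s) ψ̃^(λ(ζ - s), λζ) λ ds`,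
the hat on `ψ̃` being the Fourier transform in the first variable. The factor `λ^{1/2}` normalizes
`a_λ` to size `O(1)`: the integral by itself is `O(λ^{-1/2})`. -/
def diffAmplitude (χ : 𝓢(ℝ, ℝ)) (ψ : ℝ → ℝ) (b : ℝ → ℂ) (lam ζ : ℝ) : ℂ :=
  ((lam ^ (1 / 2 : ℝ) : ℝ) : ℂ) *
    ∫ s : ℝ, fourierHat (fun τ => (χ τ : ℂ)) s *
      fourierHat (fun τ => psiTilde ψ b τ (lam * ζ)) (lam * (ζ - s)) * lam

/-- `D(r₁, r₂, s) = (r₁² + r₂² + 2 r₁ r₂ cosh s)^{1/2}`. -/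
def diffPhase (r₁ r₂ s : ℝ) : ℝ := √(r₁ ^ 2 + r₂ ^ 2 + 2 * r₁ * r₂ * Real.cosh s)

/-- The integrand, in `s`, of the diffractive kernel. -/
def diffIntegrand (ρ : ℝ) (χ : 𝓢(ℝ, ℝ)) (ψ : ℝ → ℝ) (b : ℝ → ℂ) (lam r₁ r₂ θ s : ℝ) : ℂ :=
  Complex.exp (Complex.I * lam * diffPhase r₁ r₂ s) *
    ((Real.sin (θ / ρ) / (Real.cosh (s / ρ) - Real.cos (θ / ρ)) : ℝ) : ℂ) *
    diffAmplitude χ ψ b lam (diffPhase r₁ r₂ s)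

/-- The diffractive kernel `K(r₁, r₂, θ)`, for a real angle `θ`. -/
def diffKernel (ρ : ℝ) (χ : 𝓢(ℝ, ℝ)) (ψ : ℝ → ℝ) (b : ℝ → ℂ) (lam r₁ r₂ θ : ℝ) : ℂ :=
  ∫ s in Ioi (0 : ℝ), diffIntegrand ρ χ ψ b lam r₁ r₂ θ s

theorem diffKernel_periodic (ρ : ℝ) [h : Fact (0 < ρ)] (χ : 𝓢(ℝ, ℝ)) (ψ : ℝ → ℝ) (b : ℝ → ℂ)
    (lam r₁ r₂ : ℝ) :
    Function.Periodic (diffKernel ρ χ ψ b lam r₁ r₂) (2 * π * ρ) := by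
  intro θ
  have hρ : ρ ≠ 0 := h.out.ne'
  have e : (θ + 2 * π * ρ) / ρ = θ / ρ + 2 * π := by field_simp
  simp only [diffKernel, diffIntegrand, e, Real.sin_add_two_pi, Real.cos_add_two_pi]

/-- The diffractive kernel `K(r₁, r₂, θ)` as a function of `θ ∈ ℝ / 2πρℤ`. -/
def diffKernelCircle (ρ : ℝ) [Fact (0 < ρ)] (χ : 𝓢(ℝ, ℝ)) (ψ : ℝ → ℝ) (b : ℝ → ℂ)
    (lam r₁ r₂ : ℝ) : AddCircle (2 * π * ρ) → ℂ :=
  (diffKernel_periodic ρ χ ψ b lam r₁ r₂).lift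

/-- The integral operator
`(r₂, θ₂) ↦ ∬ K(r₁, r₂, θ₂ - θ₁) g(r₁, θ₁) r₁ dr₁ dθ₁`. -/
def diffOperator (ρ : ℝ) [Fact (0 < ρ)] (χ : 𝓢(ℝ, ℝ)) (ψ : ℝ → ℝ) (b : ℝ → ℂ) (lam : ℝ)
    (g : Cone ρ → ℂ) (y : Cone ρ) : ℂ :=
  ∫ x, diffKernelCircle ρ χ ψ b lam x.1 y.1 (y.2 - x.2) * g x ∂(coneMeasure ρ)

end

/-! Two pointwise bounds on the kernel suffice: `|K| ≤ C (1 + r₁)⁻³` and `|K| ≤ C (λ r₁ r₂)^{-1/2}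
|θ|⁻¹`, with `|θ|` the distance to `0` on the circle (`exists_norm_diffKernelCircle_le`).

The first uses no oscillation. Since `χ̂` is supported away from `0` and at bounded frequencies, and
the transform of `ψ̃` decays rapidly with size `(1 + w)^{-1/2}`, the amplitude satisfies `|a_λ(ζ)| ≤
C (1 + ζ)⁻³` (`norm_diffAmplitude_le`). The angular factor is dominated by a Poisson kernel in `s`
of width `|θ|`, whose mass does not depend on `θ`.

For the second, Fourier inversion gives `a_λ(ζ) = 2π λ^{1/2} ∫ χ(u) ψ(u/λ) b(ζ(λ - u)) e^{-iζu} du`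
(`diffAmplitude_eq`). Hence `e^{iλD} a_λ(D)` is an average of `e^{imD} b(mD)` with `m = λ - u >
λ/2`, and `m` is absorbed into the radii because `D` is homogeneous of degree one. The integral of
`e^{iD} b(D)` over `[0, S]` is `O((r₁ r₂)^{-1/2})` uniformly in `S`, by van der Corput's argument
(`norm_integral_phaseAmp_le`). Abel summation then inserts the decreasing factor `(cosh(s/ρ) -
cos(θ/ρ))⁻¹` at the cost of its value at `s = 0`, and `|sin|/(1 - cos)` is `O(|θ|⁻¹)`.

For `p = ∞`, the first bound and Cauchy–Schwarz are enough. For `p = 6`, the `L⁶(r₂ dr₂)` norm of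
the minimum of the two bounds is at most a constant times `λ^{-1/3} (1 + r₁)⁻¹ r₁^{-1/3}
|θ|^{-2/3}`, in which `r₁` and `θ` have separated. Minkowski in `r₂` and Cauchy–Schwarz in `r₁`
leave convolution with `|θ|^{-2/3}` on the circle, bounded from `L²` to `L⁶` because `1/6 = 1/2 -
1/3`. This Hardy–Littlewood–Sobolev estimate is proved by truncating at each level and integrating
over levels (`lintegral_fracIntegral_pow_six_le`). -/

noncomputable section

/-! ### Fourier decay of `ψ̃`, uniform in the dilation parameter -/

/-- `w ^ j b⁽ʲ⁾(w (1 - τ)) φ(τ)`. -/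
def scaledAmp (b : ℝ → ℂ) (φ : ℝ → ℝ) (j : ℕ) (w τ : ℝ) : ℂ :=
  ((w ^ j : ℝ) : ℂ) * iteratedDeriv j b (w * (1 - τ)) * φ τ

lemma hasDerivAt_iteratedDeriv_of_contDiffOn {b : ℝ → ℂ} (hb : ContDiffOn ℝ ∞ b (Ioi 0)) (j : ℕ)
    {z : ℝ} (hz : 0 < z) : HasDerivAt (iteratedDeriv j b) (iteratedDeriv (j + 1) b z) z := by
  rw [iteratedDeriv_succ]
  apply DifferentiableAt.hasDerivAt
  have h := hb.contDiffAt (Ioi_mem_nhds hz)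
  have h2 := h.differentiableAt_iteratedFDeriv (m := j) (by exact_mod_cast ENat.natCast_lt_top j)
  rw [iteratedDeriv_eq_equiv_comp]
  exact (LinearIsometryEquiv.differentiableAt _).comp z h2

lemma eventually_eq_zero_of_notMem_tsupport {φ : ℝ → ℝ} {τ : ℝ} (h : τ ∉ tsupport φ) :
    φ =ᶠ[𝓝 τ] fun _ => 0 := by
  rw [notMem_tsupport_iff_eventuallyEq] at h
  exact h

/-- A derivative falling on `b` produces `-w`, which the prefactor `w ^ j` absorbs, so the family is
closed under differentiation: either `j` rises by one or `φ` becomes `φ'`. Off the support of `φ`,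
where nothing is known about `b`, the function vanishes near the point. -/
lemma hasDerivAt_scaledAmp {b : ℝ → ℂ} (hb : ContDiffOn ℝ ∞ b (Ioi 0)) {φ : ℝ → ℝ}
    (hφ : ContDiff ℝ ∞ φ) (hs : tsupport φ ⊆ Ioo (-(1 / 2)) (1 / 2)) (j : ℕ) {w : ℝ} (hw : 0 < w)
    (τ : ℝ) : HasDerivAt (scaledAmp b φ j w)
      (-scaledAmp b φ (j + 1) w τ + scaledAmp b (deriv φ) j w τ) τ := by
  have hd : HasDerivAt φ (deriv φ τ) τ := (hφ.differentiable (by simp) τ).hasDerivAt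
  by_cases h : τ ∈ tsupport φ
  · have hτ := hs h
    have hpos : 0 < w * (1 - τ) := mul_pos hw (by linarith [hτ.2])
    have h1 : HasDerivAt (fun τ : ℝ => w * (1 - τ)) (-w) τ := by
      simpa using ((hasDerivAt_id τ).const_sub 1).const_mul w
    have h2 := (hasDerivAt_iteratedDeriv_of_contDiffOn hb j hpos).scomp τ h1
    refine ((h2.const_mul ((w ^ j : ℝ) : ℂ)).mul hd.ofReal_comp).congr_deriv ?_
    simp only [scaledAmp, Function.comp, Complex.real_smul]
    push_cast
    ring
  · have h0 := eventually_eq_zero_of_notMem_tsupport h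
    have e : scaledAmp b φ j w =ᶠ[𝓝 τ] fun _ => 0 := by
      filter_upwards [h0] with x hx
      simp [scaledAmp, hx]
    have : -scaledAmp b φ (j + 1) w τ + scaledAmp b (deriv φ) j w τ = 0 := by
      simp [scaledAmp, h0.eq_of_nhds, h0.deriv_eq]
    rw [this]
    exact (hasDerivAt_const τ (0 : ℂ)).congr_of_eventuallyEq e

/-- On the support of `φ` one has `1 - τ > 1/2`, so `1 + w(1 - τ)` is at least `(1 + w)/2`. The
growth `w ^ j` is then cancelled by the symbol decay of the `j`-th derivative, and every `j` leaves
the same size. -/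
lemma norm_scaledAmp_le {b : ℝ → ℂ} (hb : IsBesselAmplitude b) {φ : ℝ → ℝ}
    (hφ : ContDiff ℝ ∞ φ) (hs : tsupport φ ⊆ Ioo (-(1 / 2)) (1 / 2)) (j : ℕ) :
    ∃ C : ℝ, 0 ≤ C ∧ ∀ w, 0 < w → ∀ τ,
      ‖scaledAmp b φ j w τ‖ ≤ C * (1 + w) ^ (-(1 / 2) : ℝ) := by
  obtain ⟨B, hB⟩ := hb.symbol_bound j
  have hcs : HasCompactSupport φ :=
    isCompact_Icc.of_isClosed_subset (isClosed_tsupport φ) (hs.trans Ioo_subset_Icc_self)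
  obtain ⟨M, hM⟩ := hcs.exists_bound_of_continuous hφ.continuous
  have hM0 : 0 ≤ M := (norm_nonneg _).trans (hM 0)
  have hB0 : 0 ≤ B := by
    have := (norm_nonneg _).trans (hB 1 one_pos)
    by_contra hneg
    have := mul_neg_of_neg_of_pos (not_le.1 hneg)
      (Real.rpow_pos_of_pos (show (0 : ℝ) < 1 + 1 by norm_num) (-(j : ℝ) - 1 / 2))
    linarith
  refine ⟨B * 2 ^ ((j : ℝ) + 1 / 2) * M, by positivity, fun w hw τ => ?_⟩
  by_cases h : φ τ = 0
  · simp only [scaledAmp, h, Complex.ofReal_zero, mul_zero, norm_zero]; positivity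
  · have hτ := hs (subset_tsupport _ h)
    have hpos : 0 < w * (1 - τ) := mul_pos hw (by linarith [hτ.2])
    have h1 : (1 + w * (1 - τ)) ^ (-(j : ℝ) - 1 / 2) ≤
        2 ^ ((j : ℝ) + 1 / 2) * (1 + w) ^ (-(j : ℝ) - 1 / 2) := by
      have := Real.rpow_le_rpow_of_nonpos (show 0 < (1 + w) / 2 by positivity)
        (show (1 + w) / 2 ≤ 1 + w * (1 - τ) by nlinarith [hτ.2])
        (show -(j : ℝ) - 1 / 2 ≤ 0 by have : (0 : ℝ) ≤ j := j.cast_nonneg; linarith)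
      refine this.trans (le_of_eq ?_)
      rw [Real.div_rpow (by positivity) (by norm_num), show -(j : ℝ) - 1 / 2 = -(j + 1 / 2) by ring,
        Real.rpow_neg (by norm_num : (0 : ℝ) ≤ 2), div_inv_eq_mul, mul_comm]
    have h2 : w ^ j * (1 + w) ^ (-(j : ℝ) - 1 / 2) ≤ (1 + w) ^ (-(1 / 2) : ℝ) := by
      have e : (1 + w) ^ (-(1 / 2) : ℝ) = (1 + w) ^ j * (1 + w) ^ (-(j : ℝ) - 1 / 2) := by
        rw [← Real.rpow_natCast, ← Real.rpow_add (by positivity)]; congr 1; ring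
      rw [e]
      gcongr
      linarith
    have hb1 := hB _ hpos
    rw [scaledAmp, norm_mul, norm_mul, Complex.norm_real, Complex.norm_real,
      Real.norm_of_nonneg (by positivity : 0 ≤ w ^ j)]
    calc w ^ j * ‖iteratedDeriv j b (w * (1 - τ))‖ * ‖φ τ‖
        ≤ w ^ j * (B * (2 ^ ((j : ℝ) + 1 / 2) * (1 + w) ^ (-(j : ℝ) - 1 / 2))) * M := by
          gcongr
          · exact hb1.trans (by gcongr)
          · exact hM τ
      _ = B * 2 ^ ((j : ℝ) + 1 / 2) * M * (w ^ j * (1 + w) ^ (-(j : ℝ) - 1 / 2)) := by ring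
      _ ≤ _ := by gcongr

lemma scaledAmp_eq_zero {b : ℝ → ℂ} {φ : ℝ → ℝ} (hs : tsupport φ ⊆ Ioo (-(1 / 2)) (1 / 2))
    (j : ℕ) (w : ℝ) {τ : ℝ} (hτ : τ ∉ Icc (-(1 / 2) : ℝ) (1 / 2)) : scaledAmp b φ j w τ = 0 := by
  have : φ τ = 0 := by
    by_contra h
    exact hτ (Ioo_subset_Icc_self (hs (subset_tsupport _ h)))
  simp [scaledAmp, this]

lemma continuous_scaledAmp {b : ℝ → ℂ} (hb : ContDiffOn ℝ ∞ b (Ioi 0)) {φ : ℝ → ℝ}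
    (hφ : ContDiff ℝ ∞ φ) (hs : tsupport φ ⊆ Ioo (-(1 / 2)) (1 / 2)) (j : ℕ) {w : ℝ} (hw : 0 < w) :
    Continuous (scaledAmp b φ j w) :=
  continuous_iff_continuousAt.2 fun τ => (hasDerivAt_scaledAmp hb hφ hs j hw τ).continuousAt

lemma norm_exp_neg_I_mul (t τ : ℝ) : ‖Complex.exp (-(Complex.I * t * τ))‖ = 1 := by
  have : Complex.exp (-(Complex.I * t * τ)) = Complex.exp (((-(t * τ) : ℝ) : ℂ) * Complex.I) := by
    congr 1; push_cast; ring
  rw [this, Complex.norm_exp_ofReal_mul_I]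

lemma integrable_exp_mul_scaledAmp {b : ℝ → ℂ} (hb : ContDiffOn ℝ ∞ b (Ioi 0)) {φ : ℝ → ℝ}
    (hφ : ContDiff ℝ ∞ φ) (hs : tsupport φ ⊆ Ioo (-(1 / 2)) (1 / 2)) (j : ℕ) {w : ℝ} (hw : 0 < w)
    (t : ℝ) :
    Integrable fun τ : ℝ => Complex.exp (-(Complex.I * t * τ)) * scaledAmp b φ j w τ := by
  have hc := continuous_scaledAmp hb hφ hs j hw
  refine Continuous.integrable_of_hasCompactSupport (by fun_prop) ?_
  exact HasCompactSupport.intro isCompact_Icc fun τ hτ => by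
    rw [scaledAmp_eq_zero hs j w hτ, mul_zero]

/-- Integration by parts; compact support removes the boundary terms. -/
lemma mul_fourierHat_scaledAmp {b : ℝ → ℂ} (hb : ContDiffOn ℝ ∞ b (Ioi 0)) {φ : ℝ → ℝ}
    (hφ : ContDiff ℝ ∞ φ) (hs : tsupport φ ⊆ Ioo (-(1 / 2)) (1 / 2)) (j : ℕ) {w : ℝ} (hw : 0 < w)
    (t : ℝ) : Complex.I * t * fourierHat (scaledAmp b φ j w) t =
      -fourierHat (scaledAmp b φ (j + 1) w) t + fourierHat (scaledAmp b (deriv φ) j w) t := by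
  have hφ' : ContDiff ℝ ∞ (deriv φ) := (contDiff_infty_iff_deriv.1 hφ).2
  have hs' : tsupport (deriv φ) ⊆ Ioo (-(1 / 2)) (1 / 2) := tsupport_deriv_subset.trans hs
  have i0 := integrable_exp_mul_scaledAmp hb hφ hs j hw t
  have i1 := integrable_exp_mul_scaledAmp hb hφ hs (j + 1) hw t
  have i2 := integrable_exp_mul_scaledAmp hb hφ' hs' j hw t
  have hd : ∀ τ : ℝ, HasDerivAt
      (fun τ : ℝ => Complex.exp (-(Complex.I * t * τ)) * scaledAmp b φ j w τ)
      (-(Complex.I * t) * (Complex.exp (-(Complex.I * t * τ)) * scaledAmp b φ j w τ) +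
        (-(Complex.exp (-(Complex.I * t * τ)) * scaledAmp b φ (j + 1) w τ) +
        Complex.exp (-(Complex.I * t * τ)) * scaledAmp b (deriv φ) j w τ)) τ := by
    intro τ
    have h1 : HasDerivAt (fun τ : ℝ => (τ : ℂ)) 1 τ := Complex.ofRealCLM.hasDerivAt
    have h2 := (h1.const_mul (Complex.I * t)).neg.cexp
    refine (h2.mul (hasDerivAt_scaledAmp hb hφ hs j hw τ)).congr_deriv ?_
    simp only [Pi.neg_apply]
    ring
  have i3 : Integrable fun τ : ℝ =>
      -(Complex.exp (-(Complex.I * t * τ)) * scaledAmp b φ (j + 1) w τ) +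
        Complex.exp (-(Complex.I * t * τ)) * scaledAmp b (deriv φ) j w τ := i1.neg.add i2
  have h0 := integral_eq_zero_of_hasDerivAt_of_integrable hd ((i0.const_mul _).add i3) i0
  rw [integral_add (i0.const_mul _) i3, integral_const_mul] at h0
  have h3 : ∫ τ : ℝ, (-(Complex.exp (-(Complex.I * t * τ)) * scaledAmp b φ (j + 1) w τ) +
        Complex.exp (-(Complex.I * t * τ)) * scaledAmp b (deriv φ) j w τ) =
      -fourierHat (scaledAmp b φ (j + 1) w) t + fourierHat (scaledAmp b (deriv φ) j w) t := by
    have := integral_add i1.neg i2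
    simp only [Pi.neg_apply, integral_neg] at this
    exact this
  rw [h3] at h0
  unfold fourierHat at h0 ⊢
  linear_combination -h0

/-- Induction on the number of integrations by parts. Each one trades a factor `t` for `j + 1` or
`φ'`, so `φ` and `j` must remain general. -/
lemma norm_pow_mul_fourierHat_scaledAmp_le {b : ℝ → ℂ} (hb : IsBesselAmplitude b) (n : ℕ) :
    ∀ (φ : ℝ → ℝ), ContDiff ℝ ∞ φ → tsupport φ ⊆ Ioo (-(1 / 2)) (1 / 2) → ∀ j : ℕ,
    ∃ C : ℝ, 0 ≤ C ∧ ∀ w, 0 < w → ∀ t : ℝ,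
      |t| ^ n * ‖fourierHat (scaledAmp b φ j w) t‖ ≤ C * (1 + w) ^ (-(1 / 2) : ℝ) := by
  induction n with
  | zero =>
    intro φ hφ hs j
    obtain ⟨C, hC0, hC⟩ := norm_scaledAmp_le hb hφ hs j
    refine ⟨C, hC0, fun w hw t => ?_⟩
    rw [pow_zero, one_mul]
    have e : fourierHat (scaledAmp b φ j w) t = ∫ τ in Icc (-(1 / 2) : ℝ) (1 / 2),
        Complex.exp (-(Complex.I * t * τ)) * scaledAmp b φ j w τ := by
      rw [setIntegral_eq_integral_of_forall_compl_eq_zero]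
      · rfl
      · intro τ hτ
        rw [scaledAmp_eq_zero hs j w hτ, mul_zero]
    rw [e]
    have := norm_setIntegral_le_of_norm_le_const (μ := volume)
      (f := fun τ : ℝ => Complex.exp (-(Complex.I * t * τ)) * scaledAmp b φ j w τ)
      (s := Icc (-(1 / 2) : ℝ) (1 / 2)) (C := C * (1 + w) ^ (-(1 / 2) : ℝ)) (by simp)
      (fun τ _ => by rw [norm_mul, norm_exp_neg_I_mul, one_mul]; exact hC w hw τ)
    refine this.trans (le_of_eq ?_)
    rw [Measure.real, Real.volume_Icc]
    norm_num
  | succ n ih =>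
    intro φ hφ hs j
    have hφ' : ContDiff ℝ ∞ (deriv φ) := (contDiff_infty_iff_deriv.1 hφ).2
    have hs' : tsupport (deriv φ) ⊆ Ioo (-(1 / 2)) (1 / 2) := tsupport_deriv_subset.trans hs
    obtain ⟨A, hA0, hA⟩ := ih φ hφ hs (j + 1)
    obtain ⟨B, hB0, hB⟩ := ih _ hφ' hs' j
    refine ⟨A + B, by positivity, fun w hw t => ?_⟩
    have e := congrArg norm (mul_fourierHat_scaledAmp hb.smooth hφ hs j hw t)
    rw [norm_mul, norm_mul, Complex.norm_I, one_mul, Complex.norm_real, Real.norm_eq_abs] at e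
    calc |t| ^ (n + 1) * ‖fourierHat (scaledAmp b φ j w) t‖
        = |t| ^ n * (|t| * ‖fourierHat (scaledAmp b φ j w) t‖) := by ring
      _ ≤ |t| ^ n * (‖fourierHat (scaledAmp b φ (j + 1) w) t‖ +
            ‖fourierHat (scaledAmp b (deriv φ) j w) t‖) := by
          rw [e]; gcongr; exact (norm_add_le _ _).trans (by rw [norm_neg])
      _ ≤ _ := by rw [mul_add, add_mul]; exact add_le_add (hA w hw t) (hB w hw t)

lemma psiTilde_eq_scaledAmp (ψ : ℝ → ℝ) (b : ℝ → ℂ) (w : ℝ) :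
    (fun τ => psiTilde ψ b τ w) = scaledAmp b ψ 0 w := by
  funext τ; simp [psiTilde, scaledAmp]

/-- Rapid decay of the Fourier transform of `ψ̃`, uniformly in `w`. -/
lemma norm_fourierHat_psiTilde_le {b : ℝ → ℂ} (hb : IsBesselAmplitude b) {ψ : ℝ → ℝ}
    (hψ : IsUnitBump ψ) (n : ℕ) : ∃ C : ℝ, 0 ≤ C ∧ ∀ w, 0 < w → ∀ t : ℝ,
      ‖fourierHat (fun τ => psiTilde ψ b τ w) t‖ ≤
        C * (1 + w) ^ (-(1 / 2) : ℝ) / (1 + |t|) ^ n := by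
  obtain ⟨A, hA0, hA⟩ := norm_pow_mul_fourierHat_scaledAmp_le hb 0 ψ hψ.smooth hψ.tsupport_subset 0
  obtain ⟨B, hB0, hB⟩ := norm_pow_mul_fourierHat_scaledAmp_le hb n ψ hψ.smooth hψ.tsupport_subset 0
  refine ⟨2 ^ n * (A + B), by positivity, fun w hw t => ?_⟩
  rw [psiTilde_eq_scaledAmp, le_div_iff₀ (by positivity)]
  have h1 : (1 + |t|) ^ n ≤ 2 ^ n * (1 + |t| ^ n) := by
    rcases le_total |t| 1 with h | h
    · calc (1 + |t|) ^ n ≤ 2 ^ n := by gcongr; linarith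
        _ ≤ _ := le_mul_of_one_le_right (by positivity) (by linarith [pow_nonneg (abs_nonneg t) n])
    · calc (1 + |t|) ^ n ≤ (2 * |t|) ^ n := by gcongr; linarith
        _ = 2 ^ n * |t| ^ n := mul_pow _ _ _
        _ ≤ _ := by gcongr; linarith
  have hA' := hA w hw t
  have hB' := hB w hw t
  rw [pow_zero, one_mul] at hA'
  calc _ ≤ ‖fourierHat (scaledAmp b ψ 0 w) t‖ * (2 ^ n * (1 + |t| ^ n)) := by gcongr
    _ = 2 ^ n * (‖fourierHat (scaledAmp b ψ 0 w) t‖ +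
          |t| ^ n * ‖fourierHat (scaledAmp b ψ 0 w) t‖) := by ring
    _ ≤ 2 ^ n * (A * (1 + w) ^ (-(1 / 2) : ℝ) + B * (1 + w) ^ (-(1 / 2) : ℝ)) := by gcongr
    _ = _ := by ring

/-! ### Fourier inversion and the amplitude `a_λ` -/

open scoped FourierTransform

lemma continuous_fourierHat {f : ℝ → ℂ} (hf : Integrable f) : Continuous (fourierHat f) := by
  refine continuous_of_dominated (bound := fun τ => ‖f τ‖) (fun t => ?_) (fun t => ?_) hf.norm ?_
  · exact (Continuous.aestronglyMeasurable (by fun_prop)).mul hf.1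
  · exact ae_of_all _ fun τ => by rw [norm_mul, norm_exp_neg_I_mul, one_mul]
  · exact ae_of_all _ fun τ => by fun_prop

lemma fourierHat_eq_fourier (f : ℝ → ℂ) (t : ℝ) : fourierHat f t = 𝓕 f (t / (2 * π)) := by
  rw [Real.fourier_real_eq_integral_exp_smul]
  unfold fourierHat
  congr 1
  funext τ
  rw [smul_eq_mul]
  congr 2
  have : -2 * π * τ * (t / (2 * π)) = -(t * τ) := by field_simp
  rw [this]; push_cast; ring

/-- Inversion for the `e^{-itτ}` normalization, deduced from the one with `2π` in the exponent by
rescaling the frequency; the Jacobian is the factor `2π`. -/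
lemma integral_fourierHat_mul_exp {f : ℝ → ℂ} (hf : Integrable f) (hc : Continuous f)
    (hi : Integrable (fourierHat f)) (u : ℝ) :
    ∫ s : ℝ, fourierHat f s * Complex.exp (Complex.I * s * u) = 2 * π * f u := by
  have hpi : (2 * π : ℝ) ≠ 0 := by positivity
  have hF : 𝓕 f = fun ξ => fourierHat f (2 * π * ξ) := by
    funext ξ
    rw [fourierHat_eq_fourier, mul_div_cancel_left₀ _ hpi]
  have hiF : Integrable (𝓕 f) := by
    rw [hF]; exact hi.comp_mul_left' hpi
  have h := congrFun (hc.fourierInv_fourier_eq hf hiF) u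
  rw [Real.fourierInv_eq', hF] at h
  have h2 := Measure.integral_comp_mul_left
    (fun s : ℝ => fourierHat f s * Complex.exp (Complex.I * s * u)) (2 * π)
  rw [abs_of_pos (by positivity)] at h2
  have h3 : ∫ x : ℝ, fourierHat f (2 * π * x) * Complex.exp (Complex.I * ((2 * π * x : ℝ) : ℂ) * u)
      = f u := by
    rw [← h]
    congr 1
    funext v
    rw [smul_eq_mul, mul_comm]
    congr 2
    simp
    ring_nf
  rw [h3, Complex.real_smul] at h2
  rw [h2]
  generalize ∫ y : ℝ, fourierHat f y * Complex.exp (Complex.I * y * u) = J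
  push_cast
  have : (π : ℂ) ≠ 0 := by exact_mod_cast Real.pi_ne_zero
  field_simp

section Cutoff

variable {δ : ℝ} {χ : 𝓢(ℝ, ℝ)}

lemma integrable_ofReal_schwartz (χ : 𝓢(ℝ, ℝ)) : Integrable fun τ => (χ τ : ℂ) :=
  χ.integrable.ofReal

lemma fourierHat_cutoff_eq_zero (hχ : IsSpectralCutoff δ χ) {s : ℝ}
    (hs : ¬ (δ < |s| ∧ |s| < 2 * δ)) : fourierHat (fun τ => (χ τ : ℂ)) s = 0 := by
  by_contra h
  exact hs (hχ.tsupport_hat (subset_tsupport _ h))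

lemma integrable_fourierHat_cutoff (hχ : IsSpectralCutoff δ χ) :
    Integrable (fourierHat fun τ => (χ τ : ℂ)) := by
  refine (continuous_fourierHat (integrable_ofReal_schwartz χ)).integrable_of_hasCompactSupport ?_
  refine HasCompactSupport.intro (isCompact_Icc (a := -(2 * δ)) (b := 2 * δ)) fun s hs => ?_
  refine fourierHat_cutoff_eq_zero hχ fun h => hs ?_
  exact ⟨(abs_lt.1 h.2).1.le, (abs_lt.1 h.2).2.le⟩

lemma norm_fourierHat_le {f : ℝ → ℂ} (t : ℝ) : ‖fourierHat f t‖ ≤ ∫ τ, ‖f τ‖ := by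
  refine (norm_integral_le_integral_norm _).trans (le_of_eq ?_)
  congr 1
  funext τ
  rw [norm_mul, norm_exp_neg_I_mul, one_mul]

/-- The mass of this approximate identity does not depend on its scale. It gives uniformity in `λ`
for the amplitude and, with scale `|θ|⁻¹`, uniformity in `θ` for the angular factor. -/
lemma integral_scaled_inv_one_add_sq {lam : ℝ} (hlam : 0 < lam) (ζ : ℝ) :
    Integrable (fun s : ℝ => lam * (1 + (lam * (ζ - s)) ^ 2)⁻¹) ∧
      ∫ s : ℝ, lam * (1 + (lam * (ζ - s)) ^ 2)⁻¹ = π := by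
  constructor
  · exact ((integrable_inv_one_add_sq.comp_mul_left' hlam.ne').comp_sub_left ζ).const_mul lam
  · rw [integral_const_mul, integral_sub_left_eq_self (fun s => (1 + (lam * s) ^ 2)⁻¹) volume ζ,
      Measure.integral_comp_mul_left (fun s => (1 + s ^ 2)⁻¹) lam, integral_univ_inv_one_add_sq,
      abs_of_pos (inv_pos.2 hlam), smul_eq_mul]
    field_simp

/-- The amplitude `a_λ` is bounded and decays, uniformly in `λ`. -/
lemma norm_diffAmplitude_le (hδ : 0 < δ) (hχ : IsSpectralCutoff δ χ) {ψ : ℝ → ℝ}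
    (hψ : IsUnitBump ψ) {b : ℝ → ℂ} (hb : IsBesselAmplitude b) :
    ∃ C : ℝ, 0 < C ∧ ∀ lam ζ : ℝ, 1 ≤ lam → 0 < ζ →
      ‖diffAmplitude χ ψ b lam ζ‖ ≤ C / (1 + ζ) ^ 3 := by
  -- Six powers of decay are spent as `1 + 3 + 2`: one to replace `λζ` by `λδ`, three for the decay
  -- in `ζ`, two for integrability in `s`.
  obtain ⟨A, hA0, hA⟩ := norm_fourierHat_psiTilde_le hb hψ 6
  set B : ℝ := ∫ τ, ‖(χ τ : ℂ)‖ with hB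
  have hB0 : 0 ≤ B := integral_nonneg fun _ => norm_nonneg _
  refine ⟨B * A * δ ^ (-(1 / 2) : ℝ) * (1 + 2 * δ) ^ 3 * π + 1, by positivity,
    fun lam ζ hlam hζ => ?_⟩
  have hlam0 : 0 < lam := by linarith
  obtain ⟨hI, hIπ⟩ := integral_scaled_inv_one_add_sq hlam0 ζ
  set D : ℝ := B * A * δ ^ (-(1 / 2) : ℝ) * (1 + 2 * δ) ^ 3 / (1 + ζ) ^ 3 with hD
  have hD0 : 0 ≤ D := by positivity
  have key : ∀ s : ℝ, ‖((lam ^ (1 / 2 : ℝ) : ℝ) : ℂ) * (fourierHat (fun τ => (χ τ : ℂ)) s *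
      fourierHat (fun τ => psiTilde ψ b τ (lam * ζ)) (lam * (ζ - s)) * lam)‖ ≤
      D * (lam * (1 + (lam * (ζ - s)) ^ 2)⁻¹) := by
    intro s
    by_cases hs : δ < |s| ∧ |s| < 2 * δ
    swap
    · rw [fourierHat_cutoff_eq_zero hχ hs]
      simp only [zero_mul, mul_zero, norm_zero]
      positivity
    set y : ℝ := |lam * (ζ - s)| with hy
    have hy0 : 0 ≤ y := abs_nonneg _
    have hy1 : y = lam * |ζ - s| := by rw [hy, abs_mul, abs_of_pos hlam0]
    have hy2 : (lam * (ζ - s)) ^ 2 = y ^ 2 := (sq_abs _).symm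
    have htri : |s| ≤ ζ + |ζ - s| := by
      have := abs_sub_abs_le_abs_sub s ζ
      rw [abs_of_pos hζ, abs_sub_comm] at this
      linarith
    -- Here the gap `|s| > δ` enters: if `ζ` is small then `y` is at least of order `λδ`, so
    -- `λ^{1/2}` is controlled even when `λζ` is not large.
    have h1 : lam * δ ≤ (1 + lam * ζ) * (1 + y) ^ 2 := by
      have : lam * δ ≤ lam * ζ + y := by rw [hy1, ← mul_add]; gcongr; linarith [hs.1]
      have : 0 ≤ lam * ζ := by positivity
      nlinarith [mul_nonneg this hy0, sq_nonneg y, mul_nonneg this (sq_nonneg y)]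
    have h2 : lam ^ (1 / 2 : ℝ) * (1 + lam * ζ) ^ (-(1 / 2) : ℝ) ≤ δ ^ (-(1 / 2) : ℝ) * (1 + y) := by
      have h3 := Real.rpow_le_rpow (by positivity) h1 (show (0 : ℝ) ≤ 1 / 2 by norm_num)
      rw [Real.mul_rpow hlam0.le hδ.le, Real.mul_rpow (by positivity) (by positivity),
        ← Real.sqrt_eq_rpow ((1 + y) ^ 2), Real.sqrt_sq (by positivity)] at h3
      rw [Real.rpow_neg (by positivity), Real.rpow_neg hδ.le, ← div_eq_mul_inv,
        div_le_iff₀ (by positivity), inv_mul_eq_div, div_mul_eq_mul_div, le_div_iff₀ (by positivity)]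
      linarith
    -- Here `|s| < 2δ` and `λ ≥ 1` enter: `ζ ≤ 2δ + y`, so decay in `y` is decay in `ζ`.
    have h4 : (1 + y)⁻¹ ^ 3 ≤ (1 + 2 * δ) ^ 3 / (1 + ζ) ^ 3 := by
      rw [inv_pow, inv_eq_one_div, div_le_div_iff₀ (by positivity) (by positivity), one_mul,
        ← mul_pow]
      gcongr
      have h5 : |ζ - s| ≤ y := by rw [hy1]; exact le_mul_of_one_le_left (abs_nonneg _) hlam
      have h6 : ζ ≤ |s| + |ζ - s| := by
        have := abs_sub_abs_le_abs_sub ζ s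
        rw [abs_of_pos hζ] at this
        linarith
      nlinarith [hs.2]
    have h7 : (1 + y)⁻¹ ^ 2 ≤ (1 + y ^ 2)⁻¹ := by
      rw [inv_pow]; gcongr; nlinarith
    rw [norm_mul, norm_mul, norm_mul, Complex.norm_real, Complex.norm_real,
      Real.norm_of_nonneg (by positivity), Real.norm_of_nonneg hlam0.le, hy2]
    calc lam ^ (1 / 2 : ℝ) * (‖fourierHat (fun τ => (χ τ : ℂ)) s‖ *
          ‖fourierHat (fun τ => psiTilde ψ b τ (lam * ζ)) (lam * (ζ - s))‖ * lam)
        ≤ lam ^ (1 / 2 : ℝ) * (B * (A * (1 + lam * ζ) ^ (-(1 / 2) : ℝ) / (1 + y) ^ 6) * lam) := by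
          gcongr
          · exact norm_fourierHat_le s
          · exact hA _ (by positivity) _
      _ = B * A * (lam ^ (1 / 2 : ℝ) * (1 + lam * ζ) ^ (-(1 / 2) : ℝ)) / (1 + y) ^ 6 * lam := by
          ring
      _ ≤ B * A * (δ ^ (-(1 / 2) : ℝ) * (1 + y)) / (1 + y) ^ 6 * lam := by gcongr
      _ = B * A * δ ^ (-(1 / 2) : ℝ) * ((1 + y)⁻¹ ^ 3 * (lam * (1 + y)⁻¹ ^ 2)) := by
          field_simp
      _ ≤ B * A * δ ^ (-(1 / 2) : ℝ) * ((1 + 2 * δ) ^ 3 / (1 + ζ) ^ 3 *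
            (lam * (1 + y ^ 2)⁻¹)) := by gcongr
      _ = _ := by rw [hD]; ring
  have h := norm_integral_le_of_norm_le (hI.const_mul D) (ae_of_all _ key)
  rw [integral_const_mul, integral_const_mul, hIπ] at h
  unfold diffAmplitude
  refine h.trans ?_
  rw [hD, div_mul_eq_mul_div]
  gcongr
  linarith

lemma integrable_exp_mul_scaledAmp_div {b : ℝ → ℂ} (hb : IsBesselAmplitude b) {ψ : ℝ → ℝ}
    (hψ : IsUnitBump ψ) {w lam : ℝ} (hw : 0 < w) (hlam : 0 < lam) (ζ : ℝ) :
    Integrable fun u : ℝ => Complex.exp (-(Complex.I * ζ * u)) * scaledAmp b ψ 0 w (u / lam) := by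
  have h := (integrable_exp_mul_scaledAmp hb.smooth hψ.smooth hψ.tsupport_subset 0 hw
    (lam * ζ)).comp_div hlam.ne'
  refine h.congr (ae_of_all _ fun u => ?_)
  have : (lam : ℂ) ≠ 0 := by exact_mod_cast hlam.ne'
  simp only
  congr 2
  push_cast
  field_simp

/-- The amplitude `a_λ` as an average of dilates of `b` against `χ`. -/
lemma diffAmplitude_eq (hχ : IsSpectralCutoff δ χ) {ψ : ℝ → ℝ} (hψ : IsUnitBump ψ) {b : ℝ → ℂ}
    (hb : IsBesselAmplitude b) {lam ζ : ℝ} (hlam : 0 < lam) (hζ : 0 < ζ) :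
    diffAmplitude χ ψ b lam ζ = ((2 * π * lam ^ (1 / 2 : ℝ) : ℝ) : ℂ) *
      ∫ u : ℝ, ((χ u * ψ (u / lam) : ℝ) : ℂ) *
        ((Ioi 0).indicator b (ζ * (lam - u)) * Complex.exp (-(Complex.I * ζ * u))) := by
  have hw : 0 < lam * ζ := by positivity
  have hlamC : (lam : ℂ) ≠ 0 := by exact_mod_cast hlam.ne'
  have hX := integrable_fourierHat_cutoff hχ
  set X := fourierHat fun τ => (χ τ : ℂ) with hXdef
  set H : ℝ → ℂ := fun u => Complex.exp (-(Complex.I * ζ * u)) * scaledAmp b ψ 0 (lam * ζ) (u / lam)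
    with hH
  have hHi : Integrable H := integrable_exp_mul_scaledAmp_div hb hψ hw hlam ζ
  -- The substitution `τ = u / λ` uses up the factor `λ` and leaves `s` only in `e^{isu}`.
  have h1 : ∀ s : ℝ, fourierHat (fun τ => psiTilde ψ b τ (lam * ζ)) (lam * (ζ - s)) * lam =
      ∫ u : ℝ, Complex.exp (Complex.I * s * u) * H u := by
    intro s
    have h2 := Measure.integral_comp_div (fun τ : ℝ =>
      Complex.exp (-(Complex.I * ((lam * (ζ - s) : ℝ) : ℂ) * τ)) * scaledAmp b ψ 0 (lam * ζ) τ) lam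
    rw [abs_of_pos hlam, Complex.real_smul] at h2
    rw [psiTilde_eq_scaledAmp, fourierHat, mul_comm, ← h2]
    congr 1
    funext u
    rw [hH]
    simp only
    rw [← mul_assoc, ← Complex.exp_add]
    congr 2
    push_cast
    field_simp
    ring_nf
  have hprod : Integrable (Function.uncurry fun s u : ℝ =>
      X s * (Complex.exp (Complex.I * s * u) * H u)) (volume.prod volume) := by
    refine (hX.mul_prod hHi).mono ?_ (ae_of_all _ fun p => ?_)
    · have hm : AEStronglyMeasurable (fun p : ℝ × ℝ => Complex.exp (Complex.I * p.1 * p.2))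
          (volume.prod volume) := Continuous.aestronglyMeasurable (by fun_prop)
      refine (hm.mul (hX.mul_prod hHi).1).congr (ae_of_all _ fun p => ?_)
      simp only [Function.uncurry, Pi.mul_apply]
      ring
    · have : ‖Complex.exp (Complex.I * p.1 * p.2)‖ = 1 := by
        have := norm_exp_neg_I_mul (-p.1) p.2
        simpa using this
      simp only [Function.uncurry, norm_mul, this, one_mul]
      exact le_rfl
  unfold diffAmplitude
  simp_rw [mul_assoc, h1]
  -- After Fubini the inner integral in `s` is Fourier inversion for `χ` at `u`.
  have h3 : ∫ s : ℝ, X s * ∫ u : ℝ, Complex.exp (Complex.I * s * u) * H u =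
      ∫ u : ℝ, (2 * π * (χ u : ℂ)) * H u := by
    simp_rw [← integral_const_mul]
    rw [integral_integral_swap hprod]
    congr 1
    funext u
    simp_rw [← mul_assoc]
    rw [integral_mul_const, hXdef, integral_fourierHat_mul_exp (integrable_ofReal_schwartz χ)
      (Complex.continuous_ofReal.comp χ.continuous) hX]
  rw [h3, ← integral_const_mul, ← integral_const_mul]
  congr 1
  funext u
  -- Where `ψ(u/λ) ≠ 0` one has `u < λ/2`, so the argument of `b` is positive and the indicator
  -- equals one. The indicator makes the integrand measurable, `b` being arbitrary off `(0, ∞)`.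
  have h4 : H u = ψ (u / lam) *
      ((Ioi 0).indicator b (ζ * (lam - u)) * Complex.exp (-(Complex.I * ζ * u))) := by
    rw [hH]
    simp only [scaledAmp, pow_zero, iteratedDeriv_zero]
    by_cases h : ψ (u / lam) = 0
    · simp [h]
    · have h5 := (hψ.tsupport_subset (subset_tsupport _ h)).2
      rw [div_lt_iff₀ hlam] at h5
      have e : lam * ζ * (1 - u / lam) = ζ * (lam - u) := by field_simp
      have hmem : ζ * (lam - u) ∈ Ioi (0 : ℝ) := mul_pos hζ (by linarith)
      rw [indicator_of_mem hmem, e]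
      push_cast
      ring
  rw [h4]
  push_cast
  ring_nf

end Cutoff

/-! ### The phase `D` and the reciprocal of its derivative -/

section Phase

variable {r₁ r₂ : ℝ}

lemma diffPhase_arg_ge (h₁ : 0 < r₁) (h₂ : 0 < r₂) (s : ℝ) :
    (r₁ + r₂) ^ 2 ≤ r₁ ^ 2 + r₂ ^ 2 + 2 * r₁ * r₂ * Real.cosh s := by
  have := mul_le_mul_of_nonneg_left (Real.one_le_cosh s) (mul_pos h₁ h₂).le
  nlinarith

lemma add_le_diffPhase (h₁ : 0 < r₁) (h₂ : 0 < r₂) (s : ℝ) : r₁ + r₂ ≤ diffPhase r₁ r₂ s :=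
  Real.le_sqrt_of_sq_le (diffPhase_arg_ge h₁ h₂ s)

lemma diffPhase_pos (h₁ : 0 < r₁) (h₂ : 0 < r₂) (s : ℝ) : 0 < diffPhase r₁ r₂ s :=
  (add_pos h₁ h₂).trans_le (add_le_diffPhase h₁ h₂ s)

lemma diffPhase_sq (h₁ : 0 < r₁) (h₂ : 0 < r₂) (s : ℝ) :
    diffPhase r₁ r₂ s ^ 2 = r₁ ^ 2 + r₂ ^ 2 + 2 * r₁ * r₂ * Real.cosh s :=
  Real.sq_sqrt ((sq_nonneg _).trans (diffPhase_arg_ge h₁ h₂ s))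

/-- Homogeneity of degree one is what allows a frequency `m` to be moved from the phase into the
radii. -/
lemma diffPhase_mul {m : ℝ} (hm : 0 ≤ m) (r₁ r₂ s : ℝ) :
    diffPhase (m * r₁) (m * r₂) s = m * diffPhase r₁ r₂ s := by
  unfold diffPhase
  rw [show (m * r₁) ^ 2 + (m * r₂) ^ 2 + 2 * (m * r₁) * (m * r₂) * Real.cosh s =
    m ^ 2 * (r₁ ^ 2 + r₂ ^ 2 + 2 * r₁ * r₂ * Real.cosh s) by ring,
    Real.sqrt_mul (sq_nonneg m), Real.sqrt_sq hm]

lemma hasDerivAt_diffPhase (h₁ : 0 < r₁) (h₂ : 0 < r₂) (s : ℝ) :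
    HasDerivAt (diffPhase r₁ r₂) (r₁ * r₂ * Real.sinh s / diffPhase r₁ r₂ s) s := by
  have h0 := (sq_pos_of_pos (add_pos h₁ h₂)).trans_le (diffPhase_arg_ge h₁ h₂ s)
  have h := (((Real.hasDerivAt_cosh s).const_mul (2 * r₁ * r₂)).const_add
    (r₁ ^ 2 + r₂ ^ 2)).sqrt h0.ne'
  refine h.congr_deriv ?_
  have := (diffPhase_pos h₁ h₂ s).ne'
  unfold diffPhase at this ⊢
  field_simp

lemma continuous_diffPhase (r₁ r₂ : ℝ) : Continuous (diffPhase r₁ r₂) := by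
  unfold diffPhase; fun_prop

/-- The reciprocal of the derivative of the phase. -/
def invPhaseDeriv (r₁ r₂ s : ℝ) : ℝ := diffPhase r₁ r₂ s / (r₁ * r₂ * Real.sinh s)

lemma hasDerivAt_invPhaseDeriv (h₁ : 0 < r₁) (h₂ : 0 < r₂) {s : ℝ} (hs : 0 < s) :
    HasDerivAt (invPhaseDeriv r₁ r₂) ((diffPhase r₁ r₂ s)⁻¹ -
      diffPhase r₁ r₂ s * Real.cosh s / (r₁ * r₂ * Real.sinh s ^ 2)) s := by
  have hsh := Real.sinh_pos_iff.2 hs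
  have h := (hasDerivAt_diffPhase h₁ h₂ s).div ((Real.hasDerivAt_sinh s).const_mul (r₁ * r₂))
    (by positivity)
  refine h.congr_deriv ?_
  have := diffPhase_pos h₁ h₂ s
  field_simp

/-- Cleared of denominators, this reads `r₁ r₂ sinh² s ≤ D² cosh s`, which holds since `D² ≥ 2 r₁ r₂
cosh s`. Monotonicity of `1/D'` bounds its variation on `[ε, S]` by its value at `ε`. -/
lemma invPhaseDeriv_deriv_nonpos (h₁ : 0 < r₁) (h₂ : 0 < r₂) {s : ℝ} (hs : 0 < s) :
    (diffPhase r₁ r₂ s)⁻¹ -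
      diffPhase r₁ r₂ s * Real.cosh s / (r₁ * r₂ * Real.sinh s ^ 2) ≤ 0 := by
  have hsh := Real.sinh_pos_iff.2 hs
  have hD := diffPhase_pos h₁ h₂ s
  rw [sub_nonpos, inv_eq_one_div, div_le_div_iff₀ hD (by positivity)]
  have h := diffPhase_sq h₁ h₂ s
  have hc := Real.cosh_pos s
  have e : diffPhase r₁ r₂ s * Real.cosh s * diffPhase r₁ r₂ s =
      (r₁ ^ 2 + r₂ ^ 2) * Real.cosh s + 2 * (r₁ * r₂) * Real.cosh s ^ 2 := by
    linear_combination Real.cosh s * h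
  rw [e, Real.sinh_sq]
  have : 0 < r₁ * r₂ := mul_pos h₁ h₂
  have h3 : 0 ≤ (r₁ ^ 2 + r₂ ^ 2) * Real.cosh s := by positivity
  nlinarith [mul_nonneg this.le (sq_nonneg (Real.cosh s))]

/-- Half-angle formulas with `s/2 ≤ sinh(s/2)` and `cosh s ≤ 2 cosh²(s/2)`. -/
lemma sq_mul_cosh_le {s : ℝ} (hs : 0 ≤ s) : s ^ 2 * Real.cosh s ≤ 2 * Real.sinh s ^ 2 := by
  have e1 : Real.sinh s = 2 * Real.sinh (s / 2) * Real.cosh (s / 2) := by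
    rw [← Real.sinh_two_mul]; congr 1; ring
  have e2 : Real.cosh s = Real.cosh (s / 2) ^ 2 + Real.sinh (s / 2) ^ 2 := by
    rw [← Real.cosh_two_mul]; congr 1; ring
  have h1 : s / 2 ≤ Real.sinh (s / 2) := Real.self_le_sinh_iff.2 (by positivity)
  have h2 := Real.cosh_sq (s / 2)
  have h3 : (s / 2) ^ 2 ≤ Real.sinh (s / 2) ^ 2 := by gcongr
  rw [e1, e2]
  calc s ^ 2 * (Real.cosh (s / 2) ^ 2 + Real.sinh (s / 2) ^ 2)
      ≤ 4 * Real.sinh (s / 2) ^ 2 * (2 * Real.cosh (s / 2) ^ 2) := by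
        gcongr
        · linarith
        · linarith
    _ = _ := by ring

/-- From `D² ≤ (r₁ + r₂)² cosh s`: the growth of `cosh` is paid for by one of the two factors `sinh
s` of `sinh² s`, as `sq_mul_cosh_le` makes precise, and only `1/s` remains. -/
lemma invPhaseDeriv_le (h₁ : 0 < r₁) (h₂ : 0 < r₂) {s : ℝ} (hs : 0 < s) :
    invPhaseDeriv r₁ r₂ s ≤ 2 * (r₁ + r₂) / (r₁ * r₂ * s) := by
  have hsh := Real.sinh_pos_iff.2 hs
  have hD := diffPhase_pos h₁ h₂ s
  have hQ : 0 < r₁ * r₂ := mul_pos h₁ h₂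
  unfold invPhaseDeriv
  rw [div_le_div_iff₀ (by positivity) (by positivity)]
  suffices h : diffPhase r₁ r₂ s * s ≤ 2 * (r₁ + r₂) * Real.sinh s by
    calc _ = r₁ * r₂ * (diffPhase r₁ r₂ s * s) := by ring
      _ ≤ r₁ * r₂ * (2 * (r₁ + r₂) * Real.sinh s) := by gcongr
      _ = _ := by ring
  refine le_of_sq_le_sq ?_ (by positivity)
  have h1 : diffPhase r₁ r₂ s ^ 2 ≤ (r₁ + r₂) ^ 2 * Real.cosh s := by
    rw [diffPhase_sq h₁ h₂]
    nlinarith [Real.one_le_cosh s, sq_nonneg r₁, sq_nonneg r₂]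
  calc (diffPhase r₁ r₂ s * s) ^ 2 = diffPhase r₁ r₂ s ^ 2 * s ^ 2 := mul_pow _ _ _
    _ ≤ (r₁ + r₂) ^ 2 * Real.cosh s * s ^ 2 := by gcongr
    _ = (r₁ + r₂) ^ 2 * (s ^ 2 * Real.cosh s) := by ring
    _ ≤ (r₁ + r₂) ^ 2 * (2 * Real.sinh s ^ 2) :=
        mul_le_mul_of_nonneg_left (sq_mul_cosh_le hs.le) (sq_nonneg _)
    _ ≤ _ := by nlinarith [mul_nonneg (sq_nonneg (r₁ + r₂)) (sq_nonneg (Real.sinh s))]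

end Phase

/-! ### The oscillatory integral with phase `D` -/

lemma IsBesselAmplitude.exists_bounds {b : ℝ → ℂ} (hb : IsBesselAmplitude b) :
    ∃ B : ℝ, 0 < B ∧ ∀ z, 0 < z → ‖b z‖ ≤ B ∧ ‖b z‖ ≤ B * (√z)⁻¹ ∧
      ‖deriv b z‖ ≤ B * (z * √z)⁻¹ := by
  -- One integration by parts needs only `b` and `b'`. The powers of `1 + z` are weakened to powers
  -- of `z`, which integrate exactly along the phase.
  obtain ⟨B₀, h₀⟩ := hb.symbol_bound 0
  obtain ⟨B₁, h₁⟩ := hb.symbol_bound 1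
  refine ⟨|B₀| + |B₁| + 1, by positivity, fun z hz => ?_⟩
  have hs := Real.sqrt_pos.2 hz
  have e0 := h₀ z hz
  have e1 := h₁ z hz
  simp only [iteratedDeriv_zero, iteratedDeriv_one, Nat.cast_zero, neg_zero, zero_sub,
    Nat.cast_one] at e0 e1
  have p0 : (1 + z) ^ (-(1 / 2) : ℝ) ≤ 1 :=
    Real.rpow_le_one_of_one_le_of_nonpos (by linarith) (by norm_num)
  have p1 : (1 + z) ^ (-(1 / 2) : ℝ) ≤ (√z)⁻¹ := by
    rw [Real.rpow_neg (by positivity), ← Real.sqrt_eq_rpow]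
    gcongr
    linarith
  have p2 : (1 + z) ^ (-1 - 1 / 2 : ℝ) ≤ (z * √z)⁻¹ := by
    have : (-1 - 1 / 2 : ℝ) = -(1 + 1 / 2) := by norm_num
    rw [this, Real.rpow_neg (by positivity), Real.rpow_add (by positivity), Real.rpow_one,
      ← Real.sqrt_eq_rpow]
    gcongr <;> linarith
  have a0 : |B₀| ≤ |B₀| + |B₁| + 1 := by linarith [abs_nonneg B₁]
  have a1 : |B₁| ≤ |B₀| + |B₁| + 1 := by linarith [abs_nonneg B₀]
  have hp : (0 : ℝ) ≤ (1 + z) ^ (-(1 / 2) : ℝ) := by positivity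
  have hp' : (0 : ℝ) ≤ (1 + z) ^ (-1 - 1 / 2 : ℝ) := by positivity
  have e0' : ‖b z‖ ≤ |B₀| * (1 + z) ^ (-(1 / 2) : ℝ) :=
    e0.trans (mul_le_mul_of_nonneg_right (le_abs_self _) hp)
  have e1' : ‖deriv b z‖ ≤ |B₁| * (1 + z) ^ (-1 - 1 / 2 : ℝ) :=
    e1.trans (mul_le_mul_of_nonneg_right (le_abs_self _) hp')
  refine ⟨e0'.trans ?_, e0'.trans (by gcongr), e1'.trans (by gcongr)⟩
  calc _ ≤ (|B₀| + |B₁| + 1) * 1 := by gcongr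
    _ = _ := mul_one _

/-- `e^{iD(s)} b(D(s))`. -/
def phaseAmp (b : ℝ → ℂ) (r₁ r₂ s : ℝ) : ℂ :=
  Complex.exp (Complex.I * diffPhase r₁ r₂ s) * b (diffPhase r₁ r₂ s)

lemma norm_exp_I_mul_ofReal' (x : ℝ) : ‖Complex.exp (Complex.I * x)‖ = 1 := by
  rw [mul_comm, Complex.norm_exp_ofReal_mul_I]

lemma continuous_phaseAmp {b : ℝ → ℂ} (hb : ContDiffOn ℝ ∞ b (Ioi 0)) {r₁ r₂ : ℝ} (h₁ : 0 < r₁)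
    (h₂ : 0 < r₂) : Continuous (phaseAmp b r₁ r₂) := by
  have hc := continuous_diffPhase r₁ r₂
  have := hb.continuousOn.comp_continuous hc fun s => diffPhase_pos h₁ h₂ s
  have hcC : Continuous fun s => (diffPhase r₁ r₂ s : ℂ) := Complex.continuous_ofReal.comp hc
  exact (Complex.continuous_exp.comp (continuous_const.mul hcC)).mul this

/-- Integration by parts away from the stationary point of the phase. -/
lemma norm_integral_phaseAmp_le_invPhaseDeriv {b : ℝ → ℂ} (hb : ContDiffOn ℝ ∞ b (Ioi 0)) {B : ℝ}
    (hB0 : 0 < B)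
    (hB : ∀ z, 0 < z → ‖b z‖ ≤ B * (√z)⁻¹ ∧ ‖deriv b z‖ ≤ B * (z * √z)⁻¹)
    {r₁ r₂ : ℝ} (h₁ : 0 < r₁) (h₂ : 0 < r₂) {ε S : ℝ} (hε : 0 < ε) (hS : ε ≤ S) :
    ‖∫ s in ε..S, phaseAmp b r₁ r₂ s‖ ≤ 5 * B * (√(r₁ + r₂))⁻¹ * invPhaseDeriv r₁ r₂ ε := by
  have hL : 0 < r₁ + r₂ := add_pos h₁ h₂
  set D := diffPhase r₁ r₂ with hDdef
  set q := invPhaseDeriv r₁ r₂ with hqdef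
  set D' : ℝ → ℝ := fun s => r₁ * r₂ * Real.sinh s / D s with hD'
  set q' : ℝ → ℝ := fun s => (D s)⁻¹ - D s * Real.cosh s / (r₁ * r₂ * Real.sinh s ^ 2) with hq'
  have hDp : ∀ s, 0 < D s := diffPhase_pos h₁ h₂
  have hDd : ∀ s, HasDerivAt D (D' s) s := hasDerivAt_diffPhase h₁ h₂
  have hqd : ∀ s, 0 < s → HasDerivAt q (q' s) s := fun s hs => hasDerivAt_invPhaseDeriv h₁ h₂ hs
  have hq'0 : ∀ s, 0 < s → q' s ≤ 0 := fun s hs => invPhaseDeriv_deriv_nonpos h₁ h₂ hs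
  have hsh : ∀ s : ℝ, 0 < s → 0 < Real.sinh s := fun s hs => Real.sinh_pos_iff.2 hs
  have hqp : ∀ s, 0 < s → 0 < q s := fun s hs =>
    div_pos (hDp s) (mul_pos (mul_pos h₁ h₂) (hsh s hs))
  have hD'p : ∀ s, 0 < s → 0 < D' s := fun s hs =>
    div_pos (mul_pos (mul_pos h₁ h₂) (hsh s hs)) (hDp s)
  have hDq : ∀ s, 0 < s → D' s * q s = 1 := fun s hs => by
    have := hsh s hs; have := hDp s
    simp only [hD', hqdef, invPhaseDeriv, ← hDdef]
    field_simp
  have hqanti : AntitoneOn q (Icc ε S) := by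
    refine antitoneOn_of_deriv_nonpos (convex_Icc _ _)
      (fun s hs => (hqd s (hε.trans_le hs.1)).continuousAt.continuousWithinAt)
      (fun s hs => ?_) (fun s hs => ?_)
    · rw [interior_Icc] at hs
      exact (hqd s (hε.trans hs.1)).differentiableAt.differentiableWithinAt
    · rw [interior_Icc] at hs
      rw [(hqd s (hε.trans hs.1)).deriv]
      exact hq'0 s (hε.trans hs.1)
  have hsqrt : ∀ s, (√(D s))⁻¹ ≤ (√(r₁ + r₂))⁻¹ := fun s => by
    have := Real.sqrt_pos.2 hL
    gcongr
    exact add_le_diffPhase h₁ h₂ s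
  have hbd : ∀ s, HasDerivAt (fun s => b (D s)) (D' s * deriv b (D s)) s := fun s => by
    have := hasDerivAt_iteratedDeriv_of_contDiffOn hb 0 (hDp s)
    rw [iteratedDeriv_zero, zero_add, iteratedDeriv_one] at this
    exact (this.scomp s (hDd s)).congr_deriv (by rw [Complex.real_smul])
  -- `V` is `e^{iD} b(D) / (i D')`; its derivative is the integrand up to the error `W`, where the
  -- derivative falls on `b(D)` or on `1/D'`.
  set V : ℝ → ℂ := fun s => -Complex.I * (phaseAmp b r₁ r₂ s * q s) with hV
  set W : ℝ → ℂ := fun s => Complex.I * (Complex.exp (Complex.I * D s) *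
    (deriv b (D s) + b (D s) * q' s)) with hW
  have hpos : ∀ s ∈ uIcc ε S, 0 < s := fun s hs => by
    rw [uIcc_of_le hS] at hs; exact hε.trans_le hs.1
  have hVd : ∀ s ∈ uIcc ε S, HasDerivAt V (phaseAmp b r₁ r₂ s - W s) s := by
    intro s hs
    have hs0 := hpos s hs
    have he : HasDerivAt (fun s => Complex.exp (Complex.I * D s))
        (Complex.I * D' s * Complex.exp (Complex.I * D s)) s :=
      ((hDd s).ofReal_comp.const_mul Complex.I).cexp.congr_deriv (by ring)
    have := (((he.mul (hbd s)).mul (hqd s hs0).ofReal_comp).const_mul (-Complex.I))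
    refine this.congr_deriv ?_
    have e : (D' s : ℂ) * q s = 1 := by exact_mod_cast hDq s hs0
    simp only [hW, phaseAmp, ← hDdef, Pi.mul_apply]
    linear_combination (Complex.exp (Complex.I * D s) * b (D s) -
      Complex.I * Complex.exp (Complex.I * D s) * deriv b (D s)) * e -
      Complex.exp (Complex.I * D s) * b (D s) * D' s * q s * Complex.I_sq
  have hcD : Continuous D := continuous_diffPhase r₁ r₂
  have hcq' : ContinuousOn q' (uIcc ε S) := by
    refine ContinuousOn.sub (hcD.continuousOn.inv₀ fun s _ => (hDp s).ne')
      (ContinuousOn.div (by fun_prop) (by fun_prop) fun s hs => ?_)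
    have := hsh s (hpos s hs)
    positivity
  have hcb' : Continuous fun s => deriv b (D s) := by
    have hd : ContinuousOn (deriv b) (Ioi 0) := fun z hz => by
      have := hasDerivAt_iteratedDeriv_of_contDiffOn hb 1 hz
      rw [iteratedDeriv_one] at this
      exact this.continuousAt.continuousWithinAt
    exact hd.comp_continuous hcD hDp
  have hcb : Continuous fun s => b (D s) := hb.continuousOn.comp_continuous hcD hDp
  have hcA := continuous_phaseAmp hb h₁ h₂
  have hcW : ContinuousOn W (uIcc ε S) := by
    have : ContinuousOn (fun s => ((q' s : ℝ) : ℂ)) (uIcc ε S) :=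
      Complex.continuous_ofReal.comp_continuousOn hcq'
    have hDC : Continuous fun s => (D s : ℂ) := Complex.continuous_ofReal.comp hcD
    have hE : Continuous fun s => Complex.exp (Complex.I * D s) :=
      Complex.continuous_exp.comp (continuous_const.mul hDC)
    exact continuousOn_const.mul
      (hE.continuousOn.mul (hcb'.continuousOn.add (hcb.continuousOn.mul this)))
  have hFTC := intervalIntegral.integral_eq_sub_of_hasDerivAt hVd
    ((hcA.intervalIntegrable _ _).sub hcW.intervalIntegrable)
  rw [intervalIntegral.integral_sub (hcA.intervalIntegrable _ _) hcW.intervalIntegrable] at hFTC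
  -- the antiderivative of the majorant of `W`
  set G : ℝ → ℝ := fun s => -(2 * B * q ε) * (√(D s))⁻¹ - B * (√(r₁ + r₂))⁻¹ * q s with hG
  set g : ℝ → ℝ := fun s => B * q ε * (D' s * (D s * √(D s))⁻¹) - B * (√(r₁ + r₂))⁻¹ * q' s with hg
  have hGd : ∀ s ∈ uIcc ε S, HasDerivAt G (g s) s := by
    intro s hs
    have hs0 := hpos s hs
    have hr := Real.sqrt_pos.2 (hDp s)
    have h := ((((hDd s).sqrt (hDp s).ne').inv hr.ne').const_mul (-(2 * B * q ε))).sub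
      ((hqd s hs0).const_mul (B * (√(r₁ + r₂))⁻¹))
    refine h.congr_deriv ?_
    simp only [hg]
    rw [Real.sq_sqrt (hDp s).le]
    have := hDp s
    field_simp
  have hcD' : Continuous D' := Continuous.div (by fun_prop) hcD fun s => (hDp s).ne'
  have hcg : ContinuousOn g (uIcc ε S) := by
    have h1 : Continuous fun s => (D s * √(D s))⁻¹ := by
      refine Continuous.inv₀ (by fun_prop) fun s => ?_
      have := hDp s
      positivity
    fun_prop
  have hGi := intervalIntegral.integral_eq_sub_of_hasDerivAt hGd hcg.intervalIntegrable
  have hWg : ∀ s ∈ Ioc ε S, ‖W s‖ ≤ g s := by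
    intro s hs
    have hs0 : 0 < s := hε.trans hs.1
    have hqs : q s ≤ q ε := hqanti ⟨le_rfl, hS⟩ ⟨hs.1.le, hs.2⟩ hs.1.le
    simp only [hW, hg]
    rw [norm_mul, norm_mul, Complex.norm_I, norm_exp_I_mul_ofReal', one_mul, one_mul]
    refine (norm_add_le _ _).trans ?_
    rw [norm_mul, Complex.norm_real, Real.norm_of_nonpos (hq'0 s hs0), sub_eq_add_neg]
    refine add_le_add ?_ ?_
    · have h1 : 1 ≤ D' s * q ε := by
        rw [← hDq s hs0]
        exact mul_le_mul_of_nonneg_left hqs (hD'p s hs0).le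
      have h2 : 0 ≤ B * (D s * √(D s))⁻¹ := by have := hDp s; positivity
      calc ‖deriv b (D s)‖ ≤ B * (D s * √(D s))⁻¹ := (hB _ (hDp s)).2
        _ ≤ B * (D s * √(D s))⁻¹ * (D' s * q ε) := le_mul_of_one_le_right h2 h1
        _ = _ := by ring
    · have h1 := (hB _ (hDp s)).1.trans (mul_le_mul_of_nonneg_left (hsqrt s) hB0.le)
      have := mul_le_mul_of_nonneg_right h1 (neg_nonneg.2 (hq'0 s hs0))
      linarith
  have hWn : ‖∫ s in ε..S, W s‖ ≤ ∫ s in ε..S, g s :=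
    intervalIntegral.norm_integral_le_of_norm_le hS (ae_of_all _ hWg) hcg.intervalIntegrable
  have hVn : ∀ s ∈ Icc ε S, ‖V s‖ ≤ B * (√(r₁ + r₂))⁻¹ * q ε := by
    intro s hs
    have hs0 : 0 < s := hε.trans_le hs.1
    simp only [hV, phaseAmp, ← hDdef]
    rw [norm_mul, norm_neg, Complex.norm_I, norm_mul, norm_mul, norm_exp_I_mul_ofReal', one_mul,
      one_mul, Complex.norm_real, Real.norm_of_nonneg (hqp s hs0).le]
    have h1 := (hB _ (hDp s)).1.trans (mul_le_mul_of_nonneg_left (hsqrt s) hB0.le)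
    have h3 := hqp s hs0
    have h4 : q s ≤ q ε := hqanti ⟨le_rfl, hS⟩ hs hs.1
    gcongr
  have e : ∫ s in ε..S, phaseAmp b r₁ r₂ s = V S - V ε + ∫ s in ε..S, W s := by
    linear_combination hFTC
  rw [e]
  have hS0 : 0 < S := hε.trans_le hS
  -- The term with `b'` contributes 2 and the variation of `q` contributes 1; the two boundary
  -- values of `V` bring the total to 5.
  have hGb : G S - G ε ≤ 3 * (B * (√(r₁ + r₂))⁻¹ * q ε) := by
    have h1 : 0 ≤ 2 * B * q ε * (√(D S))⁻¹ := by have := hqp ε hε; positivity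
    have h2 : 0 ≤ B * (√(r₁ + r₂))⁻¹ * q S := by have := hqp S hS0; positivity
    have h3 : 2 * B * q ε * (√(D ε))⁻¹ ≤ 2 * B * q ε * (√(r₁ + r₂))⁻¹ :=
      mul_le_mul_of_nonneg_left (hsqrt ε) (by have := hqp ε hε; positivity)
    simp only [hG]
    linarith
  calc _ ≤ ‖V S‖ + ‖V ε‖ + ‖∫ s in ε..S, W s‖ :=
        (norm_add_le _ _).trans (add_le_add_left (norm_sub_le _ _) _)
    _ ≤ B * (√(r₁ + r₂))⁻¹ * q ε + B * (√(r₁ + r₂))⁻¹ * q ε + 3 * (B * (√(r₁ + r₂))⁻¹ * q ε) :=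
        add_le_add (add_le_add (hVn S ⟨hS, le_rfl⟩) (hVn ε ⟨le_rfl, hS⟩))
          (hWn.trans (hGi.le.trans hGb))
    _ = _ := by ring

/-- The oscillatory integral with phase `D`, uniformly in the upper endpoint. -/
lemma norm_integral_phaseAmp_le {b : ℝ → ℂ} (hb : IsBesselAmplitude b) :
    ∃ C : ℝ, 0 < C ∧ ∀ r₁ r₂ S : ℝ, 0 < r₁ → 0 < r₂ → 0 ≤ S →
      ‖∫ s in (0 : ℝ)..S, phaseAmp b r₁ r₂ s‖ ≤ C * (√(r₁ * r₂))⁻¹ := by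
  obtain ⟨B, hB0, hB⟩ := hb.exists_bounds
  refine ⟨11 * B, by positivity, fun r₁ r₂ S h₁ h₂ hS => ?_⟩
  have hL : 0 < r₁ + r₂ := add_pos h₁ h₂
  have hQ : 0 < r₁ * r₂ := mul_pos h₁ h₂
  have hLs := Real.sqrt_pos.2 hL
  have hQs := Real.sqrt_pos.2 hQ
  have hc := continuous_phaseAmp hb.smooth h₁ h₂
  -- This `ε` balances the trivial bound `ε (r₁ + r₂)^{-1/2}` on `[0, ε]` against `(r₁ + r₂)^{1/2} /
  -- (r₁ r₂ ε)` from the integration by parts; both equal `(r₁ r₂)^{-1/2}`.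
  set ε : ℝ := √(r₁ + r₂) / √(r₁ * r₂) with hε
  have hε0 : 0 < ε := by positivity
  have hnear : ∀ T, 0 ≤ T → T ≤ ε →
      ‖∫ s in (0 : ℝ)..T, phaseAmp b r₁ r₂ s‖ ≤ B * (√(r₁ * r₂))⁻¹ := by
    intro T hT hTε
    have h := intervalIntegral.norm_integral_le_of_norm_le_const (a := 0) (b := T)
      (C := B * (√(r₁ + r₂))⁻¹) (f := phaseAmp b r₁ r₂) (fun s _ => by
        rw [phaseAmp, norm_mul, norm_exp_I_mul_ofReal', one_mul]
        refine (hB _ (diffPhase_pos h₁ h₂ s)).2.1.trans ?_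
        gcongr
        exact add_le_diffPhase h₁ h₂ s)
    rw [sub_zero, abs_of_nonneg hT] at h
    refine h.trans ?_
    calc _ ≤ B * (√(r₁ + r₂))⁻¹ * ε := by gcongr
      _ = _ := by rw [hε]; field_simp
  rcases le_total S ε with h | h
  · refine (hnear S hS h).trans ?_
    gcongr
    linarith
  · rw [← intervalIntegral.integral_add_adjacent_intervals (hc.intervalIntegrable 0 ε)
      (hc.intervalIntegrable ε S)]
    have h2 := norm_integral_phaseAmp_le_invPhaseDeriv hb.smooth hB0 (fun z hz => (hB z hz).2)
      h₁ h₂ hε0 h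
    have h3 : 5 * B * (√(r₁ + r₂))⁻¹ * invPhaseDeriv r₁ r₂ ε ≤ 10 * B * (√(r₁ * r₂))⁻¹ := by
      calc _ ≤ 5 * B * (√(r₁ + r₂))⁻¹ * (2 * (r₁ + r₂) / (r₁ * r₂ * ε)) := by
            gcongr; exact invPhaseDeriv_le h₁ h₂ hε0
        _ = 5 * B * (√(r₁ + r₂))⁻¹ * (2 * (√(r₁ + r₂)) ^ 2 / ((√(r₁ * r₂)) ^ 2 * ε)) := by
            rw [Real.sq_sqrt hL.le, Real.sq_sqrt hQ.le]
        _ = _ := by rw [hε]; field_simp; ring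
    calc _ ≤ B * (√(r₁ * r₂))⁻¹ + 10 * B * (√(r₁ * r₂))⁻¹ :=
          (norm_add_le _ _).trans (add_le_add (hnear ε hε0.le le_rfl) (h2.trans h3))
      _ = _ := by ring

/-- Abel summation: a decreasing weight costs only its initial value. -/
lemma norm_integral_mul_le_of_antitone {P P' : ℝ → ℝ} {h : ℝ → ℂ} {T M : ℝ} (hT : 0 ≤ T)
    (hP : ∀ s, HasDerivAt P (P' s) s) (hP'c : Continuous P') (hP' : ∀ s, 0 ≤ s → P' s ≤ 0)
    (hPT : 0 ≤ P T) (hh : Continuous h)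
    (hM : ∀ S, 0 ≤ S → ‖∫ s in (0 : ℝ)..S, h s‖ ≤ M) :
    ‖∫ s in (0 : ℝ)..T, (P s : ℂ) * h s‖ ≤ P 0 * M := by
  set H : ℝ → ℂ := fun S => ∫ s in (0 : ℝ)..S, h s with hH
  have hHd : ∀ s, HasDerivAt H (h s) s := fun s =>
    intervalIntegral.integral_hasDerivAt_right (hh.intervalIntegrable _ _)
      hh.aestronglyMeasurable.stronglyMeasurableAtFilter hh.continuousAt
  have hP'C : Continuous fun s => (P' s : ℂ) := Complex.continuous_ofReal.comp hP'c
  have hHc : Continuous H := continuous_iff_continuousAt.2 fun s => (hHd s).continuousAt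
  have hip := intervalIntegral.integral_mul_deriv_eq_deriv_mul (a := 0) (b := T)
    (fun s _ => (hP s).ofReal_comp) (fun s _ => hHd s)
    (hP'C.intervalIntegrable _ _) (hh.intervalIntegrable _ _)
  have hH0 : H 0 = 0 := by simp [hH]
  have hbd : ‖∫ s in (0 : ℝ)..T, (P' s : ℂ) * H s‖ ≤ ∫ s in (0 : ℝ)..T, -P' s * M := by
    refine intervalIntegral.norm_integral_le_of_norm_le hT (ae_of_all _ fun s hs => ?_)
      ((hP'c.neg.mul continuous_const).intervalIntegrable _ _)
    rw [norm_mul, Complex.norm_real, Real.norm_of_nonpos (hP' s hs.1.le)]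
    exact mul_le_mul_of_nonneg_left (hM s hs.1.le) (neg_nonneg.2 (hP' s hs.1.le))
  have hFT : ∫ s in (0 : ℝ)..T, -P' s * M = (P 0 - P T) * M := by
    rw [intervalIntegral.integral_mul_const, intervalIntegral.integral_neg,
      intervalIntegral.integral_eq_sub_of_hasDerivAt (fun s _ => hP s)
        (hP'c.intervalIntegrable _ _)]
    ring
  rw [hip, hH0, mul_zero, sub_zero]
  calc _ ≤ ‖(P T : ℂ) * H T‖ + ‖∫ s in (0 : ℝ)..T, (P' s : ℂ) * H s‖ := norm_sub_le _ _
    _ ≤ P T * M + (P 0 - P T) * M := by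
        refine add_le_add ?_ (hbd.trans hFT.le)
        rw [norm_mul, Complex.norm_real, Real.norm_of_nonneg hPT]
        exact mul_le_mul_of_nonneg_left (hM T hT) hPT
    _ = _ := by ring

/-! ### The angular factor -/

/-- The factor `sin(θ/ρ) / (cosh(s/ρ) - cos(θ/ρ))`. -/
def angularFactor (ρ θ s : ℝ) : ℝ :=
  Real.sin (θ / ρ) / (Real.cosh (s / ρ) - Real.cos (θ / ρ))

lemma one_add_sq_div_two_le_cosh (x : ℝ) : 1 + x ^ 2 / 2 ≤ Real.cosh x := by
  have e : Real.cosh |x| = 1 + 2 * Real.sinh (|x| / 2) ^ 2 := by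
    have h1 := Real.cosh_two_mul (|x| / 2)
    have h2 := Real.cosh_sq (|x| / 2)
    rw [show 2 * (|x| / 2) = |x| by ring] at h1
    linarith
  rw [← Real.cosh_abs, e]
  have h1 : |x| / 2 ≤ Real.sinh (|x| / 2) := Real.self_le_sinh_iff.2 (by positivity)
  have h3 : (|x| / 2) ^ 2 ≤ Real.sinh (|x| / 2) ^ 2 := by gcongr
  rw [div_pow, sq_abs] at h3
  linarith

section Angular

variable {ρ θ : ℝ}

lemma two_div_pi_sq_mul_sq_le (hφ : |θ / ρ| ≤ π) :
    2 / π ^ 2 * (θ / ρ) ^ 2 ≤ 1 - Real.cos (θ / ρ) := by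
  have := Real.cos_le_one_sub_mul_cos_sq hφ
  linarith

lemma cos_lt_one_of_abs_le (hρ : 0 < ρ) (hθ0 : θ ≠ 0) (hφ : |θ / ρ| ≤ π) :
    Real.cos (θ / ρ) < 1 := by
  have := two_div_pi_sq_mul_sq_le hφ
  have h2 : 0 < 2 / π ^ 2 * (θ / ρ) ^ 2 := by
    have : θ / ρ ≠ 0 := div_ne_zero hθ0 hρ.ne'
    positivity
  linarith

/-- This is the modulus of the angular factor at `s = 0`, the only value that Abel summation
charges. -/
lemma abs_sin_mul_inv_le (hρ : 0 < ρ) (hθ0 : θ ≠ 0) (hφ : |θ / ρ| ≤ π) :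
    |Real.sin (θ / ρ)| * (1 - Real.cos (θ / ρ))⁻¹ ≤ π ^ 2 * ρ / 2 * |θ|⁻¹ := by
  have h := two_div_pi_sq_mul_sq_le hφ
  have hθ' : 0 < |θ| := abs_pos.2 hθ0
  have hp : 0 < 2 / π ^ 2 * (θ / ρ) ^ 2 := by
    have : θ / ρ ≠ 0 := div_ne_zero hθ0 hρ.ne'
    positivity
  calc _ ≤ |θ / ρ| * (2 / π ^ 2 * (θ / ρ) ^ 2)⁻¹ :=
        mul_le_mul Real.abs_sin_le_abs (inv_anti₀ hp h) (inv_nonneg.2 (hp.le.trans h))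
          (abs_nonneg _)
    _ = _ := by
        rw [abs_div, abs_of_pos hρ, div_pow, ← sq_abs θ]
        field_simp

/-- The denominator is `(cosh(s/ρ) - 1) + (1 - cos(θ/ρ))`, and each part is bounded below by a
square. Taking the smaller constant `2/π²` for both gives a multiple of `θ² + s²`, hence a Poisson
kernel in `s` of width `|θ|`. -/
lemma abs_angularFactor_le (hρ : 0 < ρ) (hθ0 : θ ≠ 0) (hφ : |θ / ρ| ≤ π) (s : ℝ) :
    |angularFactor ρ θ s| ≤ π ^ 2 * ρ / 2 * (|θ|⁻¹ * (1 + (|θ|⁻¹ * s) ^ 2)⁻¹) := by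
  have h := two_div_pi_sq_mul_sq_le hφ
  have hθ' : 0 < |θ| := abs_pos.2 hθ0
  have h2 : 2 / π ^ 2 * (s / ρ) ^ 2 ≤ (s / ρ) ^ 2 / 2 := by
    have : 2 / π ^ 2 ≤ 1 / 2 := by
      rw [div_le_div_iff₀ (by positivity) (by norm_num)]
      nlinarith [Real.pi_gt_three]
    calc _ ≤ 1 / 2 * (s / ρ) ^ 2 := by gcongr
      _ = _ := by ring
  have h3 := one_add_sq_div_two_le_cosh (s / ρ)
  have h4 : 2 / π ^ 2 * ((θ / ρ) ^ 2 + (s / ρ) ^ 2) ≤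
      Real.cosh (s / ρ) - Real.cos (θ / ρ) := by rw [mul_add]; linarith
  have hp : 0 < 2 / π ^ 2 * ((θ / ρ) ^ 2 + (s / ρ) ^ 2) := by
    have : θ / ρ ≠ 0 := div_ne_zero hθ0 hρ.ne'
    positivity
  unfold angularFactor
  rw [abs_div, abs_of_pos (hp.trans_le h4)]
  calc _ ≤ |θ / ρ| / (2 / π ^ 2 * ((θ / ρ) ^ 2 + (s / ρ) ^ 2)) :=
        div_le_div₀ (abs_nonneg _) Real.abs_sin_le_abs hp h4
    _ = _ := by
        rw [abs_div, abs_of_pos hρ, div_pow, ← sq_abs θ]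
        have : 0 < |θ| ^ 2 + s ^ 2 := by positivity
        field_simp

lemma integral_angular_majorant (hθ0 : θ ≠ 0) :
    Integrable (fun s : ℝ => |θ|⁻¹ * (1 + (|θ|⁻¹ * s) ^ 2)⁻¹) ∧
      ∫ s : ℝ, |θ|⁻¹ * (1 + (|θ|⁻¹ * s) ^ 2)⁻¹ = π := by
  have h := integral_scaled_inv_one_add_sq (inv_pos.2 (abs_pos.2 hθ0)) 0
  have e : (fun s : ℝ => |θ|⁻¹ * (1 + (|θ|⁻¹ * (0 - s)) ^ 2)⁻¹) =
      fun s : ℝ => |θ|⁻¹ * (1 + (|θ|⁻¹ * s) ^ 2)⁻¹ := by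
    funext s; ring_nf
  rwa [e] at h

end Angular

/-! ### Pointwise bounds and measurability for the diffractive kernel -/

section Kernel

variable {δ : ℝ} {χ : 𝓢(ℝ, ℝ)} {ψ : ℝ → ℝ} {b : ℝ → ℂ}

lemma measurable_indicator_amplitude (hb : IsBesselAmplitude b) :
    Measurable ((Ioi (0 : ℝ)).indicator b) := by
  classical
  rw [← Set.piecewise_eq_indicator]
  exact hb.smooth.continuousOn.measurable_piecewise continuousOn_const measurableSet_Ioi

lemma IsUnitBump.exists_bound (hψ : IsUnitBump ψ) : ∃ M : ℝ, 0 < M ∧ ∀ x, ‖ψ x‖ ≤ M := by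
  have hcs : HasCompactSupport ψ := isCompact_Icc.of_isClosed_subset (isClosed_tsupport ψ)
    (hψ.tsupport_subset.trans Ioo_subset_Icc_self)
  obtain ⟨M, hM⟩ := hcs.exists_bound_of_continuous hψ.smooth.continuous
  exact ⟨|M| + 1, by positivity, fun x => (hM x).trans ((le_abs_self M).trans (by linarith))⟩

/-- The integrand in the formula for `a_λ` as an average of dilates of `b`. -/
def amplitudeIntegrand (χ : 𝓢(ℝ, ℝ)) (ψ : ℝ → ℝ) (b : ℝ → ℂ) (lam ζ u : ℝ) : ℂ :=
  ((χ u * ψ (u / lam) : ℝ) : ℂ) *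
    ((Ioi 0).indicator b (ζ * (lam - u)) * Complex.exp (-(Complex.I * ζ * u)))

lemma measurable_amplitudeIntegrand (χ : 𝓢(ℝ, ℝ)) (hψ : IsUnitBump ψ) (hb : IsBesselAmplitude b)
    (lam : ℝ) : Measurable fun p : ℝ × ℝ => amplitudeIntegrand χ ψ b lam p.1 p.2 := by
  have h1 : Continuous χ := χ.continuous
  have h2 : Continuous ψ := hψ.smooth.continuous
  have h3 := measurable_indicator_amplitude hb
  have h4 : Continuous fun p : ℝ × ℝ => Complex.exp (-(Complex.I * p.1 * p.2)) := by fun_prop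
  have h5 : Continuous fun p : ℝ × ℝ => ((χ p.2 * ψ (p.2 / lam) : ℝ) : ℂ) :=
    Complex.continuous_ofReal.comp (by fun_prop)
  have h6 : Continuous fun p : ℝ × ℝ => p.1 * (lam - p.2) := by fun_prop
  exact h5.measurable.mul ((h3.comp h6.measurable).mul h4.measurable)

/-- The averaged formula for `a_λ` is a parameter integral of a jointly measurable function, but
holds only for `ζ > 0`. As `D ≥ 0` for all real radii, the one other value is `D = 0`, where a
constant is assigned. -/
lemma measurable_diffAmplitude_comp_diffPhase (hχ : IsSpectralCutoff δ χ) (hψ : IsUnitBump ψ)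
    (hb : IsBesselAmplitude b) {lam : ℝ} (hlam : 0 < lam) :
    Measurable fun p : ℝ × ℝ × ℝ => diffAmplitude χ ψ b lam (diffPhase p.1 p.2.1 p.2.2) := by
  set F : ℝ → ℂ := fun ζ => if 0 < ζ then ((2 * π * lam ^ (1 / 2 : ℝ) : ℝ) : ℂ) *
      ∫ u : ℝ, amplitudeIntegrand χ ψ b lam ζ u else diffAmplitude χ ψ b lam 0 with hF
  have hFm : Measurable F := by
    refine Measurable.ite measurableSet_Ioi ?_ measurable_const
    have := (measurable_amplitudeIntegrand χ hψ hb lam).stronglyMeasurable.integral_prod_right'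
      (ν := volume)
    exact this.measurable.const_mul _
  have hD : Continuous fun p : ℝ × ℝ × ℝ => diffPhase p.1 p.2.1 p.2.2 := by
    unfold diffPhase; fun_prop
  have e : (fun p : ℝ × ℝ × ℝ => diffAmplitude χ ψ b lam (diffPhase p.1 p.2.1 p.2.2)) =
      fun p => F (diffPhase p.1 p.2.1 p.2.2) := by
    funext p
    simp only [hF]
    split_ifs with h
    · exact diffAmplitude_eq hχ hψ hb hlam h
    · have : diffPhase p.1 p.2.1 p.2.2 = 0 := le_antisymm (not_lt.1 h) (Real.sqrt_nonneg _)
      rw [this]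
  rw [e]
  exact hFm.comp hD.measurable

lemma measurable_diffIntegrand (hχ : IsSpectralCutoff δ χ) (hψ : IsUnitBump ψ)
    (hb : IsBesselAmplitude b) (ρ : ℝ) {lam : ℝ} (hlam : 0 < lam) :
    Measurable fun p : (ℝ × ℝ × ℝ) × ℝ =>
      diffIntegrand ρ χ ψ b lam p.1.1 p.1.2.1 p.1.2.2 p.2 := by
  have h1 := (measurable_diffAmplitude_comp_diffPhase hχ hψ hb hlam).comp
    (f := fun p : (ℝ × ℝ × ℝ) × ℝ => (p.1.1, p.1.2.1, p.2)) (by fun_prop)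
  have h2 : Continuous fun p : (ℝ × ℝ × ℝ) × ℝ => Complex.exp
      (Complex.I * lam * diffPhase p.1.1 p.1.2.1 p.2) := by
    have : Continuous fun p : (ℝ × ℝ × ℝ) × ℝ => diffPhase p.1.1 p.1.2.1 p.2 := by
      unfold diffPhase; fun_prop
    have := Complex.continuous_ofReal.comp this
    exact Complex.continuous_exp.comp (continuous_const.mul this)
  have h3 : Measurable fun p : (ℝ × ℝ × ℝ) × ℝ =>
      ((Real.sin (p.1.2.2 / ρ) / (Real.cosh (p.2 / ρ) - Real.cos (p.1.2.2 / ρ)) : ℝ) : ℂ) := by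
    have e1 : Measurable fun p : (ℝ × ℝ × ℝ) × ℝ => Real.sin (p.1.2.2 / ρ) :=
      Continuous.measurable (by fun_prop)
    have e2 : Measurable fun p : (ℝ × ℝ × ℝ) × ℝ =>
        Real.cosh (p.2 / ρ) - Real.cos (p.1.2.2 / ρ) := Continuous.measurable (by fun_prop)
    exact Complex.measurable_ofReal.comp (e1.div e2)
  exact (h2.measurable.mul h3).mul h1

/-- By periodicity the angle may be brought into `|θ/ρ| ≤ π`, the range in which `1 - cos` has a
quadratic lower bound. -/
lemma exists_abs_le_diffIntegrand_eq (ρ : ℝ) (hρ : 0 < ρ) (θ : ℝ) :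
    ∃ θ' : ℝ, |θ' / ρ| ≤ π ∧ ∀ (χ : 𝓢(ℝ, ℝ)) (ψ : ℝ → ℝ) (b : ℝ → ℂ) (lam r₁ r₂ : ℝ),
      diffIntegrand ρ χ ψ b lam r₁ r₂ θ = diffIntegrand ρ χ ψ b lam r₁ r₂ θ' := by
  have h2 : (0 : ℝ) < 2 * π := by positivity
  refine ⟨ρ * toIocMod h2 (-π) (θ / ρ), ?_, fun χ ψ b lam r₁ r₂ => ?_⟩
  · rw [mul_div_cancel_left₀ _ hρ.ne']
    have := toIocMod_mem_Ioc h2 (-π) (θ / ρ)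
    rw [abs_le]
    exact ⟨this.1.le, by linarith [this.2]⟩
  · have e := self_sub_toIocDiv_zsmul h2 (-π) (θ / ρ)
    rw [zsmul_eq_mul] at e
    funext s
    unfold diffIntegrand
    rw [mul_div_cancel_left₀ _ hρ.ne', ← e, Real.sin_sub_int_mul_two_pi,
      Real.cos_sub_int_mul_two_pi]

lemma diffIntegrand_zero (ρ lam r₁ r₂ : ℝ) : diffIntegrand ρ χ ψ b lam r₁ r₂ 0 = fun _ => 0 := by
  funext s
  simp [diffIntegrand]

/-- Decay of the amplitude in `D` becomes decay in `r₁` because `D ≥ r₁ + r₂`; the exponential has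
modulus one. -/
lemma norm_diffIntegrand_le {ρ : ℝ} (hρ : 0 < ρ) {A lam : ℝ}
    (hA : ∀ ζ : ℝ, 0 < ζ → ‖diffAmplitude χ ψ b lam ζ‖ ≤ A / (1 + ζ) ^ 3)
    {r₁ r₂ θ : ℝ} (h₁ : 0 < r₁) (h₂ : 0 < r₂) (hθ0 : θ ≠ 0) (hφ : |θ / ρ| ≤ π) (s : ℝ) :
    ‖diffIntegrand ρ χ ψ b lam r₁ r₂ θ s‖ ≤ π ^ 2 * ρ / 2 * (A / (1 + r₁) ^ 3) *
      (|θ|⁻¹ * (1 + (|θ|⁻¹ * s) ^ 2)⁻¹) := by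
  have hD := diffPhase_pos h₁ h₂ s
  have e1 : ‖Complex.exp (Complex.I * lam * diffPhase r₁ r₂ s)‖ = 1 := by
    have := norm_exp_I_mul_ofReal' (lam * diffPhase r₁ r₂ s)
    push_cast at this
    rwa [← mul_assoc] at this
  have hA0 : 0 ≤ A := by
    have := (norm_nonneg _).trans (hA _ hD)
    by_contra h
    have := div_neg_of_neg_of_pos (not_le.1 h) (show 0 < (1 + diffPhase r₁ r₂ s) ^ 3 by positivity)
    linarith
  have e2 : ‖diffAmplitude χ ψ b lam (diffPhase r₁ r₂ s)‖ ≤ A / (1 + r₁) ^ 3 := by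
    refine (hA _ hD).trans ?_
    gcongr
    linarith [add_le_diffPhase h₁ h₂ s]
  have e3 := abs_angularFactor_le hρ hθ0 hφ s
  unfold angularFactor at e3
  unfold diffIntegrand
  rw [norm_mul, norm_mul, e1, one_mul, Complex.norm_real, Real.norm_eq_abs]
  calc _ ≤ π ^ 2 * ρ / 2 * (|θ|⁻¹ * (1 + (|θ|⁻¹ * s) ^ 2)⁻¹) * (A / (1 + r₁) ^ 3) := by gcongr
    _ = _ := by ring

/-- Absolute convergence of the integral defining the diffractive kernel. -/
lemma integrableOn_diffIntegrand (hδ : 0 < δ) (hχ : IsSpectralCutoff δ χ) (hψ : IsUnitBump ψ)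
    (hb : IsBesselAmplitude b) {ρ : ℝ} (hρ : 0 < ρ) {lam r₁ r₂ : ℝ} (hlam : 1 ≤ lam)
    (h₁ : 0 < r₁) (h₂ : 0 < r₂) (θ : ℝ) :
    IntegrableOn (diffIntegrand ρ χ ψ b lam r₁ r₂ θ) (Ioi 0) := by
  obtain ⟨A, -, hA⟩ := norm_diffAmplitude_le hδ hχ hψ hb
  obtain ⟨θ', hφ, he⟩ := exists_abs_le_diffIntegrand_eq ρ hρ θ
  rw [he]
  by_cases hθ0 : θ' = 0
  · rw [hθ0, diffIntegrand_zero]; exact integrableOn_zero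
  refine Integrable.integrableOn ?_
  refine ((integral_angular_majorant hθ0).1.const_mul _).mono' ?_
    (ae_of_all _ (norm_diffIntegrand_le hρ (fun ζ => hA lam ζ hlam) h₁ h₂ hθ0 hφ))
  exact ((measurable_diffIntegrand hχ hψ hb ρ (by linarith : 0 < lam)).comp
    (f := fun s : ℝ => ((r₁, r₂, θ'), s)) (by fun_prop)).aestronglyMeasurable

/-- The Poisson majorant has mass `π`, so the singularity at `θ = 0` disappears after integration in
`s`. -/
lemma norm_diffKernel_le {ρ : ℝ} (hρ : 0 < ρ) {A lam : ℝ}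
    (hA : ∀ ζ : ℝ, 0 < ζ → ‖diffAmplitude χ ψ b lam ζ‖ ≤ A / (1 + ζ) ^ 3)
    {r₁ r₂ θ : ℝ} (h₁ : 0 < r₁) (h₂ : 0 < r₂) (hθ0 : θ ≠ 0) (hφ : |θ / ρ| ≤ π) :
    ‖diffKernel ρ χ ψ b lam r₁ r₂ θ‖ ≤ π ^ 3 * ρ / 2 * A / (1 + r₁) ^ 3 := by
  obtain ⟨hi, hπ⟩ := integral_angular_majorant hθ0
  have hb := norm_diffIntegrand_le hρ hA h₁ h₂ hθ0 hφ
  have hc := hi.const_mul (π ^ 2 * ρ / 2 * (A / (1 + r₁) ^ 3))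
  unfold diffKernel
  calc _ ≤ ∫ s in Ioi (0 : ℝ), π ^ 2 * ρ / 2 * (A / (1 + r₁) ^ 3) *
        (|θ|⁻¹ * (1 + (|θ|⁻¹ * s) ^ 2)⁻¹) :=
        norm_integral_le_of_norm_le hc.integrableOn (ae_of_all _ hb)
    _ ≤ ∫ s : ℝ, π ^ 2 * ρ / 2 * (A / (1 + r₁) ^ 3) * (|θ|⁻¹ * (1 + (|θ|⁻¹ * s) ^ 2)⁻¹) :=
        setIntegral_le_integral hc (ae_of_all _ fun s => (norm_nonneg _).trans (hb s))
    _ = _ := by rw [integral_const_mul, hπ]; ring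

/-- The factors `e^{iλD}` and `e^{-iDu}` combine to `e^{i(λ - u)D}`, matching the argument `(λ - u)
D` of `b`. The support of `ψ` keeps the new frequency above `λ/2`. -/
lemma amplitudeIntegrand_mul_exp_eq (hψ : IsUnitBump ψ) {lam u r₁ r₂ : ℝ}
    (hlam : 0 < lam) (hu : ψ (u / lam) ≠ 0) (h₁ : 0 < r₁) (h₂ : 0 < r₂) (s : ℝ) :
    lam / 2 < lam - u ∧ Complex.exp (Complex.I * lam * diffPhase r₁ r₂ s) *
      amplitudeIntegrand χ ψ b lam (diffPhase r₁ r₂ s) u =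
      ((χ u * ψ (u / lam) : ℝ) : ℂ) * phaseAmp b ((lam - u) * r₁) ((lam - u) * r₂) s := by
  have h5 := (hψ.tsupport_subset (subset_tsupport _ hu)).2
  rw [div_lt_iff₀ hlam] at h5
  have hm : lam / 2 < lam - u := by linarith
  have hm0 : 0 < lam - u := by linarith
  refine ⟨hm, ?_⟩
  have hmem : diffPhase r₁ r₂ s * (lam - u) ∈ Ioi (0 : ℝ) := mul_pos (diffPhase_pos h₁ h₂ s) hm0
  rw [amplitudeIntegrand, phaseAmp, diffPhase_mul hm0.le, indicator_of_mem hmem,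
    mul_comm (diffPhase r₁ r₂ s) (lam - u)]
  have e : Complex.exp (Complex.I * (((lam - u) * diffPhase r₁ r₂ s : ℝ) : ℂ)) =
      Complex.exp (Complex.I * lam * diffPhase r₁ r₂ s) *
        Complex.exp (-(Complex.I * diffPhase r₁ r₂ s * u)) := by
    rw [← Complex.exp_add]; congr 1; push_cast; ring
  rw [e]
  ring

lemma norm_integral_phaseAmp_dilate_le {C : ℝ} (hC0 : 0 < C)
    (hC : ∀ r₁ r₂ S : ℝ, 0 < r₁ → 0 < r₂ → 0 ≤ S →
      ‖∫ s in (0 : ℝ)..S, phaseAmp b r₁ r₂ s‖ ≤ C * (√(r₁ * r₂))⁻¹)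
    {lam m r₁ r₂ S : ℝ} (hlam : 0 < lam) (hm : lam / 2 < m) (h₁ : 0 < r₁) (h₂ : 0 < r₂)
    (hS : 0 ≤ S) :
    ‖∫ s in (0 : ℝ)..S, phaseAmp b (m * r₁) (m * r₂) s‖ ≤ 2 * C * (lam * √(r₁ * r₂))⁻¹ := by
  have hm0 : 0 < m := by linarith
  have hQ := Real.sqrt_pos.2 (mul_pos h₁ h₂)
  refine (hC _ _ S (mul_pos hm0 h₁) (mul_pos hm0 h₂) hS).trans ?_
  have e : √(m * r₁ * (m * r₂)) = m * √(r₁ * r₂) := by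
    rw [show m * r₁ * (m * r₂) = m ^ 2 * (r₁ * r₂) by ring, Real.sqrt_mul (sq_nonneg m),
      Real.sqrt_sq hm0.le]
  rw [e]
  calc C * (m * √(r₁ * r₂))⁻¹ ≤ C * (lam / 2 * √(r₁ * r₂))⁻¹ := by gcongr
    _ = _ := by field_simp

/-- The truncated kernel, by stationary phase in `s`. -/
lemma norm_integral_diffIntegrand_le (hχ : IsSpectralCutoff δ χ) (hψ : IsUnitBump ψ)
    (hb : IsBesselAmplitude b) {ρ : ℝ} (hρ : 0 < ρ) {C M : ℝ} (hC0 : 0 < C)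
    (hC : ∀ r₁ r₂ S : ℝ, 0 < r₁ → 0 < r₂ → 0 ≤ S →
      ‖∫ s in (0 : ℝ)..S, phaseAmp b r₁ r₂ s‖ ≤ C * (√(r₁ * r₂))⁻¹)
    (hM : ∀ x, ‖ψ x‖ ≤ M)
    {lam r₁ r₂ θ T : ℝ} (hlam : 0 < lam) (h₁ : 0 < r₁) (h₂ : 0 < r₂) (hθ0 : θ ≠ 0)
    (hφ : |θ / ρ| ≤ π) (hT : 0 ≤ T) :
    ‖∫ s in (0 : ℝ)..T, diffIntegrand ρ χ ψ b lam r₁ r₂ θ s‖ ≤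
      (2 * π ^ 3 * ρ * C * M * ∫ u, ‖χ u‖) * (√(lam * r₁ * r₂))⁻¹ * |θ|⁻¹ := by
  obtain ⟨B, hB0, hB⟩ := hb.exists_bounds
  have hM0 : 0 ≤ M := (norm_nonneg _).trans (hM 0)
  set c := Real.cos (θ / ρ) with hc
  have hc1 : c < 1 := cos_lt_one_of_abs_le hρ hθ0 hφ
  set P : ℝ → ℝ := fun s => (Real.cosh (s / ρ) - c)⁻¹ with hP
  have hden : ∀ s : ℝ, 1 - c ≤ Real.cosh (s / ρ) - c := fun s => by
    linarith [Real.one_le_cosh (s / ρ)]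
  have hden0 : ∀ s : ℝ, 0 < Real.cosh (s / ρ) - c := fun s => (sub_pos.2 hc1).trans_le (hden s)
  have hP0 : ∀ s, 0 < P s := fun s => inv_pos.2 (hden0 s)
  have hPle : ∀ s, P s ≤ (1 - c)⁻¹ := fun s => inv_anti₀ (sub_pos.2 hc1) (hden s)
  have hPc : Continuous P := Continuous.inv₀ (by fun_prop) fun s => (hden0 s).ne'
  set P' : ℝ → ℝ := fun s => -(Real.sinh (s / ρ) * ρ⁻¹) / (Real.cosh (s / ρ) - c) ^ 2 with hP'
  have hPd : ∀ s, HasDerivAt P (P' s) s := fun s => by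
    have h1 : HasDerivAt (fun s : ℝ => s / ρ) ρ⁻¹ s := by
      simpa using (hasDerivAt_id s).div_const ρ
    exact ((h1.cosh).sub_const c).inv (hden0 s).ne'
  have hP'c : Continuous P' :=
    Continuous.div (by fun_prop) (by fun_prop) fun s => (pow_pos (hden0 s) 2).ne'
  have hP'0 : ∀ s, 0 ≤ s → P' s ≤ 0 := fun s hs => by
    have : 0 ≤ Real.sinh (s / ρ) := Real.sinh_nonneg_iff.2 (by positivity)
    have h2 : 0 ≤ Real.sinh (s / ρ) * ρ⁻¹ := by positivity
    exact div_nonpos_of_nonpos_of_nonneg (neg_nonpos.2 h2) (sq_nonneg _)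
  set κ : ℝ := 2 * π * lam ^ (1 / 2 : ℝ) with hκ
  have hκ0 : 0 ≤ κ := by positivity
  set Ψ : ℝ → ℝ → ℂ := fun s u => (P s : ℂ) *
    (Complex.exp (Complex.I * lam * diffPhase r₁ r₂ s) *
      amplitudeIntegrand χ ψ b lam (diffPhase r₁ r₂ s) u) with hΨ
  have e1 : ∀ s, diffIntegrand ρ χ ψ b lam r₁ r₂ θ s =
      ((κ * Real.sin (θ / ρ) : ℝ) : ℂ) * ∫ u, Ψ s u := by
    intro s
    simp only [hΨ]
    rw [integral_const_mul, integral_const_mul]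
    unfold diffIntegrand
    rw [diffAmplitude_eq hχ hψ hb hlam (diffPhase_pos h₁ h₂ s)]
    simp only [hP, ← hc, ← hκ, amplitudeIntegrand]
    rw [div_eq_mul_inv]
    push_cast
    ring
  have hexp : ∀ s, ‖Complex.exp (Complex.I * lam * diffPhase r₁ r₂ s)‖ = 1 := fun s => by
    have := norm_exp_I_mul_ofReal' (lam * diffPhase r₁ r₂ s)
    push_cast at this
    rwa [← mul_assoc] at this
  -- This crude bound, far from uniform in `θ`, serves only Fubini on the finite interval `[0, T]`.
  have hΨb : ∀ s u, ‖Ψ s u‖ ≤ (1 - c)⁻¹ * M * B * ‖χ u‖ := by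
    intro s u
    have hind : ‖(Ioi (0 : ℝ)).indicator b (diffPhase r₁ r₂ s * (lam - u))‖ ≤ B := by
      by_cases h : diffPhase r₁ r₂ s * (lam - u) ∈ Ioi (0 : ℝ)
      · rw [indicator_of_mem h]; exact (hB _ h).1
      · rw [indicator_of_notMem h, norm_zero]; exact hB0.le
    simp only [hΨ, amplitudeIntegrand]
    rw [norm_mul, norm_mul, hexp, one_mul, norm_mul, norm_mul, norm_exp_neg_I_mul, mul_one,
      Complex.norm_real, Complex.norm_real, norm_mul, Real.norm_of_nonneg (hP0 s).le]
    have hc0 : 0 ≤ (1 - c)⁻¹ := (inv_pos.2 (sub_pos.2 hc1)).le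
    calc _ ≤ (1 - c)⁻¹ * (‖χ u‖ * M * B) := by
          gcongr
          · exact hPle s
          · exact hM _
      _ = _ := by ring
  have hΨm : Measurable (Function.uncurry Ψ) := by
    have m1 : Measurable fun p : ℝ × ℝ => (P p.1 : ℂ) :=
      (Complex.continuous_ofReal.comp (hPc.comp continuous_fst)).measurable
    have hD : Continuous fun p : ℝ × ℝ => diffPhase r₁ r₂ p.1 :=
      (continuous_diffPhase r₁ r₂).comp continuous_fst
    have m2 : Measurable fun p : ℝ × ℝ =>
        Complex.exp (Complex.I * lam * diffPhase r₁ r₂ p.1) :=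
      (Complex.continuous_exp.comp
        (continuous_const.mul (Complex.continuous_ofReal.comp hD))).measurable
    have m3 := (measurable_amplitudeIntegrand χ hψ hb lam).comp (hD.measurable.prodMk measurable_snd)
    exact m1.mul (m2.mul m3)
  have hΨi : Integrable (Function.uncurry Ψ) ((volume.restrict (Ioc 0 T)).prod volume) := by
    have hχi : Integrable fun u => ‖χ u‖ := χ.integrable.norm
    have := (integrable_const (μ := volume.restrict (Ioc (0 : ℝ) T))
      ((1 - c)⁻¹ * M * B)).mul_prod hχi
    exact this.mono' hΨm.aestronglyMeasurable (ae_of_all _ fun p => hΨb p.1 p.2)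
  have hinner : ∀ u, ‖∫ s in Ioc 0 T, Ψ s u‖ ≤
      ‖χ u‖ * (M * ((1 - c)⁻¹ * (2 * C * (lam * √(r₁ * r₂))⁻¹))) := by
    intro u
    have hQ := Real.sqrt_pos.2 (mul_pos h₁ h₂)
    have hc0 : 0 < (1 - c)⁻¹ := inv_pos.2 (sub_pos.2 hc1)
    by_cases hu : ψ (u / lam) = 0
    · simp only [hΨ, amplitudeIntegrand, hu, mul_zero, Complex.ofReal_zero, zero_mul,
        integral_zero, norm_zero]
      positivity
    have hm := (amplitudeIntegrand_mul_exp_eq (χ := χ) (b := b) hψ hlam hu h₁ h₂ 0).1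
    have hm0 : 0 < lam - u := by linarith
    have e2 : ∀ s, Ψ s u = ((χ u * ψ (u / lam) : ℝ) : ℂ) *
        ((P s : ℂ) * phaseAmp b ((lam - u) * r₁) ((lam - u) * r₂) s) := fun s => by
      simp only [hΨ]
      rw [(amplitudeIntegrand_mul_exp_eq hψ hlam hu h₁ h₂ s).2]
      ring
    simp_rw [e2]
    rw [integral_const_mul, norm_mul, Complex.norm_real, norm_mul, mul_assoc,
      ← intervalIntegral.integral_of_le hT]
    -- For each fixed `u` the weight `P` is decreasing and the partial integrals of the oscillating
    -- factor are uniformly `O(λ⁻¹ (r₁ r₂)^{-1/2})`.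
    have h3 := norm_integral_mul_le_of_antitone hT hPd hP'c hP'0 (hP0 T).le
      (continuous_phaseAmp hb.smooth (mul_pos hm0 h₁) (mul_pos hm0 h₂))
      (fun S hS => norm_integral_phaseAmp_dilate_le hC0 hC hlam hm h₁ h₂ hS)
    have h4 : P 0 = (1 - c)⁻¹ := by simp [hP]
    rw [h4] at h3
    gcongr
    exact hM _
  have e3 : ∫ s in (0 : ℝ)..T, diffIntegrand ρ χ ψ b lam r₁ r₂ θ s =
      ((κ * Real.sin (θ / ρ) : ℝ) : ℂ) * ∫ u, ∫ s in Ioc 0 T, Ψ s u := by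
    simp_rw [e1]
    rw [intervalIntegral.integral_const_mul, intervalIntegral.integral_of_le hT,
      integral_integral_swap hΨi]
  have hnorm := norm_integral_le_of_norm_le ((χ.integrable (μ := volume)).norm.mul_const
    (M * ((1 - c)⁻¹ * (2 * C * (lam * √(r₁ * r₂))⁻¹)))) (ae_of_all _ hinner)
  rw [integral_mul_const] at hnorm
  have hX : 0 ≤ ∫ u, ‖χ u‖ := integral_nonneg fun _ => norm_nonneg _
  have hl := Real.sqrt_pos.2 hlam
  have hQ := Real.sqrt_pos.2 (mul_pos h₁ h₂)
  -- The normalization `λ^{1/2}` of the amplitude against the gain `λ⁻¹` leaves `λ^{-1/2}`.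
  have hκe : κ * (lam * √(r₁ * r₂))⁻¹ = 2 * π * (√(lam * r₁ * r₂))⁻¹ := by
    rw [hκ, ← Real.sqrt_eq_rpow, mul_assoc lam, Real.sqrt_mul hlam.le]
    have : lam = √lam * √lam := (Real.mul_self_sqrt hlam.le).symm
    field_simp
    rw [sq, ← this]
  rw [e3, norm_mul, Complex.norm_real, norm_mul, Real.norm_of_nonneg hκ0, Real.norm_eq_abs]
  calc _ ≤ κ * |Real.sin (θ / ρ)| * ((∫ u, ‖χ u‖) *
        (M * ((1 - c)⁻¹ * (2 * C * (lam * √(r₁ * r₂))⁻¹)))) := by gcongr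
    _ = 2 * C * M * (∫ u, ‖χ u‖) * (κ * (lam * √(r₁ * r₂))⁻¹) *
          (|Real.sin (θ / ρ)| * (1 - c)⁻¹) := by ring
    _ ≤ 2 * C * M * (∫ u, ‖χ u‖) * (κ * (lam * √(r₁ * r₂))⁻¹) *
          (π ^ 2 * ρ / 2 * |θ|⁻¹) :=
        mul_le_mul_of_nonneg_left (abs_sin_mul_inv_le hρ hθ0 hφ) (by positivity)
    _ = _ := by rw [hκe]; ring

/-- The two pointwise bounds for the diffractive kernel. -/
lemma exists_norm_diffKernelCircle_le (hδ : 0 < δ) (hχ : IsSpectralCutoff δ χ) (hψ : IsUnitBump ψ)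
    (hb : IsBesselAmplitude b) (ρ : ℝ) [hρ : Fact (0 < ρ)] :
    ∃ C : ℝ, 0 < C ∧ ∀ lam r₁ r₂ : ℝ, 1 ≤ lam → 0 < r₁ → 0 < r₂ → ∀ z : AddCircle (2 * π * ρ),
      ‖diffKernelCircle ρ χ ψ b lam r₁ r₂ z‖ ≤ C * ((1 + r₁) ^ 3)⁻¹ ∧
      ‖diffKernelCircle ρ χ ψ b lam r₁ r₂ z‖ ≤ C * ((√(lam * r₁ * r₂))⁻¹ * ‖z‖⁻¹) := by
  have hρ0 := hρ.out
  obtain ⟨A, hA0, hA⟩ := norm_diffAmplitude_le hδ hχ hψ hb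
  obtain ⟨E, hE0, hE⟩ := norm_integral_phaseAmp_le hb
  obtain ⟨M, hM0, hM⟩ := hψ.exists_bound
  have hX : 0 ≤ ∫ u, ‖χ u‖ := integral_nonneg fun _ => norm_nonneg _
  set C₁ := π ^ 3 * ρ / 2 * A with hC₁
  set C₂ := 2 * π ^ 3 * ρ * E * M * ∫ u, ‖χ u‖ with hC₂
  have hC₁0 : 0 < C₁ := by positivity
  have hC₂0 : 0 ≤ C₂ := by positivity
  refine ⟨C₁ + C₂, by positivity, fun lam r₁ r₂ hlam h₁ h₂ z => ?_⟩
  have hp : (0 : ℝ) < 2 * π * ρ := by positivity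
  set θ : ℝ := (AddCircle.equivIoc (2 * π * ρ) (-(π * ρ)) z : ℝ) with hθ
  have hmem : θ ∈ Ioc (-(π * ρ)) (-(π * ρ) + 2 * π * ρ) :=
    (AddCircle.equivIoc (2 * π * ρ) (-(π * ρ)) z).2
  have hz : (θ : AddCircle (2 * π * ρ)) = z := AddCircle.coe_equivIoc
  have habs : |θ| ≤ π * ρ := abs_le.2 ⟨hmem.1.le, by linarith [hmem.2]⟩
  have hφ : |θ / ρ| ≤ π := by rwa [abs_div, abs_of_pos hρ0, div_le_iff₀ hρ0]
  have hnz : ‖z‖ = |θ| := by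
    rw [← hz, AddCircle.norm_coe_eq_abs_iff _ hp.ne', abs_of_pos hp]
    linarith
  have hK : diffKernelCircle ρ χ ψ b lam r₁ r₂ z = diffKernel ρ χ ψ b lam r₁ r₂ θ := by
    rw [← hz]; exact Function.Periodic.lift_coe _ _
  rw [hK, hnz]
  -- At `θ = 0` the sine makes the kernel vanish, consistently with the second bound, whose right
  -- side is zero by `0⁻¹ = 0`.
  by_cases hθ0 : θ = 0
  · have : diffKernel ρ χ ψ b lam r₁ r₂ θ = 0 := by
      unfold diffKernel
      rw [hθ0, diffIntegrand_zero]
      exact integral_zero _ _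
    rw [this, norm_zero]
    constructor <;> positivity
  constructor
  · refine (norm_diffKernel_le hρ0 (fun ζ => hA lam ζ hlam) h₁ h₂ hθ0 hφ).trans ?_
    rw [div_eq_mul_inv]
    gcongr
    linarith
  -- The bound for the truncated integral is uniform in `T`; absolute convergence carries it to the
  -- limit.
  · have hlim := (intervalIntegral_tendsto_integral_Ioi 0
      (integrableOn_diffIntegrand hδ hχ hψ hb hρ0 hlam h₁ h₂ θ) tendsto_id).norm
    refine le_of_tendsto hlim ?_
    filter_upwards [eventually_ge_atTop 0] with T hT
    refine (norm_integral_diffIntegrand_le hχ hψ hb hρ0 hE0 hE hM (by linarith) h₁ h₂ hθ0 hφ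
      hT).trans ?_
    rw [mul_assoc]
    gcongr
    linarith

lemma diffKernelCircle_eq (ρ : ℝ) [hρ : Fact (0 < ρ)] (χ : 𝓢(ℝ, ℝ)) (ψ : ℝ → ℝ) (b : ℝ → ℂ)
    (lam r₁ r₂ a : ℝ) (z : AddCircle (2 * π * ρ)) : diffKernelCircle ρ χ ψ b lam r₁ r₂ z =
      diffKernel ρ χ ψ b lam r₁ r₂ (AddCircle.equivIoc (2 * π * ρ) a z : ℝ) := by
  have hz : ((AddCircle.equivIoc (2 * π * ρ) a z : ℝ) : AddCircle (2 * π * ρ)) = z :=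
    AddCircle.coe_equivIoc
  conv_lhs => rw [← hz]
  exact Function.Periodic.lift_coe _ _

/-- Joint measurability of the diffractive kernel. -/
lemma measurable_diffKernelCircle (hχ : IsSpectralCutoff δ χ) (hψ : IsUnitBump ψ)
    (hb : IsBesselAmplitude b) (ρ : ℝ) [hρ : Fact (0 < ρ)] {lam : ℝ} (hlam : 0 < lam) :
    Measurable fun p : Cone ρ × Cone ρ =>
      diffKernelCircle ρ χ ψ b lam p.2.1 p.1.1 (p.1.2 - p.2.2) := by
  have h1 : Measurable fun q : ℝ × ℝ × ℝ => diffKernel ρ χ ψ b lam q.1 q.2.1 q.2.2 :=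
    ((measurable_diffIntegrand hχ hψ hb ρ hlam).stronglyMeasurable.integral_prod_right'
      (ν := volume.restrict (Ioi 0))).measurable
  have h2 : Measurable fun z : AddCircle (2 * π * ρ) =>
      (AddCircle.equivIoc (2 * π * ρ) (-(π * ρ)) z : ℝ) :=
    measurable_subtype_coe.comp (AddCircle.measurableEquivIoc (2 * π * ρ) (-(π * ρ))).measurable
  have h4 : Measurable fun p : Cone ρ × Cone ρ => p.1.2 - p.2.2 :=
    (measurable_snd.comp measurable_fst).sub (measurable_snd.comp measurable_snd)
  have h3 : Measurable fun p : Cone ρ × Cone ρ => ((p.2.1, p.1.1,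
      (AddCircle.equivIoc (2 * π * ρ) (-(π * ρ)) (p.1.2 - p.2.2) : ℝ)) : ℝ × ℝ × ℝ) :=
    (measurable_fst.comp measurable_snd).prodMk
      ((measurable_fst.comp measurable_fst).prodMk (h2.comp h4))
  simp_rw [diffKernelCircle_eq ρ χ ψ b lam _ _ (-(π * ρ))]
  generalize diffKernel ρ χ ψ b lam = F at h1 ⊢
  generalize AddCircle.equivIoc (2 * π * ρ) (-(π * ρ)) = G at h3 ⊢
  exact h1.comp h3

end Kernel

/-! ### Fractional integration on the circle -/

section HLS

variable {T : ℝ}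

lemma lintegral_comp_abs_le (φ : ℝ → ℝ≥0∞) :
    ∫⁻ x : ℝ, φ |x| = 2 * ∫⁻ x in Ioi (0 : ℝ), φ x := by
  have h1 : ∫⁻ x in Ioi (0 : ℝ), φ |x| = ∫⁻ x in Ioi (0 : ℝ), φ x :=
    setLIntegral_congr_fun measurableSet_Ioi fun x hx => by
      simp only [abs_of_pos (mem_Ioi.1 hx)]
  have h2 : ∫⁻ x in Iio (0 : ℝ), φ |x| = ∫⁻ x in Ioi (0 : ℝ), φ x := by
    rw [← h1, ← lintegral_indicator measurableSet_Iio, ← lintegral_indicator measurableSet_Ioi,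
      ← lintegral_neg_eq_self]
    congr 1
    funext x
    by_cases hx : 0 < x
    · rw [indicator_of_mem (by simpa using hx), indicator_of_mem (by simpa using hx), abs_neg]
    · rw [indicator_of_notMem (by simpa using hx), indicator_of_notMem (by simpa using hx)]
  rw [← lintegral_add_compl (μ := volume) (fun x : ℝ => φ |x|) (measurableSet_Ioi (a := (0 : ℝ))),
    compl_Ioi, setLIntegral_congr (Iio_ae_eq_Iic (a := (0 : ℝ))).symm, h1, h2, two_mul]

/-- The kernel of fractional integration `‖z‖^{-2/3}`. -/
def fracKernel (z : AddCircle T) : ℝ≥0∞ := ENNReal.ofReal (‖z‖ ^ (-(2 / 3) : ℝ))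

lemma measurable_fracKernel : Measurable (fracKernel : AddCircle T → ℝ≥0∞) :=
  ENNReal.measurable_ofReal.comp (measurable_norm.pow_const _)

/-- Radii are written as cubes here and below, so that `‖z‖^{-2/3}` and its integrals become integer
powers of `r`. -/
lemma fracKernel_le_of_le {r : ℝ} (hr : 0 < r) {z : AddCircle T} (hz : r ^ 3 ≤ ‖z‖) :
    fracKernel z ≤ ENNReal.ofReal (r⁻¹ ^ 2) := by
  apply ENNReal.ofReal_le_ofReal
  have h := Real.rpow_le_rpow_of_nonpos (by positivity : 0 < r ^ 3) hz
    (show (-(2 / 3) : ℝ) ≤ 0 by norm_num)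
  refine h.trans (le_of_eq ?_)
  rw [← Real.rpow_natCast, ← Real.rpow_mul hr.le, inv_pow, ← Real.rpow_natCast,
    ← Real.rpow_neg hr.le]
  norm_num

/-- A weighted arithmetic–geometric inequality without the factor `1/2`; it replaces Cauchy–Schwarz
and avoids square roots. -/
lemma ENNReal.mul_le_ofReal_mul_sq_add {a : ℝ} (ha : 0 < a) (x y : ℝ≥0∞) :
    x * y ≤ ENNReal.ofReal a * x ^ 2 + ENNReal.ofReal a⁻¹ * y ^ 2 := by
  rcases le_total y (ENNReal.ofReal a * x) with h | h
  · calc x * y ≤ x * (ENNReal.ofReal a * x) := by gcongr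
      _ = ENNReal.ofReal a * x ^ 2 := by ring
      _ ≤ _ := le_self_add
  · have h1 : x ≤ ENNReal.ofReal a⁻¹ * y := by
      calc x = ENNReal.ofReal a⁻¹ * (ENNReal.ofReal a * x) := by
            rw [← mul_assoc, ← ENNReal.ofReal_mul (by positivity), inv_mul_cancel₀ ha.ne',
              ENNReal.ofReal_one, one_mul]
        _ ≤ _ := by gcongr
    calc x * y ≤ ENNReal.ofReal a⁻¹ * y * y := by gcongr
      _ = ENNReal.ofReal a⁻¹ * y ^ 2 := by ring
      _ ≤ _ := le_add_self

variable [hT : Fact (0 < T)]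

/-- Radial integrals over the circle are at most those over the line. -/
lemma lintegral_addCircle_norm_le (φ : ℝ → ℝ≥0∞) :
    ∫⁻ z : AddCircle T, φ ‖z‖ ≤ 2 * ∫⁻ x in Ioi (0 : ℝ), φ x := by
  have hT0 := hT.out
  rw [← AddCircle.lintegral_preimage T (-(T / 2)) (fun z => φ ‖z‖), ← lintegral_comp_abs_le]
  refine le_trans (le_of_eq ?_) (setLIntegral_le_lintegral (Ioc (-(T / 2)) (-(T / 2) + T)) _)
  refine setLIntegral_congr_fun measurableSet_Ioc fun x hx => ?_
  rw [(AddCircle.norm_coe_eq_abs_iff T hT0.ne').2]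
  rw [abs_of_pos hT0, abs_le]
  exact ⟨hx.1.le, by linarith [hx.2]⟩

/-- On the line, `|x|^{-2/3}` over `|x| < R` integrates to `6 R^{1/3}`. -/
lemma lintegral_fracKernel_near {r : ℝ} (hr : 0 < r) :
    ∫⁻ z : AddCircle T, {z : AddCircle T | ‖z‖ < r ^ 3}.indicator fracKernel z ≤
      ENNReal.ofReal (6 * r) := by
  have h := lintegral_addCircle_norm_le (T := T)
    ((Iio (r ^ 3)).indicator fun x => ENNReal.ofReal (x ^ (-(2 / 3) : ℝ)))
  refine le_trans (le_of_eq ?_) (h.trans ?_)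
  · congr 1
  · have hr3 : 0 < r ^ 3 := by positivity
    rw [← lintegral_indicator measurableSet_Ioi, indicator_indicator, lintegral_indicator
      (measurableSet_Ioi.inter measurableSet_Iio), Ioi_inter_Iio,
      setLIntegral_congr Ioo_ae_eq_Ioc]
    have hi : IntervalIntegrable (fun x : ℝ => x ^ (-(2 / 3) : ℝ)) volume 0 (r ^ 3) :=
      intervalIntegral.intervalIntegrable_rpow' (by norm_num)
    rw [intervalIntegrable_iff_integrableOn_Ioc_of_le hr3.le] at hi
    rw [← ofReal_integral_eq_lintegral_ofReal hi
      ((ae_restrict_iff' measurableSet_Ioc).2 (ae_of_all _ fun x hx =>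
        Real.rpow_nonneg hx.1.le _)), ← intervalIntegral.integral_of_le hr3.le,
      integral_rpow (Or.inl (by norm_num)), ← ENNReal.ofReal_ofNat,
      ← ENNReal.ofReal_mul (by norm_num)]
    apply ENNReal.ofReal_le_ofReal
    have e : (r ^ 3) ^ (-(2 / 3) + 1 : ℝ) = r := by
      rw [← Real.rpow_natCast, ← Real.rpow_mul hr.le]; norm_num
    rw [e, Real.zero_rpow (by norm_num)]
    norm_num
    linarith

/-- On the line, `|x|^{-4/3}` over `|x| ≥ R` integrates to `6 R^{-1/3}`. -/
lemma lintegral_fracKernel_far {r : ℝ} (hr : 0 < r) :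
    ∫⁻ z : AddCircle T, {z : AddCircle T | r ^ 3 ≤ ‖z‖}.indicator (fun z => fracKernel z ^ 2) z ≤
      ENNReal.ofReal (6 / r) := by
  have h := lintegral_addCircle_norm_le (T := T)
    ((Ici (r ^ 3)).indicator fun x => ENNReal.ofReal (x ^ (-(2 / 3) : ℝ)) ^ 2)
  refine le_trans (le_of_eq ?_) (h.trans ?_)
  · congr 1
  · have hr3 : 0 < r ^ 3 := by positivity
    have hs : Ioi (0 : ℝ) ∩ Ici (r ^ 3) = Ici (r ^ 3) :=
      inter_eq_right.2 fun x hx => hr3.trans_le hx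
    rw [← lintegral_indicator measurableSet_Ioi, indicator_indicator, hs,
      lintegral_indicator measurableSet_Ici, setLIntegral_congr Ioi_ae_eq_Ici.symm]
    have e1 : ∫⁻ x in Ioi (r ^ 3), ENNReal.ofReal (x ^ (-(2 / 3) : ℝ)) ^ 2 =
        ∫⁻ x in Ioi (r ^ 3), ENNReal.ofReal (x ^ (-(4 / 3) : ℝ)) := by
      refine setLIntegral_congr_fun measurableSet_Ioi fun x hx => ?_
      have hx0 : 0 < x := hr3.trans hx
      rw [← ENNReal.ofReal_pow (by positivity), ← Real.rpow_natCast, ← Real.rpow_mul hx0.le]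
      norm_num
    rw [e1, ← ofReal_integral_eq_lintegral_ofReal (integrableOn_Ioi_rpow_of_lt (by norm_num) hr3)
      ((ae_restrict_iff' measurableSet_Ioi).2 (ae_of_all _ fun x hx =>
        Real.rpow_nonneg (hr3.trans hx).le _)), integral_Ioi_rpow_of_lt (by norm_num) hr3,
      ← ENNReal.ofReal_ofNat, ← ENNReal.ofReal_mul (by norm_num)]
    apply ENNReal.ofReal_le_ofReal
    have e : (r ^ 3) ^ (-(4 / 3) + 1 : ℝ) = r⁻¹ := by
      rw [← Real.rpow_natCast, ← Real.rpow_mul hr.le, ← Real.rpow_neg_one]; norm_num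
    rw [e, div_eq_mul_inv 6 r]
    norm_num
    linarith

/-- Split at `‖y - x‖ = t³`, the scale of the measure of `B`. The near part gives `6t`; on the far
part the kernel is at most `t⁻²`, giving `t⁻² t³ = t`. -/
lemma setLIntegral_fracKernel_le {B : Set (AddCircle T)} {t : ℝ} (ht : 0 < t)
    (hB : volume B ≤ ENNReal.ofReal (t ^ 3)) (x : AddCircle T) :
    ∫⁻ y in B, fracKernel (y - x) ≤ ENNReal.ofReal (7 * t) := by
  have hm : MeasurableSet {z : AddCircle T | ‖z‖ < t ^ 3} :=
    measurableSet_lt measurable_norm measurable_const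
  have hp : ∀ y : AddCircle T, fracKernel (y - x) ≤
      {z : AddCircle T | ‖z‖ < t ^ 3}.indicator fracKernel (y - x) +
        ENNReal.ofReal (t⁻¹ ^ 2) := by
    intro y
    by_cases h : ‖y - x‖ < t ^ 3
    · rw [indicator_of_mem (by exact h)]; exact le_self_add
    · exact (fracKernel_le_of_le ht (not_lt.1 h)).trans le_add_self
  calc _ ≤ ∫⁻ y in B, ({z : AddCircle T | ‖z‖ < t ^ 3}.indicator fracKernel (y - x) +
        ENNReal.ofReal (t⁻¹ ^ 2)) := lintegral_mono hp
    _ = (∫⁻ y in B, {z : AddCircle T | ‖z‖ < t ^ 3}.indicator fracKernel (y - x)) +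
        ENNReal.ofReal (t⁻¹ ^ 2) * volume B := by
      rw [lintegral_add_right _ measurable_const, lintegral_const, Measure.restrict_apply_univ]
    _ ≤ ENNReal.ofReal (6 * t) + ENNReal.ofReal (t⁻¹ ^ 2) * ENNReal.ofReal (t ^ 3) := by
      gcongr
      refine (setLIntegral_le_lintegral _ _).trans ?_
      rw [lintegral_sub_right_eq_self (fun z => {z : AddCircle T | ‖z‖ < t ^ 3}.indicator
        fracKernel z)]
      exact lintegral_fracKernel_near ht
    _ = _ := by
      rw [← ENNReal.ofReal_mul (by positivity), ← ENNReal.ofReal_add (by positivity)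
        (by positivity)]
      congr 1
      field_simp
      norm_num

section Levels

variable {f : AddCircle T → ℝ≥0∞} {e σ : ℝ}

/-- The part of `f` below height `σ³/e` has fractional integral `O(σ)` at every point. With the
kernel cut at `r³`, `r = e/σ²`, the near part gives `(σ³/e) · 6r = 6σ`. The far part, by the
weighted inequality with weight `e/σ`, gives `(e/σ) · 6/r + (σ/e) e = 7σ`. -/
lemma lintegral_fracKernel_low_le (hf : Measurable f) (he : 0 < e) (hσ : 0 < σ)
    (hE : ∫⁻ x, f x ^ 2 ≤ ENNReal.ofReal e) (y : AddCircle T) :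
    ∫⁻ x, fracKernel (y - x) * {x | f x ≤ ENNReal.ofReal (σ ^ 3 / e)}.indicator f x ≤
      ENNReal.ofReal (13 * σ) := by
  set r : ℝ := e / σ ^ 2 with hr
  have hr0 : 0 < r := by positivity
  set γ : ℝ := σ ^ 3 / e with hγ
  have hγ0 : 0 < γ := by positivity
  set N : AddCircle T → ℝ≥0∞ := {z : AddCircle T | ‖z‖ < r ^ 3}.indicator fracKernel with hN
  set F : AddCircle T → ℝ≥0∞ :=
    {z : AddCircle T | r ^ 3 ≤ ‖z‖}.indicator (fun z => fracKernel z ^ 2) with hF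
  have hNm : Measurable N :=
    measurable_fracKernel.indicator (measurableSet_lt measurable_norm measurable_const)
  have hFm : Measurable F :=
    (measurable_fracKernel.pow_const 2).indicator (measurableSet_le measurable_const measurable_norm)
  have hp : ∀ x, fracKernel (y - x) * {x | f x ≤ ENNReal.ofReal γ}.indicator f x ≤
      ENNReal.ofReal γ * N (y - x) + (ENNReal.ofReal (e / σ) * F (y - x) +
        ENNReal.ofReal (e / σ)⁻¹ * f x ^ 2) := by
    intro x
    by_cases h : ‖y - x‖ < r ^ 3
    · refine le_trans ?_ le_self_add
      rw [hN, indicator_of_mem (s := {z : AddCircle T | ‖z‖ < r ^ 3}) h, mul_comm]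
      refine mul_le_mul_left ?_ _
      by_cases h2 : x ∈ {x | f x ≤ ENNReal.ofReal γ}
      · rw [indicator_of_mem h2]; exact h2
      · rw [indicator_of_notMem h2]; exact zero_le
    · refine le_trans ?_ le_add_self
      rw [hF, indicator_of_mem (s := {z : AddCircle T | r ^ 3 ≤ ‖z‖}) (not_lt.1 h)]
      refine le_trans ?_ (ENNReal.mul_le_ofReal_mul_sq_add (div_pos he hσ) _ _)
      gcongr
      exact indicator_le_self _ _ _
  refine (lintegral_mono hp).trans ?_
  have m1 : Measurable fun x => N (y - x) := hNm.comp (measurable_const.sub measurable_id)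
  have m2 : Measurable fun x => F (y - x) := hFm.comp (measurable_const.sub measurable_id)
  rw [lintegral_add_left (m1.const_mul _), lintegral_add_left (m2.const_mul _),
    lintegral_const_mul _ m1, lintegral_const_mul _ m2, lintegral_const_mul _ (hf.pow_const 2), lintegral_sub_left_eq_self N y,
    lintegral_sub_left_eq_self F y]
  calc _ ≤ ENNReal.ofReal γ * ENNReal.ofReal (6 * r) + (ENNReal.ofReal (e / σ) *
        ENNReal.ofReal (6 / r) + ENNReal.ofReal (e / σ)⁻¹ * ENNReal.ofReal e) := by
        gcongr
        · exact lintegral_fracKernel_near hr0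
        · exact lintegral_fracKernel_far hr0
    _ = _ := by
        rw [← ENNReal.ofReal_mul hγ0.le, ← ENNReal.ofReal_mul (by positivity),
          ← ENNReal.ofReal_mul (by positivity), ← ENNReal.ofReal_add (by positivity)
          (by positivity), ← ENNReal.ofReal_add (by positivity) (by positivity)]
        congr 1
        rw [hγ, hr]
        field_simp
        norm_num

lemma measurable_fracIntegral (hf : Measurable f) :
    Measurable fun y => ∫⁻ x, fracKernel (y - x) * f x :=
  Measurable.lintegral_prod_right' (f := fun p : AddCircle T × AddCircle T =>
    fracKernel (p.1 - p.2) * f p.2)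
    ((measurable_fracKernel.comp (measurable_fst.sub measurable_snd)).mul (hf.comp measurable_snd))

lemma setLIntegral_fracIntegral_le (hf : Measurable f) {B : Set (AddCircle T)} {t : ℝ} (ht : 0 < t)
    (hB : volume B ≤ ENNReal.ofReal (t ^ 3)) :
    ∫⁻ y in B, ∫⁻ x, fracKernel (y - x) * f x ≤ ENNReal.ofReal (7 * t) * ∫⁻ x, f x := by
  rw [lintegral_lintegral_swap]
  · rw [← lintegral_const_mul _ hf]
    refine lintegral_mono fun x => ?_
    have hm : Measurable fun y => fracKernel (y - x) :=
      measurable_fracKernel.comp (measurable_id.sub measurable_const)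
    rw [lintegral_mul_const _ hm]
    gcongr
    exact setLIntegral_fracKernel_le ht hB x
  · exact ((measurable_fracKernel.comp (measurable_fst.sub measurable_snd)).mul
      (hf.comp measurable_snd)).aemeasurable

/-- At height `26σ` the low part of `f` accounts for at most `13σ`, so the high part must supply the
rest. Keeping the integral of the high part on the right, instead of bounding it by a power of `σ`,
is what makes the estimate summable over levels to a strong-type bound. -/
lemma volume_fracIntegral_superlevel_le (hf : Measurable f) (he : 0 < e) (hσ : 0 < σ)
    (hE : ∫⁻ x, f x ^ 2 ≤ ENNReal.ofReal e) :
    volume {y | ENNReal.ofReal (26 * σ) < ∫⁻ x, fracKernel (y - x) * f x} ≤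
      ENNReal.ofReal (e / σ ^ 3) *
        ∫⁻ x, {x | ENNReal.ofReal (σ ^ 3 / e) < f x}.indicator f x := by
  set γ : ℝ := σ ^ 3 / e with hγ
  have hγ0 : 0 < γ := by positivity
  set B := {y | ENNReal.ofReal (26 * σ) < ∫⁻ x, fracKernel (y - x) * f x} with hB
  set f₂ := {x | ENNReal.ofReal γ < f x}.indicator f with hf₂
  set f₁ := {x | f x ≤ ENNReal.ofReal γ}.indicator f with hf₁
  have hf₂m : Measurable f₂ := hf.indicator (measurableSet_lt measurable_const hf)
  have hf₁m : Measurable f₁ := hf.indicator (measurableSet_le hf measurable_const)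
  have hsum : ∀ x, f x = f₁ x + f₂ x := fun x => by
    simp only [hf₁, hf₂]
    by_cases h : f x ≤ ENNReal.ofReal γ
    · rw [indicator_of_mem (by exact h), indicator_of_notMem (by exact not_lt.2 h), add_zero]
    · rw [indicator_of_notMem (by exact h), indicator_of_mem (by exact not_le.1 h), zero_add]
  -- The circle has finite measure; this permits `13σ |B|` to be subtracted below.
  have hBfin : volume B ≠ ⊤ := measure_ne_top _ _
  have hγf : ENNReal.ofReal γ * ∫⁻ x, f₂ x ≤ ENNReal.ofReal e := by
    rw [← lintegral_const_mul _ hf₂m]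
    refine (lintegral_mono fun x => ?_).trans hE
    simp only [hf₂]
    by_cases h : ENNReal.ofReal γ < f x
    · rw [indicator_of_mem (by exact h), sq]; gcongr
    · rw [indicator_of_notMem (by exact h), mul_zero]; exact zero_le
  have hGfin : ∫⁻ x, f₂ x ≠ ⊤ := by
    intro h
    rw [h, ENNReal.mul_top (by simpa using hγ0)] at hγf
    exact ENNReal.ofReal_ne_top (top_le_iff.1 hγf)
  set g := (∫⁻ x, f₂ x).toReal with hg
  have hgE : ∫⁻ x, f₂ x = ENNReal.ofReal g := (ENNReal.ofReal_toReal hGfin).symm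
  have hg0 : 0 ≤ g := ENNReal.toReal_nonneg
  rw [hgE, ← ENNReal.ofReal_mul hγ0.le, ENNReal.ofReal_le_ofReal_iff he.le] at hγf
  set m := (volume B).toReal with hm
  have hmE : volume B = ENNReal.ofReal m := (ENNReal.ofReal_toReal hBfin).symm
  have hm0 : 0 ≤ m := ENNReal.toReal_nonneg
  rw [hgE, hmE, ← ENNReal.ofReal_mul (by positivity)]
  apply ENNReal.ofReal_le_ofReal
  rcases hm0.eq_or_lt with h0 | h0
  · rw [← h0]; positivity
  -- With `t³ = |B|`, integrating the fractional integral over `B` gives `13σ t³ ≤ 7t g`, hence `t²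
  -- σ ≤ g`.
  set t := m ^ (1 / 3 : ℝ) with ht
  have ht0 : 0 < t := by positivity
  have ht3 : t ^ 3 = m := by
    rw [ht, ← Real.rpow_natCast, ← Real.rpow_mul hm0]; norm_num
  have hlow : ENNReal.ofReal (26 * σ) * volume B ≤
      ENNReal.ofReal (13 * σ) * volume B + ENNReal.ofReal (7 * t) * ∫⁻ x, f₂ x := by
    calc _ ≤ ∫⁻ y in B, ∫⁻ x, fracKernel (y - x) * f x := by
          rw [← setLIntegral_const]
          exact setLIntegral_mono (measurable_fracIntegral hf) fun y hy => hy.le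
      _ = ∫⁻ y in B, ((∫⁻ x, fracKernel (y - x) * f₁ x) + ∫⁻ x, fracKernel (y - x) * f₂ x) := by
          congr 1
          funext y
          have hk : Measurable fun x => fracKernel (y - x) * f₁ x :=
            (measurable_fracKernel.comp (measurable_const.sub measurable_id)).mul hf₁m
          rw [← lintegral_add_left hk]
          congr 1
          funext x
          rw [hsum x, mul_add]
      _ = (∫⁻ y in B, ∫⁻ x, fracKernel (y - x) * f₁ x) +
            ∫⁻ y in B, ∫⁻ x, fracKernel (y - x) * f₂ x :=
          lintegral_add_left (measurable_fracIntegral hf₁m) _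
      _ ≤ _ := by
          gcongr
          · rw [← setLIntegral_const]
            exact lintegral_mono fun y => lintegral_fracKernel_low_le hf he hσ hE y
          · exact setLIntegral_fracIntegral_le hf₂m ht0 (by rw [ht3, hmE])
  rw [hmE, hgE, ← ENNReal.ofReal_mul (by positivity), ← ENNReal.ofReal_mul (by positivity),
    ← ENNReal.ofReal_mul (by positivity), ← ENNReal.ofReal_add (by positivity) (by positivity),
    ENNReal.ofReal_le_ofReal_iff (by positivity), ← ht3] at hlow
  have h1 : t ^ 2 * σ ≤ g := by
    have : t * (13 * σ * t ^ 2) ≤ t * (7 * g) := by nlinarith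
    have := le_of_mul_le_mul_left this ht0
    nlinarith
  have h2 : g * σ ^ 3 ≤ e ^ 2 := by
    rw [hγ, div_mul_eq_mul_div, div_le_iff₀ he] at hγf
    nlinarith
  rw [← ht3, div_mul_eq_mul_div, le_div_iff₀ (by positivity)]
  -- Squaring avoids fractional powers: the cube of `t² σ ≤ g` is combined with one use of the
  -- Chebyshev bound `g σ³ ≤ e²`.
  refine le_of_sq_le_sq ?_ (by positivity)
  calc (t ^ 3 * σ ^ 3) ^ 2 = (t ^ 2 * σ) ^ 3 * σ ^ 3 := by ring
    _ ≤ g ^ 3 * σ ^ 3 := by gcongr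
    _ = g ^ 2 * (g * σ ^ 3) := by ring
    _ ≤ g ^ 2 * e ^ 2 := by gcongr
    _ = _ := by ring

end Levels

/-- The condition `σ³/e < F` confines `σ` to `(0, d)` with `d³ = eF`, where `σ² ≤ d²`; the integral
is therefore at most `d³ F = e F²`. -/
lemma setLIntegral_sq_superlevel_le {e : ℝ} (he : 0 < e) (F : ℝ≥0∞) :
    ∫⁻ σ in Ioi (0 : ℝ), ENNReal.ofReal (σ ^ 2) *
      (if ENNReal.ofReal (σ ^ 3 / e) < F then F else 0) ≤ ENNReal.ofReal e * F ^ 2 := by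
  by_cases hF : F = ⊤
  · rw [hF, ENNReal.top_pow two_ne_zero, ENNReal.mul_top (by simpa using he)]
    exact le_top
  set c := F.toReal with hc
  have hFc : F = ENNReal.ofReal c := (ENNReal.ofReal_toReal hF).symm
  have hc0 : 0 ≤ c := ENNReal.toReal_nonneg
  rcases hc0.eq_or_lt with h0 | h0
  · simp [hFc, ← h0]
  set d := (e * c) ^ (1 / 3 : ℝ) with hd
  have hd0 : 0 < d := by positivity
  have hd3 : d ^ 3 = e * c := by
    rw [hd, ← Real.rpow_natCast, ← Real.rpow_mul (by positivity)]; norm_num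
  have hp : ∀ σ ∈ Ioi (0 : ℝ), ENNReal.ofReal (σ ^ 2) *
      (if ENNReal.ofReal (σ ^ 3 / e) < F then F else 0) ≤
      (Ioc 0 d).indicator (fun _ => ENNReal.ofReal (d ^ 2) * F) σ := by
    intro σ hσ
    have hσ0 : 0 < σ := hσ
    split_ifs with h
    · rw [hFc, ENNReal.ofReal_lt_ofReal_iff h0, div_lt_iff₀ he] at h
      have h1 : σ ≤ d := by
        refine le_of_lt (lt_of_pow_lt_pow_left₀ 3 hd0.le ?_)
        rw [hd3]; linarith
      rw [indicator_of_mem (by exact ⟨hσ0, h1⟩)]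
      gcongr
    · rw [mul_zero]; exact zero_le
  calc _ ≤ ∫⁻ σ in Ioi (0 : ℝ), (Ioc 0 d).indicator (fun _ => ENNReal.ofReal (d ^ 2) * F) σ :=
        setLIntegral_mono' measurableSet_Ioi hp
    _ ≤ ∫⁻ σ : ℝ, (Ioc 0 d).indicator (fun _ => ENNReal.ofReal (d ^ 2) * F) σ :=
        setLIntegral_le_lintegral _ _
    _ = ENNReal.ofReal (d ^ 2) * F * ENNReal.ofReal d := by
        rw [lintegral_indicator measurableSet_Ioc, setLIntegral_const, Real.volume_Ioc, sub_zero]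
    _ = ENNReal.ofReal (d ^ 3) * F := by
        rw [mul_right_comm, ← ENNReal.ofReal_mul (by positivity)]; congr 2
    _ = _ := by rw [hd3, ENNReal.ofReal_mul he.le, ← hFc, mul_assoc, sq]

/-- The Hardy–Littlewood–Sobolev inequality on the circle, from `L²` to `L⁶`. -/
theorem lintegral_fracIntegral_pow_six_le {f : AddCircle T → ℝ≥0∞} (hf : Measurable f) :
    ∫⁻ y, (∫⁻ x, fracKernel (y - x) * f x) ^ 6 ≤
      ENNReal.ofReal (6 * 26 ^ 6) * (∫⁻ x, f x ^ 2) ^ 3 := by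
  by_cases hE : ∫⁻ x, f x ^ 2 = ⊤
  · rw [hE, ENNReal.top_pow three_ne_zero, ENNReal.mul_top (by norm_num)]
    exact le_top
  set e := (∫⁻ x, f x ^ 2).toReal with he
  have hEe : ∫⁻ x, f x ^ 2 = ENNReal.ofReal e := (ENNReal.ofReal_toReal hE).symm
  have he0 : 0 ≤ e := ENNReal.toReal_nonneg
  rcases he0.eq_or_lt with h0 | h0
  · rw [← h0, ENNReal.ofReal_zero, lintegral_eq_zero_iff (hf.pow_const 2)] at hEe
    have hf0 : f =ᵐ[volume] 0 := by
      filter_upwards [hEe] with x hx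
      simpa using hx
    have : ∀ y, ∫⁻ x, fracKernel (y - x) * f x = 0 := fun y => by
      rw [lintegral_congr_ae (g := fun _ => 0), lintegral_zero]
      filter_upwards [hf0] with x hx
      rw [hx]; simp
    simp [this]
  set u : AddCircle T → ℝ≥0∞ := fun y => ∫⁻ x, fracKernel (y - x) * f x with hu
  have hum : Measurable u := measurable_fracIntegral hf
  -- On a space of finite measure `L²` lies in `L¹`, so the fractional integral is finite almost
  -- everywhere and its values may be treated as real.
  have hf1 : ∫⁻ x, f x ≠ ⊤ := by
    have : ∫⁻ x, f x ≤ ∫⁻ x : AddCircle T, (1 + f x ^ 2) := by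
      refine lintegral_mono fun x => ?_
      rcases le_total (f x) 1 with h | h
      · exact h.trans le_self_add
      · calc f x = f x * 1 := (mul_one _).symm
          _ ≤ f x * f x := by gcongr
          _ = f x ^ 2 := (sq _).symm
          _ ≤ _ := le_add_self
    rw [lintegral_add_left measurable_const, lintegral_const, one_mul] at this
    exact ne_top_of_le_ne_top (ENNReal.add_ne_top.2 ⟨measure_ne_top _ _, hE⟩) this
  have hufin : ∀ᵐ y, u y < ⊤ := by
    refine ae_lt_top hum ?_
    have hT0 := hT.out
    have hT3 : (T ^ (1 / 3 : ℝ)) ^ 3 = T := by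
      rw [← Real.rpow_natCast, ← Real.rpow_mul hT0.le]; norm_num
    have := setLIntegral_fracIntegral_le hf (B := univ) (t := T ^ (1 / 3 : ℝ)) (by positivity)
      (by rw [hT3, AddCircle.measure_univ])
    rw [setLIntegral_univ] at this
    exact ne_top_of_le_ne_top (ENNReal.mul_ne_top ENNReal.ofReal_ne_top hf1) this
  -- Dividing by 26 matches the levels `{v > σ}` with the superlevel estimate.
  set v : AddCircle T → ℝ := fun y => (u y).toReal / 26 with hv
  have hvm : Measurable v := hum.ennreal_toReal.div_const _
  have h1 : ∫⁻ y, u y ^ 6 = ENNReal.ofReal (26 ^ 6) * ∫⁻ y, ENNReal.ofReal (v y ^ (6 : ℝ)) := by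
    rw [← lintegral_const_mul' _ _ ENNReal.ofReal_ne_top]
    refine lintegral_congr_ae ?_
    filter_upwards [hufin] with y hy
    have : u y = ENNReal.ofReal (26 * v y) := by
      rw [hv]; simp only
      rw [mul_div_cancel₀ _ (by norm_num), ENNReal.ofReal_toReal hy.ne]
    have hv0 : 0 ≤ v y := div_nonneg ENNReal.toReal_nonneg (by norm_num)
    rw [this, ← ENNReal.ofReal_pow (by positivity), mul_pow, ENNReal.ofReal_mul (by positivity),
      ← Real.rpow_natCast (v y) 6]
    norm_cast
  have h2 := lintegral_rpow_eq_lintegral_meas_lt_mul volume (f := v) (p := 6)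
    (ae_of_all _ fun y => div_nonneg ENNReal.toReal_nonneg (by norm_num)) hvm.aemeasurable
    (by norm_num)
  -- The layer-cake weight `σ⁵` against `e/σ³` leaves `e σ²`. Exchanging the integrals then makes
  -- the `σ`-integral at most `e f²`, for a total of `6 e³`.
  have h3 : ∀ σ ∈ Ioi (0 : ℝ), volume {a | σ < v a} * ENNReal.ofReal (σ ^ (6 - 1 : ℝ)) ≤
      ∫⁻ x, ENNReal.ofReal e * (ENNReal.ofReal (σ ^ 2) *
        (if ENNReal.ofReal (σ ^ 3 / e) < f x then f x else 0)) := by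
    intro σ hσ
    have hσ0 : 0 < σ := hσ
    have hsub : {a | σ < v a} ⊆ {y | ENNReal.ofReal (26 * σ) < u y} := by
      intro a ha
      simp only [hv, mem_ofPred_eq] at ha ⊢
      rw [lt_div_iff₀ (by norm_num)] at ha
      by_cases hua : u a = ⊤
      · rw [hua]; exact ENNReal.ofReal_lt_top
      · rw [ENNReal.ofReal_lt_iff_lt_toReal (by positivity) hua]; linarith
    have hle := (measure_mono hsub).trans (volume_fracIntegral_superlevel_le hf h0 hσ0 hEe.le)
    have e5 : (σ ^ (6 - 1 : ℝ)) = σ ^ 5 := by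
      rw [← Real.rpow_natCast]; norm_num
    have e6 : ENNReal.ofReal (e / σ ^ 3) * ENNReal.ofReal (σ ^ 5) =
        ENNReal.ofReal e * ENNReal.ofReal (σ ^ 2) := by
      rw [← ENNReal.ofReal_mul (by positivity), ← ENNReal.ofReal_mul (by positivity)]
      congr 1
      field_simp
    have m1 : Measurable ({x | ENNReal.ofReal (σ ^ 3 / e) < f x}.indicator f) :=
      hf.indicator (measurableSet_lt measurable_const hf)
    calc _ ≤ ENNReal.ofReal (e / σ ^ 3) *
          (∫⁻ x, {x | ENNReal.ofReal (σ ^ 3 / e) < f x}.indicator f x) *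
            ENNReal.ofReal (σ ^ 5) := by rw [e5]; gcongr
      _ = ENNReal.ofReal e * ENNReal.ofReal (σ ^ 2) *
          ∫⁻ x, {x | ENNReal.ofReal (σ ^ 3 / e) < f x}.indicator f x := by
          rw [mul_right_comm, e6]
      _ = _ := by
          rw [← lintegral_const_mul _ m1]
          congr 1
          funext x
          rw [mul_assoc, indicator_apply]
          rfl
  have hswap : ∫⁻ σ in Ioi (0 : ℝ), ∫⁻ x, ENNReal.ofReal e * (ENNReal.ofReal (σ ^ 2) *
        (if ENNReal.ofReal (σ ^ 3 / e) < f x then f x else 0)) =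
      ∫⁻ x, ∫⁻ σ in Ioi (0 : ℝ), ENNReal.ofReal e * (ENNReal.ofReal (σ ^ 2) *
        (if ENNReal.ofReal (σ ^ 3 / e) < f x then f x else 0)) := by
    refine lintegral_lintegral_swap (Measurable.aemeasurable ?_)
    have c1 : Measurable fun p : ℝ × AddCircle T => ENNReal.ofReal (p.1 ^ 3 / e) :=
      ENNReal.measurable_ofReal.comp (by fun_prop)
    have c2 : Measurable fun p : ℝ × AddCircle T => ENNReal.ofReal (p.1 ^ 2) :=
      ENNReal.measurable_ofReal.comp (by fun_prop)
    have c3 : Measurable fun p : ℝ × AddCircle T => f p.2 := hf.comp measurable_snd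
    exact (c2.mul (Measurable.ite (measurableSet_lt c1 c3) c3 measurable_const)).const_mul _
  calc ∫⁻ y, u y ^ 6 = ENNReal.ofReal (26 ^ 6) * (ENNReal.ofReal 6 *
        ∫⁻ σ in Ioi (0 : ℝ), volume {a | σ < v a} * ENNReal.ofReal (σ ^ (6 - 1 : ℝ))) := by
        rw [h1, h2]
    _ ≤ ENNReal.ofReal (26 ^ 6) * (ENNReal.ofReal 6 *
        ∫⁻ x, ENNReal.ofReal e * (ENNReal.ofReal e * f x ^ 2)) := by
        gcongr
        refine (setLIntegral_mono' measurableSet_Ioi h3).trans (hswap.le.trans ?_)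
        refine lintegral_mono fun x => ?_
        rw [lintegral_const_mul' _ _ ENNReal.ofReal_ne_top]
        gcongr
        exact setLIntegral_sq_superlevel_le h0 (f x)
    _ = _ := by
        rw [lintegral_const_mul' _ _ ENNReal.ofReal_ne_top,
          lintegral_const_mul' _ _ ENNReal.ofReal_ne_top, hEe, mul_comm (6 : ℝ),
          ENNReal.ofReal_mul (by norm_num)]
        ring

end HLS

/-! ### Cauchy–Schwarz, Jensen and Minkowski for lower integrals -/

lemma lintegral_mul_sq_le {X : Type*} [MeasurableSpace X] {μ : Measure X} {F G : X → ℝ≥0∞}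
    (hF : AEMeasurable F μ) (hG : AEMeasurable G μ) :
    (∫⁻ x, F x * G x ∂μ) ^ 2 ≤ (∫⁻ x, F x ^ 2 ∂μ) * ∫⁻ x, G x ^ 2 ∂μ := by
  have h := ENNReal.lintegral_mul_le_Lp_mul_Lq μ Real.HolderConjugate.two_two hF hG
  simp only [Pi.mul_apply, ENNReal.rpow_two] at h
  have e : ∀ z : ℝ≥0∞, (z ^ (1 / 2 : ℝ)) ^ 2 = z := fun z => by
    rw [← ENNReal.rpow_natCast, ← ENNReal.rpow_mul]; norm_num
  calc _ ≤ ((∫⁻ x, F x ^ 2 ∂μ) ^ (1 / 2 : ℝ) * (∫⁻ x, G x ^ 2 ∂μ) ^ (1 / 2 : ℝ)) ^ 2 := by gcongr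
    _ = _ := by rw [mul_pow, e, e]

/-- Jensen's inequality for the sixth power, with a weight. -/
lemma lintegral_mul_pow_six_le {X : Type*} [MeasurableSpace X] {μ : Measure X} {a w : X → ℝ≥0∞}
    (ha : AEMeasurable a μ) (hw : AEMeasurable w μ) :
    (∫⁻ x, a x * w x ∂μ) ^ 6 ≤ (∫⁻ x, w x ∂μ) ^ 5 * ∫⁻ x, a x ^ 6 * w x ∂μ := by
  have hpq : Real.HolderConjugate (6 : ℝ) (6 / 5) := by
    rw [Real.holderConjugate_iff]; norm_num
  -- Hölder with exponents `6` and `6/5`, the weight being split as `w^{1/6} w^{5/6}`.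
  have h := ENNReal.lintegral_mul_le_Lp_mul_Lq μ hpq (f := fun x => a x * w x ^ (1 / 6 : ℝ))
    (g := fun x => w x ^ (5 / 6 : ℝ)) (ha.mul (hw.pow_const _)) (hw.pow_const _)
  have e1 : ∀ x, a x * w x ^ (1 / 6 : ℝ) * w x ^ (5 / 6 : ℝ) = a x * w x := fun x => by
    rw [mul_assoc, ← ENNReal.rpow_add_of_nonneg _ _ (by norm_num) (by norm_num)]; norm_num
  have e2 : ∀ x, (a x * w x ^ (1 / 6 : ℝ)) ^ (6 : ℝ) = a x ^ 6 * w x := fun x => by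
    rw [ENNReal.mul_rpow_of_nonneg _ _ (by norm_num), ← ENNReal.rpow_mul]
    norm_num
  have e3 : ∀ x, (w x ^ (5 / 6 : ℝ)) ^ (6 / 5 : ℝ) = w x := fun x => by
    rw [← ENNReal.rpow_mul]; norm_num
  simp only [Pi.mul_apply, e1, e2, e3] at h
  calc _ ≤ ((∫⁻ x, a x ^ 6 * w x ∂μ) ^ (1 / 6 : ℝ) * (∫⁻ x, w x ∂μ) ^ (1 / (6 / 5) : ℝ)) ^ 6 := by
        gcongr
    _ = _ := by
        rw [mul_pow, ← ENNReal.rpow_natCast, ← ENNReal.rpow_natCast, ← ENNReal.rpow_mul,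
          ← ENNReal.rpow_mul, mul_comm, ← ENNReal.rpow_natCast _ 5]
        norm_num

/-- Minkowski's integral inequality in `L⁶`, against a majorant `κ` of the norms of the slices. -/
lemma lintegral_lintegral_mul_pow_six_le {X Y : Type*} [MeasurableSpace X] [MeasurableSpace Y]
    {μ : Measure X} {ν : Measure Y} [SFinite μ] [SFinite ν] {k : X → Y → ℝ≥0∞} {κ G : X → ℝ≥0∞}
    (hk : Measurable (Function.uncurry k)) (hκ : Measurable κ) (hG : Measurable G) {L : ℝ≥0∞}
    (hκtop : ∀ᵐ x ∂μ, κ x ≠ ⊤) (hκ0 : ∀ᵐ x ∂μ, κ x = 0 → ∀ y, k x y = 0)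
    (hL : ∀ᵐ x ∂μ, ∫⁻ y, k x y ^ 6 ∂ν ≤ L * κ x ^ 6) :
    ∫⁻ y, (∫⁻ x, k x y * G x ∂μ) ^ 6 ∂ν ≤ L * (∫⁻ x, κ x * G x ∂μ) ^ 6 := by
  have hslice : ∀ y, Measurable fun x => k x y := fun y => hk.comp (measurable_id.prodMk
    measurable_const)
  -- The normalized kernel `k/κ` is averaged against the weight `κ G`. Jensen takes the sixth power
  -- inside, after which each slice contributes at most `L`. The assumptions on `κ = 0` and `κ = ∞`
  -- justify the division.
  have h1 : ∀ y, (∫⁻ x, k x y * G x ∂μ) ^ 6 ≤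
      (∫⁻ x, κ x * G x ∂μ) ^ 5 * ∫⁻ x, (k x y / κ x) ^ 6 * (κ x * G x) ∂μ := by
    intro y
    refine le_trans (le_of_eq ?_) (lintegral_mul_pow_six_le (μ := μ)
      (a := fun x => k x y / κ x) (w := fun x => κ x * G x) ((hslice y).div hκ).aemeasurable
      (hκ.mul hG).aemeasurable)
    congr 1
    refine lintegral_congr_ae ?_
    filter_upwards [hκtop, hκ0] with x hx hx0
    by_cases h : κ x = 0
    · rw [hx0 h y]; simp
    · rw [← mul_assoc, ENNReal.div_mul_cancel h hx]
  have hm : Measurable fun p : X × Y => (k p.1 p.2 / κ p.1) ^ 6 * (κ p.1 * G p.1) :=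
    ((hk.div (hκ.comp measurable_fst)).pow_const 6).mul ((hκ.mul hG).comp measurable_fst)
  have hm' : Measurable (Function.uncurry fun (y : Y) (x : X) =>
      (k x y / κ x) ^ 6 * (κ x * G x)) := hm.comp measurable_swap
  have h2 : ∫⁻ y, ∫⁻ x, (k x y / κ x) ^ 6 * (κ x * G x) ∂μ ∂ν ≤ L * ∫⁻ x, κ x * G x ∂μ := by
    rw [lintegral_lintegral_swap hm'.aemeasurable,
      ← lintegral_const_mul L (show Measurable fun x => κ x * G x from hκ.mul hG)]
    refine lintegral_mono_ae ?_
    filter_upwards [hκtop, hκ0, hL] with x hx hx0 hxL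
    have hky : Measurable fun y => k x y := hk.comp (measurable_const.prodMk measurable_id)
    rw [lintegral_mul_const _ ((hky.div_const _).pow_const 6)]
    by_cases h : κ x = 0
    · simp [h]
    simp_rw [ENNReal.div_eq_inv_mul, mul_pow]
    rw [lintegral_const_mul _ (hky.pow_const 6)]
    have : (κ x)⁻¹ ^ 6 * ∫⁻ y, k x y ^ 6 ∂ν ≤ L := by
      calc _ ≤ (κ x)⁻¹ ^ 6 * (L * κ x ^ 6) := by gcongr
        _ = L * ((κ x)⁻¹ * κ x) ^ 6 := by ring
        _ = L := by rw [ENNReal.inv_mul_cancel h hx, one_pow, mul_one]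
    gcongr
  calc _ ≤ ∫⁻ y, (∫⁻ x, κ x * G x ∂μ) ^ 5 * ∫⁻ x, (k x y / κ x) ^ 6 * (κ x * G x) ∂μ ∂ν :=
        lintegral_mono h1
    _ = (∫⁻ x, κ x * G x ∂μ) ^ 5 * ∫⁻ y, ∫⁻ x, (k x y / κ x) ^ 6 * (κ x * G x) ∂μ ∂ν :=
        lintegral_const_mul _ hm'.lintegral_prod_right'
    _ ≤ (∫⁻ x, κ x * G x ∂μ) ^ 5 * (L * ∫⁻ x, κ x * G x ∂μ) := by gcongr
    _ = _ := by ring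

/-! ### Radial integrals and the kernel majorant -/

/-- The radial measure `r dr` on `(0, ∞)`. -/
def radialMeasure : Measure ℝ :=
  (volume.restrict (Ioi (0 : ℝ))).withDensity fun r => ENNReal.ofReal r

instance : SFinite radialMeasure := by unfold radialMeasure; infer_instance

lemma lintegral_radialMeasure {F : ℝ → ℝ≥0∞} (hF : Measurable F) :
    ∫⁻ r, F r ∂radialMeasure = ∫⁻ r in Ioi (0 : ℝ), ENNReal.ofReal r * F r :=
  lintegral_withDensity_eq_lintegral_mul _ ENNReal.measurable_ofReal hF

lemma ae_radialMeasure_pos : ∀ᵐ r ∂radialMeasure, 0 < r :=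
  (withDensity_absolutelyContinuous _ _).ae_le (ae_restrict_mem measurableSet_Ioi)

lemma coneMeasure_eq (ρ : ℝ) [Fact (0 < ρ)] :
    coneMeasure ρ = radialMeasure.prod (volume : Measure (AddCircle (2 * π * ρ))) := rfl

/-- The sixth power of the kernel majorant, integrated in the outer radius. -/
lemma lintegral_min_pow_six_le {A q d : ℝ} (hA : 0 < A) (hq : 0 < q) (hd : 0 < d) :
    ∫⁻ r, ENNReal.ofReal (min A ((√(q * r))⁻¹ * d⁻¹)) ^ 6 ∂radialMeasure ≤
      ENNReal.ofReal (2 * A ^ 2 / (q ^ 2 * d ^ 4)) := by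
  have hm : Measurable fun r => ENNReal.ofReal (min A ((√(q * r))⁻¹ * d⁻¹)) ^ 6 := by
    refine (ENNReal.measurable_ofReal.comp (measurable_const.min ?_)).pow_const 6
    exact (Continuous.measurable (by fun_prop : Continuous fun r => √(q * r))).inv.mul_const _
  rw [lintegral_radialMeasure hm]
  -- `R` is the radius at which the two entries of the minimum agree. Both ranges, `r ≤ R` and `r >
  -- R`, then contribute at most `A²/(q² d⁴)`.
  set R : ℝ := (q * A ^ 2 * d ^ 2)⁻¹ with hR
  have hR0 : 0 < R := by positivity
  have hmin0 : ∀ r, 0 ≤ min A ((√(q * r))⁻¹ * d⁻¹) := fun r => le_min hA.le (by positivity)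
  have h1 : ∫⁻ r in Ioc 0 R, ENNReal.ofReal r *
      ENNReal.ofReal (min A ((√(q * r))⁻¹ * d⁻¹)) ^ 6 ≤ ENNReal.ofReal (R * A ^ 6 * R) := by
    calc _ ≤ ∫⁻ _ in Ioc 0 R, ENNReal.ofReal (R * A ^ 6) := by
          refine setLIntegral_mono' measurableSet_Ioc fun r hr => ?_
          rw [← ENNReal.ofReal_pow (hmin0 r), ← ENNReal.ofReal_mul hr.1.le]
          apply ENNReal.ofReal_le_ofReal
          have := hmin0 r
          gcongr
          · exact hr.2
          · exact min_le_left _ _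
      _ = _ := by
          rw [setLIntegral_const, Real.volume_Ioc, sub_zero, ← ENNReal.ofReal_mul (by positivity)]
  have h2 : ∫⁻ r in Ioi R, ENNReal.ofReal r *
      ENNReal.ofReal (min A ((√(q * r))⁻¹ * d⁻¹)) ^ 6 ≤
      ENNReal.ofReal ((q ^ 3 * d ^ 6)⁻¹ * R⁻¹) := by
    have hpow := (integrableOn_Ioi_rpow_of_lt (by norm_num : (-2 : ℝ) < -1) hR0).const_mul
      (q ^ 3 * d ^ 6)⁻¹
    have hval : ∫ r in Ioi R, (q ^ 3 * d ^ 6)⁻¹ * r ^ (-2 : ℝ) = (q ^ 3 * d ^ 6)⁻¹ * R⁻¹ := by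
      rw [integral_const_mul, integral_Ioi_rpow_of_lt (by norm_num) hR0]
      have : (-2 + 1 : ℝ) = -1 := by norm_num
      rw [this, Real.rpow_neg_one]
      ring
    rw [← hval, ofReal_integral_eq_lintegral_ofReal hpow
      ((ae_restrict_iff' measurableSet_Ioi).2 (ae_of_all _ fun r hr => by
        have : 0 < r := hR0.trans hr
        positivity))]
    refine setLIntegral_mono' measurableSet_Ioi fun r hr => ?_
    have hr0 : 0 < r := hR0.trans hr
    rw [← ENNReal.ofReal_pow (hmin0 r), ← ENNReal.ofReal_mul hr0.le]
    apply ENNReal.ofReal_le_ofReal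
    have := hmin0 r
    calc r * min A ((√(q * r))⁻¹ * d⁻¹) ^ 6 ≤ r * ((√(q * r))⁻¹ * d⁻¹) ^ 6 := by
          gcongr; exact min_le_right _ _
      _ = r * (((√(q * r)) ^ 2) ^ 3)⁻¹ * (d ^ 6)⁻¹ := by ring
      _ = _ := by
          rw [Real.sq_sqrt (by positivity), Real.rpow_neg hr0.le, Real.rpow_two]
          field_simp
  rw [← Ioc_union_Ioi_eq_Ioi hR0.le, lintegral_union measurableSet_Ioi
    (Ioc_disjoint_Ioi le_rfl)]
  refine (add_le_add h1 h2).trans (le_of_eq ?_)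
  rw [← ENNReal.ofReal_add (by positivity) (by positivity)]
  congr 1
  rw [hR]
  field_simp
  norm_num

/-- The radial weight `(1 + r)⁻¹ r^{-1/3}`. -/
def radialWeight (r : ℝ) : ℝ≥0∞ := ENNReal.ofReal ((1 + r)⁻¹ * r ^ (-(1 / 3) : ℝ))

lemma measurable_radialWeight : Measurable radialWeight :=
  ENNReal.measurable_ofReal.comp
    ((measurable_const.add measurable_id).inv.mul (measurable_id.pow_const _))

/-- This allows the single weight used for `L⁶` to serve the `L^∞` bound as well. -/
lemma ofReal_inv_one_add_pow_le {r : ℝ} (hr : 0 < r) :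
    ENNReal.ofReal ((1 + r) ^ 3)⁻¹ ≤ radialWeight r := by
  apply ENNReal.ofReal_le_ofReal
  have h1 : (1 + r) ^ (-(1 / 3) : ℝ) ≤ r ^ (-(1 / 3) : ℝ) :=
    Real.rpow_le_rpow_of_nonpos hr (by linarith) (by norm_num)
  have h2 : ((1 + r) ^ 2)⁻¹ ≤ (1 + r) ^ (-(1 / 3) : ℝ) := by
    rw [← Real.rpow_natCast, ← Real.rpow_neg (by positivity)]
    exact Real.rpow_le_rpow_of_exponent_le (by linarith) (by norm_num)
  calc ((1 + r) ^ 3)⁻¹ = (1 + r)⁻¹ * ((1 + r) ^ 2)⁻¹ := by rw [← mul_inv]; ring_nf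
    _ ≤ _ := by gcongr; exact h2.trans h1

/-- The integrand is comparable to `r^{1/3}` at the origin and to `r^{-5/3}` at infinity. Cubic
decay of the kernel in `r₁` is used here; quadratic decay would lead to the divergent `r⁻¹`. -/
lemma lintegral_radialWeight_sq_lt_top : ∫⁻ r, radialWeight r ^ 2 ∂radialMeasure < ⊤ := by
  rw [lintegral_radialMeasure (measurable_radialWeight.pow_const 2)]
  have e : ∀ r : ℝ, 0 < r → ENNReal.ofReal r * radialWeight r ^ 2 =
      ENNReal.ofReal (((1 + r) ^ 2)⁻¹ * r ^ (1 / 3 : ℝ)) := fun r hr => by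
    rw [radialWeight, ← ENNReal.ofReal_pow (by positivity), ← ENNReal.ofReal_mul hr.le]
    congr 1
    have h : r * (r ^ (-(1 / 3) : ℝ)) ^ 2 = r ^ (1 / 3 : ℝ) := by
      rw [← Real.rpow_natCast, ← Real.rpow_mul hr.le]
      nth_rewrite 1 [← Real.rpow_one r]
      rw [← Real.rpow_add hr]
      norm_num
    rw [mul_pow, mul_left_comm, h, inv_pow]
  have h1 : ∫⁻ r in Ioc (0 : ℝ) 1, ENNReal.ofReal r * radialWeight r ^ 2 ≤ 1 := by
    calc _ ≤ ∫⁻ _ in Ioc (0 : ℝ) 1, 1 := by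
          refine setLIntegral_mono' measurableSet_Ioc fun r hr => ?_
          rw [e r hr.1, ← ENNReal.ofReal_one]
          apply ENNReal.ofReal_le_ofReal
          have a1 : r ^ (1 / 3 : ℝ) ≤ 1 := Real.rpow_le_one hr.1.le hr.2 (by norm_num)
          have a2 : ((1 + r) ^ 2)⁻¹ ≤ 1 := inv_le_one_of_one_le₀ (by nlinarith [hr.1])
          have a3 : 0 ≤ r ^ (1 / 3 : ℝ) := Real.rpow_nonneg hr.1.le _
          exact mul_le_one₀ a2 a3 a1
      _ = 1 := by simp
  have h2 : ∫⁻ r in Ioi (1 : ℝ), ENNReal.ofReal r * radialWeight r ^ 2 < ⊤ := by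
    have hpow := integrableOn_Ioi_rpow_of_lt (by norm_num : (-(5 / 3) : ℝ) < -1) one_pos
    refine lt_of_le_of_lt (setLIntegral_mono' measurableSet_Ioi fun r hr => ?_)
      hpow.lintegral_lt_top
    have hr0 : 0 < r := one_pos.trans hr
    rw [e r hr0]
    apply ENNReal.ofReal_le_ofReal
    calc ((1 + r) ^ 2)⁻¹ * r ^ (1 / 3 : ℝ) ≤ (r ^ 2)⁻¹ * r ^ (1 / 3 : ℝ) := by gcongr; linarith
      _ = _ := by
          rw [← Real.rpow_natCast, ← Real.rpow_neg hr0.le, ← Real.rpow_add hr0]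
          norm_num
  rw [← Ioc_union_Ioi_eq_Ioi zero_le_one, lintegral_union measurableSet_Ioi
    (Ioc_disjoint_Ioi le_rfl)]
  exact ENNReal.add_lt_top.2 ⟨h1.trans_lt ENNReal.one_lt_top, h2⟩

/-- The majorant of the diffractive kernel. -/
def kernelMajorant {ρ : ℝ} (lam r₁ r₂ : ℝ) (z : AddCircle (2 * π * ρ)) : ℝ≥0∞ :=
  ENNReal.ofReal (min ((1 + r₁) ^ 3)⁻¹ ((√(lam * r₁ * r₂))⁻¹ * ‖z‖⁻¹))

lemma measurable_kernelMajorant {ρ : ℝ} (lam : ℝ) (θ : AddCircle (2 * π * ρ)) :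
    Measurable (Function.uncurry fun (x : Cone ρ) (r₂ : ℝ) =>
      kernelMajorant lam x.1 r₂ (θ - x.2)) := by
  have m1 : Measurable fun p : Cone ρ × ℝ => ((1 + p.1.1) ^ 3)⁻¹ :=
    (Continuous.measurable (by fun_prop : Continuous fun p : Cone ρ × ℝ => (1 + p.1.1) ^ 3)).inv
  have m2 : Measurable fun p : Cone ρ × ℝ => (√(lam * p.1.1 * p.2))⁻¹ :=
    (Continuous.measurable (by fun_prop :
      Continuous fun p : Cone ρ × ℝ => √(lam * p.1.1 * p.2))).inv
  have m3 : Measurable fun p : Cone ρ × ℝ => ‖θ - p.1.2‖⁻¹ :=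
    (Continuous.measurable (by fun_prop : Continuous fun p : Cone ρ × ℝ => ‖θ - p.1.2‖)).inv
  exact ENNReal.measurable_ofReal.comp (m1.min (m2.mul m3))

/-- The preceding radial integral with `A = (1 + r₁)⁻³`, `q = λ r₁`, `d = ‖z‖`. The bound `2A²/(q²
d⁴)` is `2/λ²` times the sixth power of a product of a function of `r₁` and a function of `z`. At `z
= 0` the majorant is zero by the convention `0⁻¹ = 0`. -/
lemma lintegral_kernelMajorant_pow_six_le {ρ lam r₁ : ℝ} (hlam : 0 < lam) (h₁ : 0 < r₁)
    (z : AddCircle (2 * π * ρ)) :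
    ∫⁻ r₂, kernelMajorant lam r₁ r₂ z ^ 6 ∂radialMeasure ≤
      ENNReal.ofReal (2 / lam ^ 2) * (radialWeight r₁ * fracKernel z) ^ 6 := by
  rcases (norm_nonneg z).eq_or_lt with hz | hz
  · have h0 : ∀ r₂, kernelMajorant lam r₁ r₂ z ^ 6 = 0 := fun r₂ => by
      rw [kernelMajorant, ← hz, inv_zero, mul_zero, min_eq_right (by positivity)]
      simp
    simp only [h0, lintegral_zero]
    exact zero_le
  · refine (lintegral_min_pow_six_le (A := ((1 + r₁) ^ 3)⁻¹) (by positivity)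
      (mul_pos hlam h₁) hz).trans (le_of_eq ?_)
    rw [radialWeight, fracKernel, ← ENNReal.ofReal_mul (by positivity),
      ← ENNReal.ofReal_pow (by positivity), ← ENNReal.ofReal_mul (by positivity)]
    congr 1
    have e1 : (r₁ ^ (-(1 / 3) : ℝ)) ^ 6 = (r₁ ^ 2)⁻¹ := by
      rw [← Real.rpow_natCast, ← Real.rpow_mul h₁.le, ← Real.rpow_natCast, ← Real.rpow_neg h₁.le]
      norm_num
    have e2 : (‖z‖ ^ (-(2 / 3) : ℝ)) ^ 6 = (‖z‖ ^ 4)⁻¹ := by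
      rw [← Real.rpow_natCast, ← Real.rpow_mul hz.le, ← Real.rpow_natCast, ← Real.rpow_neg hz.le]
      norm_num
    rw [mul_pow _ (‖z‖ ^ _), mul_pow (1 + r₁)⁻¹, e1, e2]
    field_simp

/-! ### The majorant operator from `L²` to `L⁶` -/

section Cone

variable {ρ : ℝ} [hρ : Fact (0 < ρ)]

lemma ae_coneMeasure_fst_pos : ∀ᵐ x ∂(coneMeasure ρ), 0 < x.1 := by
  rw [coneMeasure_eq]
  exact Measure.quasiMeasurePreserving_fst.ae ae_radialMeasure_pos

/-- Integration against the majorant maps `L²` to `L⁶` with norm `O(λ^{-1/3})`. -/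
lemma lintegral_kernelMajorant_le {lam : ℝ} (hlam : 0 < lam) {G : Cone ρ → ℝ≥0∞}
    (hG : Measurable G) :
    ∫⁻ θ : AddCircle (2 * π * ρ), ∫⁻ r₂, (∫⁻ x, kernelMajorant lam x.1 r₂ (θ - x.2) * G x
      ∂(coneMeasure ρ)) ^ 6 ∂radialMeasure ≤
      ENNReal.ofReal (2 / lam ^ 2) * (ENNReal.ofReal (6 * 26 ^ 6) *
        ((∫⁻ r, radialWeight r ^ 2 ∂radialMeasure) * ∫⁻ x, G x ^ 2 ∂(coneMeasure ρ)) ^ 3) := by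
  set f : AddCircle (2 * π * ρ) → ℝ≥0∞ := fun θ => ∫⁻ r, radialWeight r * G (r, θ) ∂radialMeasure
    with hf
  have hfm : Measurable f :=
    Measurable.lintegral_prod_left' (f := fun p : ℝ × AddCircle (2 * π * ρ) =>
      radialWeight p.1 * G p) ((measurable_radialWeight.comp measurable_fst).mul hG)
  have hκm : ∀ θ : AddCircle (2 * π * ρ),
      Measurable fun x : Cone ρ => radialWeight x.1 * fracKernel (θ - x.2) := fun θ =>
    (measurable_radialWeight.comp measurable_fst).mul
      (measurable_fracKernel.comp (measurable_const.sub measurable_snd))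
  have h1 : ∀ θ : AddCircle (2 * π * ρ), ∫⁻ r₂, (∫⁻ x, kernelMajorant lam x.1 r₂ (θ - x.2) * G x
      ∂(coneMeasure ρ)) ^ 6 ∂radialMeasure ≤
      ENNReal.ofReal (2 / lam ^ 2) * (∫⁻ θ₁, fracKernel (θ - θ₁) * f θ₁) ^ 6 := by
    intro θ
    -- Because the slice norm factors, integrating out `r₁` first turns the integral over the cone
    -- into the fractional integral of `f`.
    have e : ∫⁻ x, radialWeight x.1 * fracKernel (θ - x.2) * G x ∂(coneMeasure ρ) =
        ∫⁻ θ₁, fracKernel (θ - θ₁) * f θ₁ := by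
      have hm : Measurable fun x : Cone ρ => radialWeight x.1 * fracKernel (θ - x.2) * G x :=
        (hκm θ).mul hG
      rw [coneMeasure_eq, lintegral_prod_symm _ hm.aemeasurable]
      refine lintegral_congr fun θ₁ => ?_
      have hs : Measurable fun r => radialWeight r * G (r, θ₁) :=
        measurable_radialWeight.mul (hG.comp (measurable_id.prodMk measurable_const))
      rw [hf, ← lintegral_const_mul _ hs]
      refine lintegral_congr fun r => ?_
      ring
    rw [← e]
    have : SFinite (coneMeasure ρ) := by rw [coneMeasure_eq]; infer_instance
    refine lintegral_lintegral_mul_pow_six_le (μ := coneMeasure ρ) (ν := radialMeasure)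
      (k := fun (x : Cone ρ) r₂ => kernelMajorant lam x.1 r₂ (θ - x.2))
      (κ := fun x => radialWeight x.1 * fracKernel (θ - x.2))
      (measurable_kernelMajorant lam θ) (hκm θ) hG (ae_of_all _ fun x =>
        ENNReal.mul_ne_top ENNReal.ofReal_ne_top ENNReal.ofReal_ne_top) ?_ ?_
    -- The slice bound vanishes only on the diagonal `θ = x.2`, where the majorant is zero as well.
    · filter_upwards [ae_coneMeasure_fst_pos] with x hx h0 y
      have hw : radialWeight x.1 ≠ 0 := by
        rw [radialWeight, ENNReal.ofReal_ne_zero_iff]; positivity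
      have hz := (mul_eq_zero.1 h0).resolve_left hw
      have hz0 : ‖θ - x.2‖ = 0 := by
        by_contra hne
        have : 0 < ‖θ - x.2‖ := lt_of_le_of_ne (norm_nonneg _) (Ne.symm hne)
        rw [fracKernel, ENNReal.ofReal_eq_zero] at hz
        exact absurd hz (not_le.2 (by positivity))
      rw [kernelMajorant, hz0, inv_zero, mul_zero, min_eq_right (by positivity)]
      simp
    · filter_upwards [ae_coneMeasure_fst_pos] with x hx
      exact lintegral_kernelMajorant_pow_six_le hlam hx _
  have h2 : ∫⁻ θ, f θ ^ 2 ≤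
      (∫⁻ r, radialWeight r ^ 2 ∂radialMeasure) * ∫⁻ x, G x ^ 2 ∂(coneMeasure ρ) := by
    rw [coneMeasure_eq, lintegral_prod_symm _ (hG.pow_const 2).aemeasurable,
      ← lintegral_const_mul _ (Measurable.lintegral_prod_left'
        (f := fun p : ℝ × AddCircle (2 * π * ρ) => G p ^ 2) (hG.pow_const 2))]
    refine lintegral_mono fun θ => ?_
    exact lintegral_mul_sq_le measurable_radialWeight.aemeasurable
      (hG.comp (measurable_id.prodMk measurable_const)).aemeasurable
  have : Fact (0 < 2 * π * ρ) := conePeriodPos ρ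
  calc _ ≤ ∫⁻ θ, ENNReal.ofReal (2 / lam ^ 2) * (∫⁻ θ₁, fracKernel (θ - θ₁) * f θ₁) ^ 6 :=
        lintegral_mono h1
    _ = ENNReal.ofReal (2 / lam ^ 2) * ∫⁻ θ, (∫⁻ θ₁, fracKernel (θ - θ₁) * f θ₁) ^ 6 :=
        lintegral_const_mul _ ((measurable_fracIntegral hfm).pow_const 6)
    _ ≤ ENNReal.ofReal (2 / lam ^ 2) * (ENNReal.ofReal (6 * 26 ^ 6) * (∫⁻ θ, f θ ^ 2) ^ 3) := by
        gcongr
        exact lintegral_fracIntegral_pow_six_le hfm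
    _ ≤ _ := by gcongr

end Cone

/-! ### Operators on the cone with a dominated kernel -/

section ConeOperator

variable {ρ : ℝ} [hρ : Fact (0 < ρ)]

instance : SFinite (coneMeasure ρ) := by rw [coneMeasure_eq]; infer_instance

lemma volume_univ_coneCircle :
    (volume : Measure (AddCircle (2 * π * ρ))) univ = ENNReal.ofReal (2 * π * ρ) := by
  have : Fact (0 < 2 * π * ρ) := conePeriodPos ρ
  exact AddCircle.measure_univ _

lemma lintegral_coneMeasure_radialWeight_sq :
    ∫⁻ x, radialWeight x.1 ^ 2 ∂(coneMeasure ρ) =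
      (∫⁻ r, radialWeight r ^ 2 ∂radialMeasure) * ENNReal.ofReal (2 * π * ρ) := by
  have hm : Measurable fun x : Cone ρ => radialWeight x.1 ^ 2 :=
    (measurable_radialWeight.comp measurable_fst).pow_const 2
  rw [coneMeasure_eq, lintegral_prod _ hm.aemeasurable]
  simp_rw [lintegral_const, volume_univ_coneCircle]
  exact lintegral_mul_const _ (measurable_radialWeight.pow_const 2)

variable {k : Cone ρ × Cone ρ → ℂ} {C lam : ℝ}

/-- Cauchy-Schwarz for a kernel with radial decay. -/
lemma lintegral_enorm_kernel_mul_sq_le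
    (hkw : ∀ y x : Cone ρ, 0 < y.1 → 0 < x.1 → ‖k (y, x)‖ ≤ C * ((1 + x.1) ^ 3)⁻¹)
    (hC : 0 ≤ C) {G : Cone ρ → ℝ≥0∞} (hG : Measurable G) {y : Cone ρ} (hy : 0 < y.1) :
    (∫⁻ x, ‖k (y, x)‖ₑ * G x ∂(coneMeasure ρ)) ^ 2 ≤
      ENNReal.ofReal C ^ 2 * (((∫⁻ r, radialWeight r ^ 2 ∂radialMeasure) *
        ENNReal.ofReal (2 * π * ρ)) * ∫⁻ x, G x ^ 2 ∂(coneMeasure ρ)) := by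
  have h1 : ∫⁻ x, ‖k (y, x)‖ₑ * G x ∂(coneMeasure ρ) ≤
      ENNReal.ofReal C * ∫⁻ x, radialWeight x.1 * G x ∂(coneMeasure ρ) := by
    rw [← lintegral_const_mul' _ _ ENNReal.ofReal_ne_top]
    refine lintegral_mono_ae ?_
    filter_upwards [ae_coneMeasure_fst_pos] with x hx
    rw [← mul_assoc]
    gcongr
    rw [← ofReal_norm]
    refine (ENNReal.ofReal_le_ofReal (hkw y x hy hx)).trans ?_
    rw [ENNReal.ofReal_mul hC]
    gcongr
    exact ofReal_inv_one_add_pow_le hx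
  calc _ ≤ (ENNReal.ofReal C * ∫⁻ x, radialWeight x.1 * G x ∂(coneMeasure ρ)) ^ 2 := by gcongr
    _ = ENNReal.ofReal C ^ 2 * (∫⁻ x, radialWeight x.1 * G x ∂(coneMeasure ρ)) ^ 2 := mul_pow _ _ _
    _ ≤ _ := by
        rw [← lintegral_coneMeasure_radialWeight_sq]
        gcongr
        exact lintegral_mul_sq_le (measurable_radialWeight.comp measurable_fst).aemeasurable
          hG.aemeasurable

lemma measurable_lintegral_enorm_kernel_mul (hk : Measurable k) {G : Cone ρ → ℝ≥0∞}
    (hG : Measurable G) : Measurable fun y => ∫⁻ x, ‖k (y, x)‖ₑ * G x ∂(coneMeasure ρ) :=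
  Measurable.lintegral_prod_right' (f := fun p : Cone ρ × Cone ρ => ‖k p‖ₑ * G p.2)
    (hk.enorm.mul (hG.comp measurable_snd))

/-- The sixth moment bound for a kernel dominated by the majorant. -/
lemma lintegral_enorm_kernel_mul_pow_six_le (hk : Measurable k)
    (hkw : ∀ y x : Cone ρ, 0 < y.1 → 0 < x.1 → ‖k (y, x)‖ ≤ C * ((1 + x.1) ^ 3)⁻¹)
    (hks : ∀ y x : Cone ρ, 0 < y.1 → 0 < x.1 →
      ‖k (y, x)‖ ≤ C * ((√(lam * x.1 * y.1))⁻¹ * ‖y.2 - x.2‖⁻¹))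
    (hC : 0 ≤ C) (hlam : 0 < lam) {G : Cone ρ → ℝ≥0∞} (hG : Measurable G) :
    ∫⁻ y, (∫⁻ x, ‖k (y, x)‖ₑ * G x ∂(coneMeasure ρ)) ^ 6 ∂(coneMeasure ρ) ≤
      ENNReal.ofReal C ^ 6 * (ENNReal.ofReal (2 / lam ^ 2) * (ENNReal.ofReal (6 * 26 ^ 6) *
        ((∫⁻ r, radialWeight r ^ 2 ∂radialMeasure) * ∫⁻ x, G x ^ 2 ∂(coneMeasure ρ)) ^ 3)) := by
  have hmaj : ∀ y : Cone ρ, 0 < y.1 → (∫⁻ x, ‖k (y, x)‖ₑ * G x ∂(coneMeasure ρ)) ^ 6 ≤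
      ENNReal.ofReal C ^ 6 *
        (∫⁻ x, kernelMajorant lam x.1 y.1 (y.2 - x.2) * G x ∂(coneMeasure ρ)) ^ 6 := by
    intro y hy
    rw [← mul_pow, ← lintegral_const_mul' _ _ ENNReal.ofReal_ne_top]
    refine pow_le_pow_left' (lintegral_mono_ae ?_) 6
    filter_upwards [ae_coneMeasure_fst_pos] with x hx
    rw [← mul_assoc, kernelMajorant, ← ENNReal.ofReal_mul hC, ← ofReal_norm,
      mul_min_of_nonneg _ _ hC]
    gcongr
    exact le_min (hkw y x hy hx) (hks y x hy hx)
  have hm := (measurable_lintegral_enorm_kernel_mul hk hG).pow_const 6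
  -- The radial integral is placed innermost: Minkowski acts in `r₂` at fixed angle, and fractional
  -- integration acts afterwards in the angle.
  calc _ = ∫⁻ θ : AddCircle (2 * π * ρ), ∫⁻ r, (∫⁻ x, ‖k ((r, θ), x)‖ₑ * G x
        ∂(coneMeasure ρ)) ^ 6 ∂radialMeasure := by
        conv_lhs => rw [coneMeasure_eq]
        exact lintegral_prod_symm _ hm.aemeasurable
    _ ≤ ∫⁻ θ : AddCircle (2 * π * ρ), ENNReal.ofReal C ^ 6 * ∫⁻ r,
        (∫⁻ x, kernelMajorant lam x.1 r (θ - x.2) * G x ∂(coneMeasure ρ)) ^ 6 ∂radialMeasure := by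
        refine lintegral_mono fun θ => ?_
        rw [← lintegral_const_mul' _ _ (ENNReal.pow_ne_top ENNReal.ofReal_ne_top)]
        refine lintegral_mono_ae ?_
        filter_upwards [ae_radialMeasure_pos] with r hr
        exact hmaj (r, θ) hr
    _ = ENNReal.ofReal C ^ 6 * ∫⁻ θ : AddCircle (2 * π * ρ), ∫⁻ r,
        (∫⁻ x, kernelMajorant lam x.1 r (θ - x.2) * G x ∂(coneMeasure ρ)) ^ 6 ∂radialMeasure :=
        lintegral_const_mul' _ _ (ENNReal.pow_ne_top ENNReal.ofReal_ne_top)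
    _ ≤ _ := by
        gcongr
        exact lintegral_kernelMajorant_le hlam hG

lemma lintegral_enorm_sq_eq_eLpNorm_two_sq {X : Type*} [MeasurableSpace X] {μ : Measure X}
    (g : X → ℂ) : ∫⁻ x, ‖g x‖ₑ ^ 2 ∂μ = eLpNorm g 2 μ ^ 2 := by
  have h := eLpNorm_nnreal_pow_eq_lintegral (f := g) (μ := μ) (p := 2) (by norm_num)
  simpa using h.symm

lemma lintegral_enorm_pow_six_eq_eLpNorm_six_pow {X : Type*} [MeasurableSpace X] {μ : Measure X}
    (g : X → ℂ) : ∫⁻ x, ‖g x‖ₑ ^ 6 ∂μ = eLpNorm g 6 μ ^ 6 := by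
  have h := eLpNorm_nnreal_pow_eq_lintegral (f := g) (μ := μ) (p := 6) (by norm_num)
  have e : ∀ z : ℝ≥0∞, z ^ (6 : ℝ) = z ^ 6 := fun z => by
    rw [← ENNReal.rpow_natCast]; norm_num
  simpa [e] using h.symm

variable {g : Cone ρ → ℂ}

lemma enorm_integral_kernel_mul_le (y : Cone ρ) :
    ‖∫ x, k (y, x) * g x ∂(coneMeasure ρ)‖ₑ ≤ ∫⁻ x, ‖k (y, x)‖ₑ * ‖g x‖ₑ ∂(coneMeasure ρ) := by
  refine (enorm_integral_le_lintegral_enorm _).trans (le_of_eq ?_)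
  simp only [enorm_mul]

lemma integrable_kernel_mul (hk : Measurable k)
    (hkw : ∀ y x : Cone ρ, 0 < y.1 → 0 < x.1 → ‖k (y, x)‖ ≤ C * ((1 + x.1) ^ 3)⁻¹)
    (hC : 0 ≤ C) (hg : Measurable g) (hg2 : eLpNorm g 2 (coneMeasure ρ) < ⊤)
    {y : Cone ρ} (hy : 0 < y.1) : Integrable (fun x => k (y, x) * g x) (coneMeasure ρ) := by
  have hm : Measurable fun x => k (y, x) * g x :=
    (hk.comp (measurable_const.prodMk measurable_id)).mul hg
  refine ⟨hm.aestronglyMeasurable, ?_⟩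
  have h := lintegral_enorm_kernel_mul_sq_le hkw hC hg.enorm hy
  rw [lintegral_enorm_sq_eq_eLpNorm_two_sq] at h
  have hfin : (∫⁻ x, ‖k (y, x)‖ₑ * ‖g x‖ₑ ∂(coneMeasure ρ)) ^ 2 < ⊤ :=
    h.trans_lt (ENNReal.mul_lt_top (ENNReal.pow_lt_top ENNReal.ofReal_lt_top)
      (ENNReal.mul_lt_top (ENNReal.mul_lt_top lintegral_radialWeight_sq_lt_top
        ENNReal.ofReal_lt_top) (ENNReal.pow_lt_top hg2)))
  rw [HasFiniteIntegral]
  simp only [enorm_mul]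
  exact (ENNReal.pow_lt_top_iff.1 hfin).resolve_right (by norm_num)

/-- The operator with a dominated kernel is bounded from `L²` to `L^∞`. -/
lemma eLpNorm_top_integral_kernel_mul_le
    (hkw : ∀ y x : Cone ρ, 0 < y.1 → 0 < x.1 → ‖k (y, x)‖ ≤ C * ((1 + x.1) ^ 3)⁻¹)
    (hC : 0 ≤ C) (hg : Measurable g) :
    eLpNorm (fun y => ∫ x, k (y, x) * g x ∂(coneMeasure ρ)) ⊤ (coneMeasure ρ) ≤
      ENNReal.ofReal (52 * C * (1 + (∫⁻ r, radialWeight r ^ 2 ∂radialMeasure).toReal) *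
        (1 + 2 * π * ρ)) * eLpNorm g 2 (coneMeasure ρ) := by
  set H := (∫⁻ r, radialWeight r ^ 2 ∂radialMeasure).toReal with hH
  have hHe : ∫⁻ r, radialWeight r ^ 2 ∂radialMeasure = ENNReal.ofReal H :=
    (ENNReal.ofReal_toReal lintegral_radialWeight_sq_lt_top.ne).symm
  have hH0 : 0 ≤ H := ENNReal.toReal_nonneg
  have hP : 0 < 2 * π * ρ := by have := hρ.out; positivity
  rw [eLpNorm_exponent_top]
  refine eLpNormEssSup_le_of_ae_enorm_bound ?_
  filter_upwards [ae_coneMeasure_fst_pos] with y hy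
  refine (enorm_integral_kernel_mul_le y).trans ?_
  rw [← ENNReal.pow_le_pow_left_iff two_ne_zero]
  refine (lintegral_enorm_kernel_mul_sq_le hkw hC hg.enorm hy).trans ?_
  rw [lintegral_enorm_sq_eq_eLpNorm_two_sq, hHe, mul_pow, ← mul_assoc,
    ← ENNReal.ofReal_pow hC, ← ENNReal.ofReal_mul hH0, ← ENNReal.ofReal_mul (by positivity),
    ← ENNReal.ofReal_pow (by positivity)]
  gcongr
  have e1 : H * (2 * π * ρ) ≤ ((1 + H) * (1 + 2 * π * ρ)) ^ 2 := by
    calc H * (2 * π * ρ) ≤ (1 + H) * (1 + 2 * π * ρ) := by gcongr <;> linarith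
      _ ≤ _ := le_self_pow₀ (one_le_mul_of_one_le_of_one_le (by linarith) (by linarith)) two_ne_zero
  -- The factor 52 is not needed here; it makes the constant the same for both exponents.
  calc C ^ 2 * (H * (2 * π * ρ)) ≤ (52 * C) ^ 2 * ((1 + H) * (1 + 2 * π * ρ)) ^ 2 := by
        gcongr; linarith
    _ = _ := by ring

/-- The operator with a dominated kernel is bounded from `L²` to `L⁶` with norm `O(λ^{-1/3})`. -/
lemma eLpNorm_six_integral_kernel_mul_le (hk : Measurable k)
    (hkw : ∀ y x : Cone ρ, 0 < y.1 → 0 < x.1 → ‖k (y, x)‖ ≤ C * ((1 + x.1) ^ 3)⁻¹)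
    (hks : ∀ y x : Cone ρ, 0 < y.1 → 0 < x.1 →
      ‖k (y, x)‖ ≤ C * ((√(lam * x.1 * y.1))⁻¹ * ‖y.2 - x.2‖⁻¹))
    (hC : 0 ≤ C) (hlam : 0 < lam) (hg : Measurable g) :
    eLpNorm (fun y => ∫ x, k (y, x) * g x ∂(coneMeasure ρ)) 6 (coneMeasure ρ) ≤
      ENNReal.ofReal (52 * C * (1 + (∫⁻ r, radialWeight r ^ 2 ∂radialMeasure).toReal) *
        (1 + 2 * π * ρ) * lam ^ (-(1 / 3) : ℝ)) * eLpNorm g 2 (coneMeasure ρ) := by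
  set H := (∫⁻ r, radialWeight r ^ 2 ∂radialMeasure).toReal with hH
  have hHe : ∫⁻ r, radialWeight r ^ 2 ∂radialMeasure = ENNReal.ofReal H :=
    (ENNReal.ofReal_toReal lintegral_radialWeight_sq_lt_top.ne).symm
  have hH0 : 0 ≤ H := ENNReal.toReal_nonneg
  have hP : 0 < 2 * π * ρ := by have := hρ.out; positivity
  rw [← ENNReal.pow_le_pow_left_iff (by norm_num : 6 ≠ 0),
    ← lintegral_enorm_pow_six_eq_eLpNorm_six_pow]
  have h1 := lintegral_mono (μ := coneMeasure ρ) fun y =>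
    pow_le_pow_left' (enorm_integral_kernel_mul_le (k := k) (g := g) y) 6
  refine (h1.trans (lintegral_enorm_kernel_mul_pow_six_le hk hkw hks hC hlam hg.enorm)).trans ?_
  rw [lintegral_enorm_sq_eq_eLpNorm_two_sq, hHe, mul_pow, mul_pow _ _ 6, ← pow_mul,
    ← ENNReal.ofReal_pow hC, ← ENNReal.ofReal_pow hH0, ← ENNReal.ofReal_pow (by positivity),
    ← mul_assoc, ← mul_assoc, ← mul_assoc, ← ENNReal.ofReal_mul (by positivity),
    ← ENNReal.ofReal_mul (by positivity), ← ENNReal.ofReal_mul (by positivity)]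
  gcongr
  have e1 : (lam ^ (-(1 / 3) : ℝ)) ^ 6 = (lam ^ 2)⁻¹ := by
    rw [← Real.rpow_natCast, ← Real.rpow_mul hlam.le, ← Real.rpow_natCast,
      ← Real.rpow_neg hlam.le]
    norm_num
  have e2 : H ^ 3 ≤ (1 + H) ^ 6 :=
    (pow_le_pow_left₀ hH0 (by linarith) 3).trans (pow_le_pow_right₀ (by linarith) (by norm_num))
  have e3 : 1 ≤ (1 + 2 * π * ρ) ^ 6 := one_le_pow₀ (by linarith)
  calc C ^ 6 * (2 / lam ^ 2) * (6 * 26 ^ 6) * H ^ 3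
      = (12 * 26 ^ 6) * C ^ 6 * H ^ 3 * 1 * (lam ^ 2)⁻¹ := by ring
    -- `52 = 2 · 26`, and `2⁶ = 64` absorbs the factor 12.
    _ ≤ 52 ^ 6 * C ^ 6 * (1 + H) ^ 6 * (1 + 2 * π * ρ) ^ 6 * (lam ^ 2)⁻¹ := by
        gcongr
        norm_num
    _ = _ := by rw [← e1]; ring

lemma aestronglyMeasurable_integral_kernel_mul (hk : Measurable k) (hg : Measurable g) :
    AEStronglyMeasurable (fun y => ∫ x, k (y, x) * g x ∂(coneMeasure ρ)) (coneMeasure ρ) :=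
  (StronglyMeasurable.integral_prod_right' (f := fun p : Cone ρ × Cone ρ => k p * g p.2)
    (hk.mul (hg.comp measurable_snd)).stronglyMeasurable).aestronglyMeasurable

/-- Mapping properties of an integral operator on the cone with a dominated kernel. -/
lemma kernel_operator_bounds (hk : Measurable k)
    (hkw : ∀ y x : Cone ρ, 0 < y.1 → 0 < x.1 → ‖k (y, x)‖ ≤ C * ((1 + x.1) ^ 3)⁻¹)
    (hks : ∀ y x : Cone ρ, 0 < y.1 → 0 < x.1 →
      ‖k (y, x)‖ ≤ C * ((√(lam * x.1 * y.1))⁻¹ * ‖y.2 - x.2‖⁻¹))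
    (hC : 0 ≤ C) (hlam : 0 < lam) (hg : MemLp g 2 (coneMeasure ρ)) {p : ℝ≥0∞}
    (hp : p = 6 ∨ p = ⊤) :
    (∀ᵐ y ∂(coneMeasure ρ), Integrable (fun x => k (y, x) * g x) (coneMeasure ρ)) ∧
      MemLp (fun y => ∫ x, k (y, x) * g x ∂(coneMeasure ρ)) p (coneMeasure ρ) ∧
      eLpNorm (fun y => ∫ x, k (y, x) * g x ∂(coneMeasure ρ)) p (coneMeasure ρ) ≤
        ENNReal.ofReal (52 * C * (1 + (∫⁻ r, radialWeight r ^ 2 ∂radialMeasure).toReal) *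
          (1 + 2 * π * ρ) * lam ^ (-(2 / p).toReal)) * eLpNorm g 2 (coneMeasure ρ) := by
  -- A measurable representative of `g` changes neither the integrals in `x` at any `y` nor the
  -- norms, so the operator is unchanged everywhere.
  obtain ⟨g', hg', hgg'⟩ := hg.1
  have hg'm : Measurable g' := hg'.measurable
  have hprod : ∀ y, (fun x => k (y, x) * g x) =ᵐ[coneMeasure ρ] fun x => k (y, x) * g' x :=
    fun y => by filter_upwards [hgg'] with x hx using by rw [hx]
  have hop : (fun y => ∫ x, k (y, x) * g x ∂(coneMeasure ρ)) =
      fun y => ∫ x, k (y, x) * g' x ∂(coneMeasure ρ) :=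
    funext fun y => integral_congr_ae (hprod y)
  have hg2 : eLpNorm g' 2 (coneMeasure ρ) < ⊤ := eLpNorm_congr_ae hgg' ▸ hg.2
  have hbound : eLpNorm (fun y => ∫ x, k (y, x) * g' x ∂(coneMeasure ρ)) p (coneMeasure ρ) ≤
        ENNReal.ofReal (52 * C * (1 + (∫⁻ r, radialWeight r ^ 2 ∂radialMeasure).toReal) *
          (1 + 2 * π * ρ) * lam ^ (-(2 / p).toReal)) * eLpNorm g' 2 (coneMeasure ρ) := by
    rcases hp with rfl | rfl
    · have e : -(2 / 6 : ℝ≥0∞).toReal = -(1 / 3) := by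
        rw [ENNReal.toReal_div]; norm_num
      rw [e]
      exact eLpNorm_six_integral_kernel_mul_le hk hkw hks hC hlam hg'm
    · simpa using eLpNorm_top_integral_kernel_mul_le hkw hC hg'm
  rw [hop, eLpNorm_congr_ae hgg']
  refine ⟨?_, ⟨aestronglyMeasurable_integral_kernel_mul hk hg'm,
    hbound.trans_lt (ENNReal.mul_lt_top ENNReal.ofReal_lt_top hg2)⟩, hbound⟩
  filter_upwards [ae_coneMeasure_fst_pos] with y hy
  exact (integrable_kernel_mul hk hkw hC hg'm hg2 hy).congr (hprod y).symm

end ConeOperator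

end

/-! ### Conclusion -/

theorem mainTheorem3 (ρ : ℝ) [Fact (0 < ρ)] (δ : ℝ) (hδ : 0 < δ)
    (χ : 𝓢(ℝ, ℝ)) (hχ : IsSpectralCutoff δ χ)
    (ψ : ℝ → ℝ) (hψ : IsUnitBump ψ)
    (b : ℝ → ℂ) (hb : IsBesselAmplitude b)
    (p : ℝ≥0∞) (hp : p = 6 ∨ p = ⊤) :
    (∀ lam : ℝ, 1 ≤ lam → ∀ r₁ r₂ : ℝ, 0 < r₁ → 0 < r₂ → ∀ θ : ℝ,
      IntegrableOn (diffIntegrand ρ χ ψ b lam r₁ r₂ θ) (Ioi 0)) ∧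
    ∃ C : ℝ, 0 < C ∧ ∀ lam : ℝ, 1 ≤ lam → ∀ g : Cone ρ → ℂ, MemLp g 2 (coneMeasure ρ) →
      (∀ᵐ y ∂(coneMeasure ρ), Integrable
        (fun x => diffKernelCircle ρ χ ψ b lam x.1 y.1 (y.2 - x.2) * g x) (coneMeasure ρ)) ∧
      MemLp (diffOperator ρ χ ψ b lam g) p (coneMeasure ρ) ∧
      eLpNorm (diffOperator ρ χ ψ b lam g) p (coneMeasure ρ) ≤
        ENNReal.ofReal (C * lam ^ (-(2 / p).toReal)) * eLpNorm g 2 (coneMeasure ρ) := by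
  have hρ : 0 < ρ := Fact.out
  refine ⟨fun lam hlam r₁ r₂ h₁ h₂ θ => integrableOn_diffIntegrand hδ hχ hψ hb hρ hlam h₁ h₂ θ, ?_⟩
  obtain ⟨C, hC, hbound⟩ := exists_norm_diffKernelCircle_le hδ hχ hψ hb ρ
  refine ⟨52 * C * (1 + (∫⁻ r, radialWeight r ^ 2 ∂radialMeasure).toReal) * (1 + 2 * π * ρ),
    by positivity, fun lam hlam g hg => ?_⟩
  have hlam0 : 0 < lam := one_pos.trans_le hlam
  exact kernel_operator_bounds (measurable_diffKernelCircle hχ hψ hb ρ hlam0)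
    (fun y x hy hx => (hbound lam x.1 y.1 hlam hx hy (y.2 - x.2)).1)
    (fun y x hy hx => (hbound lam x.1 y.1 hlam hx hy (y.2 - x.2)).2) hC.le hlam0 hg hp
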